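/- **Setting.** Let $(\mathbf g_i)_{i\ge1}$ (zero mean, values in $\mathbb C^K$) and $(\mathbf y_i)_{i\ge1}$ (values in $\mathbb C^L$) be square-integrable processes with $\mathbb E\{\mathbf g_{i}\mathbf g_{j}^H\}=C_g\,c[i-j]$ and $\mathbb E\{\mathbf y_{i}\mathbf y_{j}^H\}=C_y\,c[i-j]$, where $C_y$ is positive definite, $c$ is absolutely summable, $c[0]=1$, and $S(\omega)=\sum_\tau c[\tau]e^{-j\omega\tau}$. Assume that there is a matrix $\Gamma\neq0$ such that, for all $i\le N$, the MMSE estimate of $\mathbf g_i$ from $\mathbf y_1,\dots,\mathbf y_N$ is $\mathbb E\{\mathbf g_i\mid \mathbf y_1,\dots,\mathbf y_N\}=\Gamma\mathbf y_i$. Put $\mu^{\rm MMSE}=\frac1K{\rm Tr}(C_g-\Gamma C_y\Gamma^H)$, $\tilde\Gamma=\Gamma C_y^{1/2}$, and let $\phi_1\ge\phi_2\ge\dots$ be the singular values of $\tilde\Gamma$ (extended by $0$). For $N\ge1$ let $\Sigma=\Sigma_N=(c[i-j])_{i,j\le N}$, $\underline{\mathbf g}={\rm vec}([\mathbf g_1,\dots,\mathbf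 g_N]^T)$, $\underline{\mathbf y}={\rm vec}([\mathbf y_1,\dots,\mathbf y_N]^T)$, and let $\sigma_1\ge\sigma_2\ge\dots$ be the singular values of $\tilde\Gamma\otimes\Sigma^{1/2}$ (extended by $0$). Put $\varphi(\alpha)=(\alpha-1)^+$. **Systems.** Given a rate $R$ and $1\le P\le LN$, let $r=P/(LN)$, $M=\lfloor2^{R/(2r)}\rfloor$, $0<\eta<\sqrt{3/2}\,M$ and $\kappa=\eta^2\big(1-\frac{2\eta^2}{3M^2}\big)^{-1}$. A hardware-limited system consists of matrices $A\in\mathbb C^{P\times LN}$, $B\in\mathbb C^{KN\times P}$ and $P$ identical dithered uniform ADCs with resolution $M$ and support $\gamma$, $\gamma^2=\kappa\max_l\mathbb E|(A\underline{\mathbf y})_l|^2$, i.e. spacing $\Delta=2\gamma/M$. In the operating range of the ADCs their output is $\mathbf q=A\underline{\mathbf y}+\mathbf e$, where $\mathbf e$ has zero mean, is white with $\mathbb E\{\mathbf e\mathbf e^H\}=\frac{\Delta^2}{3}I=\frac{4\gamma^2}{3M^2}I$, and is uncorrelated with $\underline{\mathbf g},\underline{\mathbf y}$. (In particular, the output of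 uniform mid-rise quantizers with $M\ge2$ levels and $\gamma>0$, with non-subtractive dither whose real and imaginary parts are i.i.d. uniform on $[-\Delta/2,\Delta/2]$ and independent of the signals, is of this form whenever almost surely no quantizer is overloaded and each complex entry has mean squared error $\Delta^2/3$.) The estimate of $\underline{\mathbf g}$ is $B\mathbf q$, and the average MSE is $\frac1{KN}\mathbb E\|\underline{\mathbf g}-B\mathbf q\|^2$. **Theorem (optimal design).** For all such $N,P$ there is exactly one $\zeta>0$ with $\frac{4\kappa}{3M^2P}\sum_{l=1}^P\varphi(\zeta\sigma_l)=1$. The average MSE is minimal among all systems (all $A$, $B$) for $$A^{\rm o}=U\,\Lambda\,\Pi\,\big(V^HC_y^{-1/2}\otimes Q^H\Sigma^{-1/2}\big),\qquad B^{\rm o}=(\Gamma C_y\otimes\Sigma)(A^{\rm o})^H\Big(A^{\rm o}(C_y\otimes\Sigma)(A^{\rm o})^H+\tfrac{4\gamma^2}{3M^2}I\Big)^{-1},\qquad\gamma^2=\frac{\kappa}{r},$$ and the support of the ADCs in this system is indeed given by $\gamma^2=\kappa/r$. Here $V\in\mathbb C^{L\times L}$ is any right singular vectors matrix of $\tilde\Gamma$;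 $Q\in\mathbb C^{N\times N}$ is any unitary matrix of eigenvectors of $\Sigma$, with eigenvalues $\lambda_1,\dots,\lambda_N$; $\Pi$ is any permutation matrix that sorts the products $\phi_i\sqrt{\lambda_k}$ in descending order; $\Lambda\in\mathbb C^{P\times LN}$ is diagonal with $(\Lambda)_{l,l}^2=\frac{4\kappa}{3M^2r}\varphi(\zeta\sigma_l)$; and $U\in\mathbb C^{P\times P}$ is any unitary matrix for which $U\Lambda\Lambda^HU^H$ has identical diagonal entries. Such $V,Q,\Pi,\Lambda,U$ exist. **Theorem (asymptotic performance).** Let $N\to\infty$ along a sequence, with $1\le P\le LN$, with $P_q=\lfloor P/N\rfloor$ and $M$ constant along the sequence, $0<\eta<\sqrt{3/2}\,M$, and $P/(LN)\to r>0$. 1. If $P_q\ge{\rm rank}(\Gamma C_y\Gamma^H)$, then the waterfilling levels $\zeta$ converge to a limit, again denoted $\zeta>0$, with $\frac{4\kappa}{3M^2rL}\,\frac1{2\pi}\int_0^{2\pi}\sum_{i=1}^K\varphi(\zeta\phi_i\sqrt{S(\omega)})\,d\omega=1$, and the average MSE of the optimal design converges to $$\mu^{\rm HL}=\mu^{\rm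 MMSE}+\frac1{2\pi}\int_0^{2\pi}\frac1K\sum_{i=1}^K\frac{\phi_i^2S(\omega)}{\varphi(\zeta\phi_i\sqrt{S(\omega)})+1}\,d\omega .$$ 2. If $c[\tau]=\delta_\tau$, then for every $P_q\ge0$ the waterfilling levels converge to some $\zeta>0$ with $\frac{4\kappa}{3M^2rL}\Big(\sum_{i=1}^{P_q}\varphi(\zeta\phi_i)+(rL-P_q)\varphi(\zeta\phi_{P_q+1})\Big)=1$, and the average MSE of the optimal design converges to $$\mu^{\rm HL}=\mu^{\rm MMSE}+\frac1K\sum_{i=1}^{\min(K,P_q)}\frac{\phi_i^2}{\varphi(\zeta\phi_i)+1}+\frac{\delta_{(P_q<K)}}{K}\Big(\sum_{i=P_q+1}^K\phi_i^2-(rL-P_q)\frac{\phi_{P_q+1}^2\,\varphi(\zeta\phi_{P_q+1})}{\varphi(\zeta\phi_{P_q+1})+1}\Big).$$ -/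

import Mathlib

open MeasureTheory ProbabilityTheory Filter Topology
open scoped Kronecker MatrixOrder ComplexConjugate ComplexOrder

namespace TaskQuant

/-! ### Signals -/

/-- The desired process `g` (values in `ℂ^K`) and the observed process `y` (values in `ℂ^L`).
Both have separable second-order statistics with the same absolutely summable scalar
autocorrelation `c`, and the MMSE estimate of `g i` from `y 0, …, y (N-1)` is `Γ y i`. -/
structure SignalModel {Ω : Type*} [MeasurableSpace Ω] (μ : Measure Ω) {K L : ℕ}
    (g : ℕ → Ω → Fin K → ℂ) (y : ℕ → Ω → Fin L → ℂ)
    (Cg : Matrix (Fin K) (Fin K) ℂ) (Cy : Matrix (Fin L) (Fin L) ℂ)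
    (Γ : Matrix (Fin K) (Fin L) ℂ) (c : ℤ → ℂ) : Prop where
  measurable_g : ∀ i, Measurable (g i)
  measurable_y : ∀ i, Measurable (y i)
  memLp_g : ∀ i k, MemLp (fun ω => g i ω k) 2 μ
  memLp_y : ∀ i l, MemLp (fun ω => y i ω l) 2 μ
  mean_g : ∀ i k, ∫ ω, g i ω k ∂μ = 0
  summable_c : Summable fun τ => ‖c τ‖
  c_zero : c 0 = 1
  corr_g : ∀ i j k k', ∫ ω, g i ω k * conj (g j ω k') ∂μ = Cg k k' * c ((i : ℤ) - j)
  corr_y : ∀ i j l l', ∫ ω, y i ω l * conj (y j ω l') ∂μ = Cy l l' * c ((i : ℤ) - j)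
  mmse : ∀ N i, i < N → ∀ k,
    μ[fun ω => g i ω k |
        MeasurableSpace.comap (fun ω (j : Fin N) => y (j : ℕ) ω) inferInstance]
      =ᵐ[μ] fun ω => (Γ.mulVec (y i ω)) k

/-- `vec([x_1, …, x_N]ᵀ)`: the entry with index `(k, i)` is the `k`-th coordinate of the `i`-th
vector. -/
def stack {Ω : Type*} {m : ℕ} (x : ℕ → Ω → Fin m → ℂ) (N : ℕ) (ω : Ω) : Fin m × Fin N → ℂ :=
  fun p => x (p.2 : ℕ) ω p.1

/-- The `N × N` Toeplitz matrix of the autocorrelation. -/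
def toeplitz (c : ℤ → ℂ) (N : ℕ) : Matrix (Fin N) (Fin N) ℂ :=
  Matrix.of fun i j => c ((i : ℤ) - (j : ℤ))

/-- The power spectral density: the discrete-time Fourier transform of the autocorrelation. -/
noncomputable def psd (c : ℤ → ℂ) (w : ℝ) : ℝ :=
  (∑' τ : ℤ, c τ * Complex.exp (-(Complex.I * w * τ))).re

/-- The average MMSE without quantization, `Tr (C_g - Γ C_y Γᴴ) / K`. -/
noncomputable def mmseValue {K L : ℕ} (Cg : Matrix (Fin K) (Fin K) ℂ)
    (Cy : Matrix (Fin L) (Fin L) ℂ) (Γ : Matrix (Fin K) (Fin L) ℂ) : ℝ :=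
  (1 / (K : ℝ)) * (Cg - Γ * Cy * Γ.conjTranspose).trace.re

/-! ### The scalar quantizers -/

/-- The analog combining ratio `r = P / (L N)`. -/
noncomputable def ratio (L N P : ℕ) : ℝ := (P : ℝ) / ((L : ℝ) * N)

/-- The resolution `⌊2 ^ (R / (2 r))⌋` of each scalar quantizer. -/
noncomputable def resolution (R r : ℝ) : ℕ := ⌊(2 : ℝ) ^ (R / (2 * r))⌋₊

/-- `κ = η² (1 - 2 η² / (3 M²))⁻¹`. -/
noncomputable def kappa (η : ℝ) (M : ℕ) : ℝ := η ^ 2 * (1 - 2 * η ^ 2 / (3 * (M : ℝ) ^ 2))⁻¹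

/-- The uniform mid-rise quantizer with `M` levels, support `γ` and spacing `Δ = 2γ/M`. -/
noncomputable def uniformQuantizer (M : ℕ) (γ a : ℝ) : ℝ :=
  if γ < |a| then SignType.sign a * (γ - (2 * γ / M) / 2)
  else -γ + (2 * γ / M) * ((min ⌊(a + γ) / (2 * γ / M)⌋₊ (M - 1) : ℕ) + 1 / 2)

/-- Entrywise non-subtractive dithered quantization of the real and imaginary parts of the
input `x`, with dither `z`. -/
noncomputable def ditheredQuantizer (M : ℕ) (γ : ℝ) {P : ℕ} (x z : Fin P → ℂ) : Fin P → ℂ :=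
  fun l => ⟨uniformQuantizer M γ (x l + z l).re, uniformQuantizer M γ (x l + z l).im⟩

/-- A dither sequence for spacing `Δ`: the real and imaginary parts of all entries are i.i.d.
uniform on `[-Δ/2, Δ/2]`, and the dither is independent of the signals `s`. -/
structure IsDither {Ω S : Type*} [MeasurableSpace Ω] [MeasurableSpace S] (μ : Measure Ω)
    (s : Ω → S) (Δ : ℝ) {P : ℕ} (z : Ω → Fin P → ℂ) : Prop where
  measurable : Measurable z
  uniform_re : ∀ l, pdf.IsUniform (fun ω => (z ω l).re) (Set.Icc (-(Δ / 2)) (Δ / 2)) μ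
  uniform_im : ∀ l, pdf.IsUniform (fun ω => (z ω l).im) (Set.Icc (-(Δ / 2)) (Δ / 2)) μ
  indep : iIndepFun (fun (j : Fin P ⊕ Fin P) (ω : Ω) =>
    Sum.elim (fun l => (z ω l).re) (fun l => (z ω l).im) j) μ
  indep_signal : IndepFun z s μ

/-- `q` is the output of dithered uniform ADCs with resolution `M` and support `γ` (spacing
`Δ = 2γ/M`) working in their operating range on the input `x`: it is the input plus zero-mean
white noise of power `Δ²/3` per complex entry (`Δ²/12` from the dither and `Δ²/12` from the
rounding in each of the two real components), uncorrelated with the desired vector `g` and the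
observed vector `y`. -/
structure IsADCOutput {Ω ι κ : Type*} [MeasurableSpace Ω] (μ : Measure Ω)
    (g : Ω → ι → ℂ) (y : Ω → κ → ℂ) (M : ℕ) (γ : ℝ) {P : ℕ} (x q : Ω → Fin P → ℂ) : Prop where
  memLp : ∀ l, MemLp (fun ω => q ω l - x ω l) 2 μ
  mean_zero : ∀ l, ∫ ω, (q ω l - x ω l) ∂μ = 0
  white : ∀ l m, ∫ ω, (q ω l - x ω l) * conj (q ω m - x ω m) ∂μ =
    if l = m then (((2 * γ / M) ^ 2 / 3 : ℝ) : ℂ) else 0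
  uncorr_y : ∀ l p, ∫ ω, (q ω l - x ω l) * conj (y ω p) ∂μ = 0
  uncorr_g : ∀ l p, ∫ ω, (q ω l - x ω l) * conj (g ω p) ∂μ = 0

/-- The support of the identical ADCs as a function of their (zero-mean) input `x`:
`γ² = κ max_l E|x_l|²`, which is the solution of `γ² = η² max_l E|x_l + z_l|²` for dither `z` with
spacing `2γ/M`. -/
noncomputable def adcSupport {Ω : Type*} [MeasurableSpace Ω] (μ : Measure Ω) (η : ℝ) (M : ℕ)
    {P : ℕ} (x : Ω → Fin P → ℂ) : ℝ :=
  √(kappa η M * ⨆ l, ∫ ω, ‖x ω l‖ ^ 2 ∂μ)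

/-- The average MSE `E‖g - B q‖² / (K N)` of the estimate `B q` of the desired vector. -/
noncomputable def avgMSE {Ω : Type*} [MeasurableSpace Ω] (μ : Measure Ω) {K N P : ℕ}
    (g : Ω → Fin K × Fin N → ℂ) (B : Matrix (Fin K × Fin N) (Fin P) ℂ)
    (q : Ω → Fin P → ℂ) : ℝ :=
  (1 / ((K : ℝ) * N)) * ∫ ω, ∑ p, ‖g ω p - (B.mulVec (q ω)) p‖ ^ 2 ∂μ

/-! ### The design -/

/-- The waterfilling function `φ(α) = (α - 1)⁺`. -/
noncomputable def wf (a : ℝ) : ℝ := max (a - 1) 0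

/-- The singular values of a matrix in descending order, from index `0` on, extended by zeros. -/
noncomputable def sv {m n : Type*} [Fintype m] [DecidableEq m] [Fintype n] [DecidableEq n]
    (A : Matrix m n ℂ) (l : ℕ) : ℝ :=
  (Matrix.toEuclideanLin A).singularValues l

/-- `Γ̃ = Γ C_y^{1/2}`. -/
noncomputable def gammaTilde {K L : ℕ} (Cy : Matrix (Fin L) (Fin L) ℂ)
    (Γ : Matrix (Fin K) (Fin L) ℂ) : Matrix (Fin K) (Fin L) ℂ :=
  Γ * CFC.sqrt Cy

/-- The singular values of `Γ̃ ⊗ Σ^{1/2}`, `Σ` the `N × N` Toeplitz matrix. -/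
noncomputable def svKron {K L : ℕ} (Cy : Matrix (Fin L) (Fin L) ℂ)
    (Γ : Matrix (Fin K) (Fin L) ℂ) (c : ℤ → ℂ) (N : ℕ) (l : ℕ) : ℝ :=
  sv (gammaTilde Cy Γ ⊗ₖ CFC.sqrt (toeplitz c N)) l

/-- The equation that sets the waterfilling level `ζ` for `N` observations and `P` quantizers. -/
def IsWaterLevel {K L : ℕ} (Cy : Matrix (Fin L) (Fin L) ℂ) (Γ : Matrix (Fin K) (Fin L) ℂ)
    (c : ℤ → ℂ) (κ : ℝ) (M N P : ℕ) (ζ : ℝ) : Prop :=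
  0 < ζ ∧ 4 * κ / (3 * (M : ℝ) ^ 2 * P) * ∑ l ∈ Finset.range P, wf (ζ * svKron Cy Γ c N l) = 1

/-- The ingredients of the waterfilling design for `N` observations and `P` quantizers with resolution
`M` and support-to-deviation ratio `η`. -/
structure Design {K L : ℕ} (Cy : Matrix (Fin L) (Fin L) ℂ) (Γ : Matrix (Fin K) (Fin L) ℂ)
    (c : ℤ → ℂ) (η : ℝ) (M N P : ℕ) where
  /-- The waterfilling level. -/
  ζ : ℝ
  /-- Right singular vectors of `Γ̃`, as columns, in the order of descending singular values. -/
  V : Matrix (Fin L) (Fin L) ℂ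
  /-- Eigenvectors of the Toeplitz matrix, as columns. -/
  Q : Matrix (Fin N) (Fin N) ℂ
  /-- The eigenvalues of the Toeplitz matrix, in the order of the columns of `Q`. -/
  eig : Fin N → ℝ
  /-- An ordering of the pairs of indices. -/
  e : Fin L × Fin N ≃ Fin (L * N)
  /-- The diagonal waterfilling matrix. -/
  Λ : Matrix (Fin P) (Fin (L * N)) ℂ
  /-- The equalizing rotation. -/
  U : Matrix (Fin P) (Fin P) ℂ
  level : IsWaterLevel Cy Γ c (kappa η M) M N P ζ
  V_unitary : V ∈ Matrix.unitaryGroup (Fin L) ℂ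
  V_spec : (gammaTilde Cy Γ).conjTranspose * gammaTilde Cy Γ =
    V * Matrix.diagonal (fun i : Fin L => ((sv (gammaTilde Cy Γ) i ^ 2 : ℝ) : ℂ)) *
      V.conjTranspose
  Q_unitary : Q ∈ Matrix.unitaryGroup (Fin N) ℂ
  Q_spec : toeplitz c N = Q * Matrix.diagonal (fun i => (eig i : ℂ)) * Q.conjTranspose
  /-- The ordering sorts the singular values `φ_i √λ_k` of `Γ̃ ⊗ Σ^{1/2}` in descending order. -/
  e_sorted : Antitone fun l : Fin (L * N) =>
    sv (gammaTilde Cy Γ) (e.symm l).1 * √(eig (e.symm l).2)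
  Λ_off : ∀ (l : Fin P) (j : Fin (L * N)), (l : ℕ) ≠ (j : ℕ) → Λ l j = 0
  Λ_diag : ∀ (l : Fin P) (j : Fin (L * N)), (l : ℕ) = (j : ℕ) → Λ l j ^ 2 =
    ((4 * kappa η M / (3 * (M : ℝ) ^ 2 * ratio L N P) * wf (ζ * svKron Cy Γ c N l) : ℝ) : ℂ)
  U_unitary : U ∈ Matrix.unitaryGroup (Fin P) ℂ
  U_equalizes : ∀ l m,
    (U * Λ * Λ.conjTranspose * U.conjTranspose) l l =
      (U * Λ * Λ.conjTranspose * U.conjTranspose) m m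

/-- The analog combining matrix `A = U Λ Π (Vᴴ C_y^{-1/2} ⊗ Qᴴ Σ^{-1/2})`, where `Π` is the
permutation that sorts the rows by the ordering `e`. -/
noncomputable def Design.analog {K L : ℕ} {Cy : Matrix (Fin L) (Fin L) ℂ}
    {Γ : Matrix (Fin K) (Fin L) ℂ} {c : ℤ → ℂ} {η : ℝ} {M N P : ℕ}
    (D : Design Cy Γ c η M N P) : Matrix (Fin P) (Fin L × Fin N) ℂ :=
  D.U * D.Λ *
    ((D.V.conjTranspose * (CFC.sqrt Cy)⁻¹) ⊗ₖ
      (D.Q.conjTranspose * (CFC.sqrt (toeplitz c N))⁻¹)).submatrix D.e.symm id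

/-- The digital processing matrix
`B = (Γ C_y ⊗ Σ) Aᴴ (A (C_y ⊗ Σ) Aᴴ + (4 γ² / (3 M²)) I)⁻¹`. -/
noncomputable def digital {K L : ℕ} (Cy : Matrix (Fin L) (Fin L) ℂ)
    (Γ : Matrix (Fin K) (Fin L) ℂ) (c : ℤ → ℂ) {N P : ℕ} (M : ℕ) (γsq : ℝ)
    (A : Matrix (Fin P) (Fin L × Fin N) ℂ) : Matrix (Fin K × Fin N) (Fin P) ℂ :=
  ((Γ * Cy) ⊗ₖ toeplitz c N) * A.conjTranspose *
    (A * (Cy ⊗ₖ toeplitz c N) * A.conjTranspose +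
      ((4 * γsq / (3 * (M : ℝ) ^ 2) : ℝ) : ℂ) • (1 : Matrix (Fin P) (Fin P) ℂ))⁻¹

/-- The digital processing matrix of the design, for the support `γ² = κ / r`. -/
noncomputable def Design.dig {K L : ℕ} {Cy : Matrix (Fin L) (Fin L) ℂ}
    {Γ : Matrix (Fin K) (Fin L) ℂ} {c : ℤ → ℂ} {η : ℝ} {M N P : ℕ}
    (D : Design Cy Γ c η M N P) : Matrix (Fin K × Fin N) (Fin P) ℂ :=
  digital Cy Γ c M (kappa η M / ratio L N P) D.analog

/-- The input of the quantizers: the analog combination `A y` of the observations. -/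
def combined {Ω : Type*} {L N P : ℕ} (A : Matrix (Fin P) (Fin L × Fin N) ℂ)
    (y : ℕ → Ω → Fin L → ℂ) (ω : Ω) : Fin P → ℂ :=
  A.mulVec (stack y N ω)

/-- `q` is the output of the ADCs with resolution `M` and support `γ = γ(A)` fed with `A y`. -/
def IsSystemOutput {Ω : Type*} [MeasurableSpace Ω] (μ : Measure Ω) {K L N P : ℕ}
    (g : ℕ → Ω → Fin K → ℂ) (y : ℕ → Ω → Fin L → ℂ) (η : ℝ) (M : ℕ)
    (A : Matrix (Fin P) (Fin L × Fin N) ℂ) (q : Ω → Fin P → ℂ) : Prop :=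
  IsADCOutput μ (stack g N) (stack y N) M (adcSupport μ η M (combined A y)) (combined A y) q

end TaskQuant

open TaskQuant

/-! Everything is a computation with second-order statistics. Orthogonality of the MMSE error gives
E{g yᴴ} = ΓC_y ⊗ Σ for the stacked vectors. With the whitened combiner X = A(C_y ⊗ Σ)^{1/2}, with H
= Γ̃ ⊗ Σ^{1/2} and with the noise power ν = 4γ²/(3M²), the total MSE is therefore Tr(C_g ⊗ Σ) + Tr
B(XXᴴ + νI)Bᴴ - 2 Re Tr BXHᴴ.

Lower bound (`neg_waterfilling_le`). The support is set by the largest input variance, which is at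
least the mean one, so ν ≥ ν₀ Tr XXᴴ with ν₀ = 4κ/(3M²P). In eigenbases of XXᴴ and HᴴH the combiner
becomes a matrix Y with orthogonal rows of squared norms x_l, and H has orthogonal columns of norms
s_i. Completing the square in B leaves the gain ∑ s_i²|Y_li|²/(x_l + ν). The weights |Y_li|²/x_l
have row sums at most 1, and column sums at most 1 by Bessel, so every channel i has weight at most
1 and the total weight is at most P. The scalar Lagrangian inequality `le_waterGain`, applied to
x_l/ν, bounds each term. The P best channels collect the most, and the level equation pays for the
power term.

Achievability (`Design.quadratic_eq`). The design aligns the rows of X with the P strongest right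
singular vectors of H, the rotation U makes all input variances equal so that maximum and mean
coincide, and B is the linear MMSE filter. The value is exactly that of the bound.

Asymptotics. The left side of the level equation, as a function of ζ, vanishes at 0 and grows at
least linearly under dilations (`SuperLinear`). This alone makes the solution unique and makes
solutions converge when the functions converge pointwise. The limits of the averages over
eigenvalues come from Szegő's theorem (`tendsto_eig_continuous`), proved by moments: Σ^k differs
from the Toeplitz matrix of S^k by o(N) in entrywise ℓ¹ norm, and Weierstrass approximation on a
Gershgorin interval passes from powers to continuous functions. For white signals Σ = I, each φ_i
occurs N times, and the sums are explicit.

Two side facts are needed. Σ is strictly positive definite, because its quadratic form is the mean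
of S times the squared modulus of a trigonometric polynomial, where S ≥ 0 and S has mean 1. And the
error of a quantizer that is not overloaded has conditional mean zero given everything independent
of its dither entry, because averaging over the dither integrates a sawtooth over one full period.
-/

namespace TaskQuant

/-! ### Singular values from a diagonalization of the Gram matrix -/

section SingularValues

variable {m n : Type*} [Fintype m] [DecidableEq m] [Fintype n] [DecidableEq n]

theorem adjoint_comp_self_toEuclideanLin (H : Matrix m n ℂ) :
    LinearMap.adjoint (Matrix.toEuclideanLin H) ∘ₗ Matrix.toEuclideanLin H =
      Matrix.toEuclideanLin (H.conjTranspose * H) := by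
  rw [← Matrix.toEuclideanLin_conjTranspose_eq_adjoint]
  ext x i
  simp [Matrix.toLpLin_apply]

theorem charpoly_adjoint_comp_self (H : Matrix m n ℂ) :
    (LinearMap.adjoint (Matrix.toEuclideanLin H) ∘ₗ Matrix.toEuclideanLin H).charpoly =
      (H.conjTranspose * H).charpoly := by
  rw [adjoint_comp_self_toEuclideanLin, Matrix.toEuclideanLin, Matrix.toLpLin_eq_toLin,
    Matrix.charpoly_toLin]

/-- A unitary diagonalization of the Gram matrix with sorted entries gives the singular values. -/
theorem sv_eq_of_diagonalization (H : Matrix m n ℂ) (W : Matrix n n ℂ)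
    (hW : W ∈ Matrix.unitaryGroup n ℂ) (s : n → ℝ) (hs : ∀ i, 0 ≤ s i)
    (hH : H.conjTranspose * H =
      W * Matrix.diagonal (fun i => ((s i ^ 2 : ℝ) : ℂ)) * W.conjTranspose)
    {d : ℕ} (e : n ≃ Fin d) (he : Antitone fun l => s (e.symm l)) (l : Fin d) :
    sv H l = s (e.symm l) := by
  have hd : Module.finrank ℂ (EuclideanSpace ℂ n) = d := by
    simpa using Fintype.card_congr e
  have hsymm := (Matrix.toEuclideanLin H).isSymmetric_adjoint_comp_self
  have hWW : W.conjTranspose * W = 1 := by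
    simpa [Matrix.star_eq_conjTranspose] using (Matrix.mem_unitaryGroup_iff'.1 hW)
  have hroots : (LinearMap.adjoint (Matrix.toEuclideanLin H) ∘ₗ
      Matrix.toEuclideanLin H).charpoly.roots =
      Multiset.map (fun i => ((s i ^ 2 : ℝ) : ℂ)) Finset.univ.val := by
    rw [charpoly_adjoint_comp_self, hH, Matrix.charpoly_mul_comm, ← mul_assoc, hWW, one_mul,
      Matrix.charpoly_diagonal]
    have hprod : ∀ f : n → ℂ, (∏ i, (Polynomial.X - Polynomial.C (f i))).roots =
        Multiset.map f Finset.univ.val := by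
      intro f
      rw [Polynomial.roots_prod]
      · simp
      · simp [Finset.prod_ne_zero_iff, Polynomial.X_sub_C_ne_zero]
    exact hprod _
  -- The sorted eigenvalues are the sorted list of roots of the characteristic polynomial, so a list
  -- that is already sorted and has the same multiset of entries must coincide with it.
  have hsort := hsymm.sort_roots_charpoly_eq_eigenvalues hd
  rw [hroots] at hsort
  have hmap : Multiset.map RCLike.re
      (Multiset.map (fun i => ((s i ^ 2 : ℝ) : ℂ)) Finset.univ.val) =
      ((List.ofFn fun l : Fin d => s (e.symm l) ^ 2 : List ℝ) : Multiset ℝ) := by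
    rw [Multiset.map_map, ← Fin.univ_val_map,
      show (Finset.univ : Finset n) = Finset.univ.map e.symm.toEmbedding by simp,
      Finset.map_val, Multiset.map_map]
    refine Multiset.map_congr rfl fun x _ => ?_
    simp only [Function.comp_apply, Equiv.coe_toEmbedding]
    exact Complex.ofReal_re _
  rw [hmap, Multiset.coe_sort] at hsort
  have hpair : (List.ofFn fun l : Fin d => s (e.symm l) ^ 2).mergeSort
      (fun a b => decide (a ≥ b)) = List.ofFn fun l : Fin d => s (e.symm l) ^ 2 := by
    apply List.mergeSort_of_pairwise
    simp_rw [decide_eq_true_eq, ← List.sortedGE_iff_pairwise]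
    refine Antitone.sortedGE_ofFn fun a b hab => ?_
    exact pow_le_pow_left₀ (hs _) (he hab) 2
  rw [hpair, List.ofFn_inj] at hsort
  have h1 := (Matrix.toEuclideanLin H).sq_singularValues_fin hd l
  rw [← congrFun hsort l] at h1
  exact (pow_left_inj₀ (LinearMap.singularValues_nonneg _ _) (hs _) two_ne_zero).1 h1

theorem sv_nonneg (H : Matrix m n ℂ) (l : ℕ) : 0 ≤ sv H l :=
  LinearMap.singularValues_nonneg _ _

theorem sv_antitone (H : Matrix m n ℂ) : Antitone (sv H) :=
  LinearMap.singularValues_antitone _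

theorem sv_eq_zero_iff_rank_le (H : Matrix m n ℂ) (l : ℕ) : sv H l = 0 ↔ H.rank ≤ l := by
  rw [sv, LinearMap.singularValues_eq_zero_iff_le_finrank_range,
    Matrix.rank_eq_finrank_range_toLin H (PiLp.basisFun 2 ℂ m) (PiLp.basisFun 2 ℂ n), Matrix.toEuclideanLin,
    Matrix.toLpLin_eq_toLin]

theorem sv_zero_pos {H : Matrix m n ℂ} (h : H ≠ 0) : 0 < sv H 0 := by
  refine lt_of_le_of_ne (sv_nonneg H 0) fun h0 => h ?_
  have hall : (Matrix.toEuclideanLin H).singularValues = 0 := by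
    ext l
    exact le_antisymm ((sv_antitone H (Nat.zero_le l)).trans_eq h0.symm) (sv_nonneg H l)
  rw [LinearMap.singularValues_eq_zero_iff] at hall
  exact (LinearEquiv.map_eq_zero_iff _).1 hall

/-- The Gram matrix has a unitary diagonalization by squared singular values. -/
theorem exists_diagonalization_sv {L : ℕ} (H : Matrix m (Fin L) ℂ) :
    ∃ V ∈ Matrix.unitaryGroup (Fin L) ℂ, H.conjTranspose * H =
      V * Matrix.diagonal (fun i : Fin L => ((sv H i ^ 2 : ℝ) : ℂ)) * V.conjTranspose := by
  have hH : (H.conjTranspose * H).PosSemidef := Matrix.posSemidef_conjTranspose_mul_self H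
  set lam := hH.1.eigenvalues with hlam
  have hnn : ∀ i, 0 ≤ lam i := hH.eigenvalues_nonneg
  -- Sorting the negatives in ascending order puts the eigenvalues in descending order.
  set e : Equiv.Perm (Fin L) := Tuple.sort fun i => -lam i with he
  have hmono : Monotone ((fun i => -lam i) ∘ e) := Tuple.monotone_sort _
  have hspec := hH.1.spectral_theorem
  rw [Unitary.conjStarAlgAut_apply] at hspec
  set W : Matrix (Fin L) (Fin L) ℂ := hH.1.eigenvectorUnitary.1 with hW
  have hWmem : W ∈ Matrix.unitaryGroup (Fin L) ℂ := hH.1.eigenvectorUnitary.2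
  have hsv : ∀ l : Fin L, sv H l = √(lam (e l)) := by
    intro l
    refine sv_eq_of_diagonalization H W hWmem (fun i => √(lam i)) (fun i => Real.sqrt_nonneg _)
      ?_ e.symm ?_ l
    · rw [hspec]
      congr 2
      congr 1
      funext i
      simp only [Function.comp_apply, Real.sq_sqrt (hnn i)]
      rfl
    · intro a b hab
      exact Real.sqrt_le_sqrt (by simpa using hmono hab)
  refine ⟨W.submatrix id e, ?_, ?_⟩
  · rw [Matrix.mem_unitaryGroup_iff', Matrix.star_eq_conjTranspose, Matrix.conjTranspose_submatrix,
      ← Matrix.submatrix_mul _ _ e id e Function.bijective_id]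
    have := Matrix.mem_unitaryGroup_iff'.1 hWmem
    rw [Matrix.star_eq_conjTranspose] at this
    rw [this]
    simp
  · rw [hspec]
    have hdiag : Matrix.diagonal (fun i : Fin L => ((sv H i ^ 2 : ℝ) : ℂ)) =
        (Matrix.diagonal (RCLike.ofReal ∘ lam)).submatrix e e := by
      rw [Matrix.submatrix_diagonal_equiv]
      congr 1
      funext i
      rw [hsv, Real.sq_sqrt (hnn _)]
      rfl
    rw [hdiag, Matrix.submatrix_mul_equiv, Matrix.conjTranspose_submatrix,
      Matrix.submatrix_mul_equiv, Matrix.star_eq_conjTranspose]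
    simp [hlam]

end SingularValues

/-! ### The scalar waterfilling inequality -/

section Waterfilling

theorem wf_nonneg (a : ℝ) : 0 ≤ wf a := le_max_right _ _

theorem wf_of_le {a : ℝ} (h : a ≤ 1) : wf a = 0 := max_eq_right (by linarith)

theorem wf_of_ge {a : ℝ} (h : 1 ≤ a) : wf a = a - 1 := max_eq_left (by linarith)

theorem wf_zero : wf 0 = 0 := wf_of_le zero_le_one

theorem continuous_wf : Continuous wf := by
  unfold wf; fun_prop

theorem abs_wf_sub_le (a b : ℝ) : |wf a - wf b| ≤ |a - b| := by
  have := abs_max_sub_max_le_abs (a - 1) (b - 1) 0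
  simpa [wf] using this

/-- `φ(α) = (α - 1)⁺` grows at least linearly under dilations. -/
theorem mul_wf_le {t a : ℝ} (ht : 1 ≤ t) (ha : 0 ≤ a) : t * wf a ≤ wf (t * a) := by
  rcases le_total a 1 with h | h
  · rw [wf_of_le h, mul_zero]; exact wf_nonneg _
  · rw [wf_of_ge h, wf_of_ge (by nlinarith)]; nlinarith

/-- The value of the Lagrangian of the scalar waterfilling problem at the optimum. -/
noncomputable def waterGain (ζ σ : ℝ) : ℝ :=
  σ ^ 2 * wf (ζ * σ) / (wf (ζ * σ) + 1) - wf (ζ * σ) / ζ ^ 2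

/-- The left side is concave in the power `x`, with maximizer `wf (ζ * σ)`. If `ζσ ≤ 1`, its slope
at 0 is already nonpositive; otherwise the gap to the maximum is a perfect square that vanishes at
`x = ζσ - 1`. -/
theorem le_waterGain {ζ σ x : ℝ} (hζ : 0 < ζ) (hσ : 0 ≤ σ) (hx : 0 ≤ x) :
    σ ^ 2 * x / (x + 1) - x / ζ ^ 2 ≤ waterGain ζ σ := by
  unfold waterGain
  have hx1 : 0 < x + 1 := by linarith
  rcases le_total (ζ * σ) 1 with h | h
  · rw [wf_of_le h]
    have h1 : σ ^ 2 ≤ 1 / ζ ^ 2 := by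
      rw [le_div_iff₀ (by positivity)]
      nlinarith [mul_nonneg hζ.le hσ]
    have h2 : σ ^ 2 * x / (x + 1) ≤ σ ^ 2 * x := div_le_self (by positivity) (by linarith)
    have h3 : σ ^ 2 * x ≤ 1 / ζ ^ 2 * x := mul_le_mul_of_nonneg_right h1 hx
    have h4 : 1 / ζ ^ 2 * x = x / ζ ^ 2 := by ring
    simp only [mul_zero, zero_div, sub_zero]
    linarith
  · rw [wf_of_ge h, sub_add_cancel]
    have hσ' : 0 < σ := by
      rcases hσ.eq_or_lt with rfl | h'
      · simp at h; linarith
      · exact h'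
    have key : σ ^ 2 * (ζ * σ - 1) / (ζ * σ) - (ζ * σ - 1) / ζ ^ 2 -
        (σ ^ 2 * x / (x + 1) - x / ζ ^ 2) = (σ * ζ - (x + 1)) ^ 2 / ((x + 1) * ζ ^ 2) := by
      field_simp
      ring
    have : 0 ≤ (σ * ζ - (x + 1)) ^ 2 / ((x + 1) * ζ ^ 2) := by positivity
    linarith

theorem waterGain_nonneg {ζ σ : ℝ} (hζ : 0 < ζ) (hσ : 0 ≤ σ) : 0 ≤ waterGain ζ σ := by
  simpa using le_waterGain hζ hσ le_rfl

/-- The power that is optimal for `σ` is a candidate for `τ`, and at fixed power the objective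
increases with the gain. -/
theorem waterGain_mono {ζ σ τ : ℝ} (hζ : 0 < ζ) (hσ : 0 ≤ σ) (h : σ ≤ τ) :
    waterGain ζ σ ≤ waterGain ζ τ := by
  refine le_trans ?_ (le_waterGain hζ (hσ.trans h) (wf_nonneg (ζ * σ)))
  unfold waterGain
  have := wf_nonneg (ζ * σ)
  gcongr

/-- Weights in `[0, 1]` of total mass at most `P` collect at most the sum of the `P` largest
values. -/
theorem sum_weight_mul_le_sum_range {d P : ℕ} (hP : 1 ≤ P) (hPd : P ≤ d) (f : ℕ → ℝ)
    (hf : Antitone f) (hf0 : ∀ l, 0 ≤ f l) (w : Fin d → ℝ) (hw0 : ∀ i, 0 ≤ w i)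
    (hw1 : ∀ i, w i ≤ 1) (hw : ∑ i, w i ≤ P) :
    ∑ i, w i * f i ≤ ∑ l ∈ Finset.range P, f l := by
  -- The threshold is the smallest of the `P` leading values: the excess over `b` is nonnegative
  -- exactly where weight 1 is allowed to count, and the remaining part costs at most `P * b`.
  set b := f (P - 1) with hb
  have hpt : ∀ i : Fin d, w i * f i ≤ (if (i : ℕ) < P then f i - b else 0) + w i * b := by
    intro i
    split_ifs with h
    · have : b ≤ f i := hf (by omega)
      nlinarith [hw0 i, hw1 i]
    · have : f i ≤ b := hf (by omega)
      nlinarith [hw0 i]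
  have hsum : ∑ i : Fin d, (if (i : ℕ) < P then f i - b else 0) =
      ∑ l ∈ Finset.range P, (f l - b) := by
    rw [Fin.sum_univ_eq_sum_range (fun l => if l < P then f l - b else 0) d,
      ← Finset.sum_filter]
    congr 1
    ext l
    simp only [Finset.mem_filter, Finset.mem_range]
    omega
  calc ∑ i, w i * f i ≤ ∑ i : Fin d, ((if (i : ℕ) < P then f i - b else 0) + w i * b) :=
        Finset.sum_le_sum fun i _ => hpt i
    _ = ∑ l ∈ Finset.range P, (f l - b) + (∑ i, w i) * b := by
        rw [Finset.sum_add_distrib, hsum, Finset.sum_mul]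
    _ ≤ ∑ l ∈ Finset.range P, (f l - b) + P * b := by
        gcongr
        exact hf0 _
    _ = ∑ l ∈ Finset.range P, f l := by
        simp [Finset.sum_sub_distrib]

end Waterfilling

/-! ### Existence, uniqueness and convergence of water levels -/

section Level

/-- A nonnegative function with `F 0 = 0` that grows at least linearly under dilations. -/
structure SuperLinear (F : ℝ → ℝ) : Prop where
  nonneg : ∀ x, 0 ≤ x → 0 ≤ F x
  zero : F 0 = 0
  dilate : ∀ t x, 1 ≤ t → 0 ≤ x → t * F x ≤ F (t * x)

theorem SuperLinear.mono {F : ℝ → ℝ} (hF : SuperLinear F) {x x' : ℝ} (hx : 0 ≤ x)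
    (h : x ≤ x') : F x ≤ F x' := by
  rcases hx.eq_or_lt with rfl | hx0
  · rw [hF.zero]; exact hF.nonneg _ h
  · have h1 : 1 ≤ x' / x := (one_le_div hx0).2 h
    have := hF.dilate (x' / x) x h1 hx
    rw [div_mul_cancel₀ _ hx0.ne'] at this
    exact le_trans (le_mul_of_one_le_left (hF.nonneg x hx) h1) this

theorem SuperLinear.lt_of_pos {F : ℝ → ℝ} (hF : SuperLinear F) {x x' : ℝ} (hx : 0 < x)
    (h : x < x') (hpos : 0 < F x) : F x < F x' := by
  have h1 : 1 < x' / x := (one_lt_div hx).2 h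
  have := hF.dilate (x' / x) x h1.le hx.le
  rw [div_mul_cancel₀ _ hx.ne'] at this
  exact lt_of_lt_of_le ((lt_mul_iff_one_lt_left hpos).2 h1) this

/-- From a point where `F` is positive, dilation makes `F` strictly larger, so the value 1 cannot be
taken twice. Strictness can fail only on the initial stretch where `F` vanishes. -/
theorem SuperLinear.level_unique {F : ℝ → ℝ} (hF : SuperLinear F) {x x' : ℝ} (hx : 0 < x)
    (hx' : 0 < x') (h : F x = 1) (h' : F x' = 1) : x = x' := by
  rcases lt_trichotomy x x' with hlt | rfl | hlt
  · have := hF.lt_of_pos hx hlt (by rw [h]; exact one_pos)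
    linarith
  · rfl
  · have := hF.lt_of_pos hx' hlt (by rw [h']; exact one_pos)
    linarith

/-- Dilating a point of positive value `F x` by at least `1 / F x` lifts the value to 1 or more; the
intermediate value theorem from `F 0 = 0` does the rest. -/
theorem SuperLinear.exists_level {F : ℝ → ℝ} (hF : SuperLinear F) (hc : Continuous F)
    (hpos : ∃ x, 0 < x ∧ 0 < F x) : ∃ x, 0 < x ∧ F x = 1 := by
  obtain ⟨x, hx, hFx⟩ := hpos
  set t := max 1 (1 / F x) with ht
  have h1 : 1 ≤ F (t * x) := by
    refine le_trans ?_ (hF.dilate t x (le_max_left _ _) hx.le)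
    calc (1 : ℝ) = 1 / F x * F x := by field_simp
      _ ≤ t * F x := by gcongr; exact le_max_right _ _
  have htx : 0 ≤ t * x := mul_nonneg (zero_le_one.trans (le_max_left _ _)) hx.le
  obtain ⟨z, hz, hFz⟩ := intermediate_value_Icc htx hc.continuousOn
    (show (1 : ℝ) ∈ Set.Icc (F 0) (F (t * x)) from ⟨by rw [hF.zero]; exact zero_le_one, h1⟩)
  refine ⟨z, lt_of_le_of_ne hz.1 ?_, hFz⟩
  rintro rfl
  rw [hF.zero] at hFz
  exact zero_ne_one hFz

/-- Levels of pointwise convergent functions converge. -/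
theorem SuperLinear.tendsto_level {F : ℝ → ℝ} {G : ℕ → ℝ → ℝ} (hF : SuperLinear F)
    (hG : ∀ n, SuperLinear (G n)) (hlim : ∀ x, 0 ≤ x → Tendsto (fun n => G n x) atTop (𝓝 (F x)))
    {x : ℝ} (hx : 0 < x) (hFx : F x = 1) {u : ℕ → ℝ} (hu : ∀ n, 0 < u n)
    (hGu : ∀ n, G n (u n) = 1) : Tendsto u atTop (𝓝 x) := by
  rw [tendsto_order]
  constructor
  · intro a ha
    rcases le_or_gt a 0 with h0 | h0
    · exact Eventually.of_forall fun n => h0.trans_lt (hu n)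
    · have hlt : F a < 1 := by
        rcases (hF.nonneg a h0.le).eq_or_lt with h | h
        · rw [← h]; exact one_pos
        · rw [← hFx]; exact hF.lt_of_pos h0 ha h
      filter_upwards [(hlim a h0.le).eventually_lt_const hlt] with n hn
      by_contra! hle
      have := (hG n).mono (hu n).le hle
      rw [hGu] at this
      linarith
  · intro b hb
    have hlt : 1 < F b := by
      rw [← hFx]; exact hF.lt_of_pos hx hb (by rw [hFx]; exact one_pos)
    filter_upwards [(hlim b (hx.trans hb).le).eventually_const_lt hlt] with n hn
    by_contra! hle
    have := (hG n).mono (hx.trans hb).le hle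
    rw [hGu] at this
    linarith

theorem superLinear_wf {a : ℝ} (ha : 0 ≤ a) : SuperLinear fun ζ => wf (ζ * a) where
  nonneg _ _ := wf_nonneg _
  zero := by simp [wf_zero]
  dilate t x ht hx := by
    simpa only [mul_assoc] using mul_wf_le ht (mul_nonneg hx ha)

theorem SuperLinear.sum {ι : Type*} (s : Finset ι) {F : ι → ℝ → ℝ}
    (hF : ∀ i ∈ s, SuperLinear (F i)) : SuperLinear fun x => ∑ i ∈ s, F i x where
  nonneg x hx := Finset.sum_nonneg fun i hi => (hF i hi).nonneg x hx
  zero := Finset.sum_eq_zero fun i hi => (hF i hi).zero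
  dilate t x ht hx := by
    rw [Finset.mul_sum]
    exact Finset.sum_le_sum fun i hi => (hF i hi).dilate t x ht hx

theorem SuperLinear.const_mul {F : ℝ → ℝ} (hF : SuperLinear F) {a : ℝ} (ha : 0 ≤ a) :
    SuperLinear fun x => a * F x where
  nonneg x hx := mul_nonneg ha (hF.nonneg x hx)
  zero := by simp [hF.zero]
  dilate t x ht hx := by
    rw [mul_left_comm]
    exact mul_le_mul_of_nonneg_left (hF.dilate t x ht hx) ha

theorem SuperLinear.add {F G : ℝ → ℝ} (hF : SuperLinear F) (hG : SuperLinear G) :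
    SuperLinear fun x => F x + G x where
  nonneg x hx := add_nonneg (hF.nonneg x hx) (hG.nonneg x hx)
  zero := by simp [hF.zero, hG.zero]
  dilate t x ht hx := by
    rw [mul_add]
    exact add_le_add (hF.dilate t x ht hx) (hG.dilate t x ht hx)

/-- The waterfilling level for finitely many channels exists and is unique. -/
theorem existsUnique_level {P : ℕ} (hP : 1 ≤ P) {a : ℝ} (ha : 0 < a) {σ : ℕ → ℝ}
    (hσ : ∀ l, 0 ≤ σ l) (hσ0 : 0 < σ 0) :
    ∃! ζ : ℝ, 0 < ζ ∧ a * ∑ l ∈ Finset.range P, wf (ζ * σ l) = 1 := by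
  have hF : SuperLinear fun ζ => a * ∑ l ∈ Finset.range P, wf (ζ * σ l) :=
    (SuperLinear.sum _ fun l _ => superLinear_wf (hσ l)).const_mul ha.le
  have hc : Continuous fun ζ => a * ∑ l ∈ Finset.range P, wf (ζ * σ l) :=
    continuous_const.mul (continuous_finsetSum _ fun l _ =>
      continuous_wf.comp (continuous_id.mul continuous_const))
  -- At `ζ = 2 / σ 0` the strongest channel contributes `wf 2 = 1`.
  obtain ⟨ζ, hζ, h⟩ := hF.exists_level hc ⟨2 / σ 0, by positivity, by
    refine mul_pos ha (Finset.sum_pos' (fun l _ => wf_nonneg _) ⟨0, Finset.mem_range.2 hP, ?_⟩)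
    rw [div_mul_cancel₀ _ hσ0.ne', wf_of_ge (by norm_num)]
    norm_num⟩
  exact ⟨ζ, ⟨hζ, h⟩, fun ζ' h' => hF.level_unique h'.1 hζ h'.2 h⟩

end Level

/-! ### The lower bound for arbitrary processing matrices -/

section LowerBound

variable {m n : Type*} [Fintype m] [Fintype n] [DecidableEq n]

theorem mul_conjTranspose_apply_self {ι κ : Type*} [Fintype κ] (Y : Matrix ι κ ℂ) (l : ι) :
    (Y * Y.conjTranspose) l l = ((∑ i, ‖Y l i‖ ^ 2 : ℝ) : ℂ) := by
  simp [Matrix.mul_apply, Complex.mul_conj, Complex.normSq_eq_norm_sq]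

theorem conjTranspose_mul_apply_self {ι κ : Type*} [Fintype κ] (Y : Matrix κ ι ℂ) (l : ι) :
    (Y.conjTranspose * Y) l l = ((∑ i, ‖Y i l‖ ^ 2 : ℝ) : ℂ) := by
  simp [Matrix.mul_apply, Complex.conj_mul']

/-- Completing the square in `b`. The condition on `z` covers `t = 0`, where the quotient is 0 by
convention and a nonzero linear term would be unbounded below. -/
theorem neg_div_le_quadratic {t : ℝ} (ht : 0 ≤ t) (b z : ℂ) (hz : t = 0 → z = 0) :
    -(‖z‖ ^ 2 / t) ≤ t * ‖b‖ ^ 2 - 2 * (b * z).re := by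
  rcases ht.eq_or_lt with h | h
  · simp [hz h.symm, ← h]
  · have h1 : (b * z).re ≤ ‖b‖ * ‖z‖ := (Complex.re_le_norm _).trans (norm_mul _ _).le
    have h2 : t * ‖b‖ ^ 2 - 2 * (‖b‖ * ‖z‖) + ‖z‖ ^ 2 / t = (t * ‖b‖ - ‖z‖) ^ 2 / t := by
      field_simp
      ring
    have h3 : 0 ≤ (t * ‖b‖ - ‖z‖) ^ 2 / t := by positivity
    linarith

/-- Bessel's inequality for the orthogonal rows of a matrix. -/
theorem sum_norm_sq_div_le_one {P : Type*} [Fintype P] [DecidableEq P] (Y : Matrix P n ℂ)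
    (x : P → ℝ) (hY : Y * Y.conjTranspose = Matrix.diagonal fun l => (x l : ℂ)) (i : n) :
    ∑ l, ‖Y l i‖ ^ 2 / x l ≤ 1 := by
  -- Since `0⁻¹ = 0`, `D` is the pseudo-inverse of `Y Yᴴ` and `E` is the orthogonal projection onto
  -- the span of the conjugated rows. Its diagonal entries are at most 1 because `1 - E = (1 - E)ᴴ
  -- (1 - E)`.
  set D : Matrix P P ℂ := Matrix.diagonal fun l => ((x l)⁻¹ : ℂ) with hD
  set E : Matrix n n ℂ := Y.conjTranspose * D * Y with hE
  have hDH : D.conjTranspose = D := by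
    rw [hD, Matrix.diagonal_conjTranspose]
    congr 1
    ext l
    simp
  have hEH : E.conjTranspose = E := by
    rw [hE]
    simp [Matrix.conjTranspose_mul, hDH, Matrix.mul_assoc]
  have hEE : E * E = E := by
    have h1 : E * E = Y.conjTranspose * (D * (Y * Y.conjTranspose) * D) * Y := by
      simp only [hE, Matrix.mul_assoc]
    rw [h1, hY, hD, Matrix.diagonal_mul_diagonal, Matrix.diagonal_mul_diagonal, hE, hD]
    congr 3
    ext l
    by_cases h : x l = 0
    · simp [h]
    · have : (x l : ℂ) ≠ 0 := by exact_mod_cast h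
      field_simp
  have h1 : (1 - E).conjTranspose * (1 - E) = 1 - E := by
    rw [Matrix.conjTranspose_sub, Matrix.conjTranspose_one, hEH, sub_mul, mul_sub, mul_sub, hEE]
    simp
  have h2 := conjTranspose_mul_apply_self (1 - E) i
  rw [h1] at h2
  have h3 : E i i = ((∑ l, ‖Y l i‖ ^ 2 / x l : ℝ) : ℂ) := by
    rw [hE, hD, Matrix.mul_apply]
    simp only [Matrix.mul_diagonal, Matrix.conjTranspose_apply, RCLike.star_def]
    push_cast
    refine Finset.sum_congr rfl fun l _ => ?_
    rw [mul_right_comm, Complex.conj_mul']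
    rfl
  rw [Matrix.sub_apply, h3, Matrix.one_apply_eq] at h2
  have h4 : 1 - ∑ l, ‖Y l i‖ ^ 2 / x l = ∑ j, ‖(1 - E) j i‖ ^ 2 := by exact_mod_cast h2
  have h5 : 0 ≤ ∑ j, ‖(1 - E) j i‖ ^ 2 := by positivity
  linarith

/-- The waterfilling bound on the power that `P` orthogonal rows extract from channels with
gains `s`. -/
theorem sum_sum_le_waterfilling {s : n → ℝ} (hs : ∀ i, 0 ≤ s i) {d P : ℕ} (e : n ≃ Fin d)
    (hP : 1 ≤ P) (hPd : P ≤ d) {σ : ℕ → ℝ} (hσ : Antitone σ) (hσ0 : ∀ l, 0 ≤ σ l)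
    (hσs : ∀ l : Fin d, σ l = s (e.symm l)) {ζ ν₀ ν : ℝ} (hζ : 0 < ζ) (hν₀ : 0 < ν₀)
    (hlevel : ν₀ * ∑ l ∈ Finset.range P, wf (ζ * σ l) = 1)
    (Y : Matrix (Fin P) n ℂ) (x : Fin P → ℝ)
    (hY : Y * Y.conjTranspose = Matrix.diagonal fun l => (x l : ℂ))
    (hν : ν₀ * ∑ l, x l ≤ ν) :
    ∑ l, (∑ i, s i ^ 2 * ‖Y l i‖ ^ 2) / (x l + ν) ≤
      ∑ l ∈ Finset.range P, σ l ^ 2 * wf (ζ * σ l) / (wf (ζ * σ l) + 1) := by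
  have hx : ∀ l, x l = ∑ i, ‖Y l i‖ ^ 2 := by
    intro l
    have := mul_conjTranspose_apply_self Y l
    rw [hY, Matrix.diagonal_apply_eq] at this
    exact_mod_cast this
  have hx0 : ∀ l, 0 ≤ x l := fun l => by rw [hx]; positivity
  have hxz : ∀ l, x l = 0 → ∀ i, ‖Y l i‖ ^ 2 = 0 := by
    intro l h i
    rw [hx, Finset.sum_eq_zero_iff_of_nonneg fun _ _ => by positivity] at h
    exact h i (Finset.mem_univ i)
  have hsx0 : 0 ≤ ∑ l, x l := Finset.sum_nonneg fun l _ => hx0 l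
  have hν0 : 0 ≤ ν := le_trans (mul_nonneg hν₀.le hsx0) hν
  have hrhs : 0 ≤ ∑ l ∈ Finset.range P, σ l ^ 2 * wf (ζ * σ l) / (wf (ζ * σ l) + 1) :=
    Finset.sum_nonneg fun l _ => by
      have := wf_nonneg (ζ * σ l)
      positivity
  -- If `ν = 0`, the power constraint forces every `x l` to vanish, and the left side is 0 by
  -- division by zero.
  rcases hν0.eq_or_lt with h0 | hνpos
  · have hz : ∑ l, x l = 0 := le_antisymm (by
      rw [← h0] at hν
      by_contra! hc
      linarith [mul_pos hν₀ hc]) hsx0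
    rw [Finset.sum_eq_zero_iff_of_nonneg fun l _ => hx0 l] at hz
    refine le_trans (le_of_eq ?_) hrhs
    refine Finset.sum_eq_zero fun l hl => ?_
    rw [hz l hl, ← h0]
    simp
  -- The Lagrangian bound at the normalized power `x l / ν`, weighted by `‖Y l i‖² / x l`. The
  -- second summand returns the price that the Lagrangian subtracts.
  · have hterm : ∀ l i, s i ^ 2 * ‖Y l i‖ ^ 2 / (x l + ν) ≤
        ‖Y l i‖ ^ 2 / x l * waterGain ζ (s i) + ‖Y l i‖ ^ 2 / (ν * ζ ^ 2) := by
      intro l i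
      rcases (hx0 l).eq_or_lt with h | h
      · rw [hxz l h.symm i]; simp
      · have h1 := le_waterGain hζ (hs i) (div_nonneg h.le hνpos.le)
        have h2 : s i ^ 2 * ‖Y l i‖ ^ 2 / (x l + ν) = ‖Y l i‖ ^ 2 / x l *
            (s i ^ 2 * (x l / ν) / (x l / ν + 1) - x l / ν / ζ ^ 2) +
              ‖Y l i‖ ^ 2 / (ν * ζ ^ 2) := by
          field_simp
          ring
        rw [h2]
        gcongr
    -- Each nonzero row has total weight 1, and zero rows have weight 0.
    have hmass : ∑ i, ∑ l, ‖Y l i‖ ^ 2 / x l ≤ P := by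
      rw [Finset.sum_comm]
      calc ∑ l, ∑ i, ‖Y l i‖ ^ 2 / x l = ∑ l : Fin P, x l / x l :=
            Finset.sum_congr rfl fun l _ => by rw [← Finset.sum_div, ← hx]
        _ ≤ ∑ _l : Fin P, (1 : ℝ) := Finset.sum_le_sum fun l _ => div_self_le_one _
        _ = P := by simp
    have hgain : ∑ i, (∑ l, ‖Y l i‖ ^ 2 / x l) * waterGain ζ (s i) ≤
        ∑ l ∈ Finset.range P, waterGain ζ (σ l) := by
      rw [← Equiv.sum_comp e.symm]
      simp only [← hσs]
      refine sum_weight_mul_le_sum_range hP hPd (fun l => waterGain ζ (σ l))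
        (fun a b h => waterGain_mono hζ (hσ0 _) (hσ h)) (fun l => waterGain_nonneg hζ (hσ0 l))
        (fun j => ∑ l, ‖Y l (e.symm j)‖ ^ 2 / x l)
        (fun j => Finset.sum_nonneg fun l _ => div_nonneg (by positivity) (hx0 l))
        (fun j => sum_norm_sq_div_le_one Y x hY _) ?_
      rw [Equiv.sum_comp e.symm fun i => ∑ l, ‖Y l i‖ ^ 2 / x l]
      exact hmass
    -- The level equation writes `∑ x l` as `(∑ wf) * (ν₀ * ∑ x l)`, and the last factor is at most
    -- `ν`.
    have hpow : (∑ l, x l) / (ν * ζ ^ 2) ≤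
        (∑ l ∈ Finset.range P, wf (ζ * σ l)) / ζ ^ 2 := by
      rw [← div_div]
      gcongr
      rw [div_le_iff₀ hνpos]
      have : ∑ l, x l = (∑ l ∈ Finset.range P, wf (ζ * σ l)) * (ν₀ * ∑ l, x l) := by
        linear_combination (∑ l, x l) * (-1 : ℝ) * hlevel
      rw [this]
      exact mul_le_mul_of_nonneg_left hν (Finset.sum_nonneg fun l _ => wf_nonneg _)
    calc ∑ l, (∑ i, s i ^ 2 * ‖Y l i‖ ^ 2) / (x l + ν)
        = ∑ l, ∑ i, s i ^ 2 * ‖Y l i‖ ^ 2 / (x l + ν) :=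
          Finset.sum_congr rfl fun l _ => Finset.sum_div _ _ _
      _ ≤ ∑ l, ∑ i, (‖Y l i‖ ^ 2 / x l * waterGain ζ (s i) + ‖Y l i‖ ^ 2 / (ν * ζ ^ 2)) :=
          Finset.sum_le_sum fun l _ => Finset.sum_le_sum fun i _ => hterm l i
      _ = ∑ i, (∑ l, ‖Y l i‖ ^ 2 / x l) * waterGain ζ (s i) + (∑ l, x l) / (ν * ζ ^ 2) := by
          simp only [Finset.sum_add_distrib]
          congr 1
          · rw [Finset.sum_comm]
            exact Finset.sum_congr rfl fun i _ => (Finset.sum_mul _ _ _).symm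
          · rw [Finset.sum_div]
            exact Finset.sum_congr rfl fun l _ => by rw [hx, Finset.sum_div]
      _ ≤ ∑ l ∈ Finset.range P, waterGain ζ (σ l) +
            (∑ l ∈ Finset.range P, wf (ζ * σ l)) / ζ ^ 2 := add_le_add hgain hpow
      _ = _ := by
          rw [Finset.sum_div, ← Finset.sum_add_distrib]
          exact Finset.sum_congr rfl fun l _ => by rw [waterGain]; ring

/-- With diagonal `Y Yᴴ` the objective decouples over the entries of `B`, and completing the square
costs `‖(Y Hᴴ)_l‖² / (x l + ν)` for each row. As `Hᴴ H` is diagonal, these row norms are the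
weighted sums bounded by `sum_sum_le_waterfilling`. -/
theorem neg_waterfilling_le_of_diagonal {s : n → ℝ} (hs : ∀ i, 0 ≤ s i) {d P : ℕ}
    (e : n ≃ Fin d)
    (hP : 1 ≤ P) (hPd : P ≤ d) {σ : ℕ → ℝ} (hσ : Antitone σ) (hσ0 : ∀ l, 0 ≤ σ l)
    (hσs : ∀ l : Fin d, σ l = s (e.symm l)) {ζ ν₀ ν : ℝ} (hζ : 0 < ζ) (hν₀ : 0 < ν₀)
    (hlevel : ν₀ * ∑ l ∈ Finset.range P, wf (ζ * σ l) = 1)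
    (H : Matrix m n ℂ)
    (hH : H.conjTranspose * H = Matrix.diagonal fun i => ((s i ^ 2 : ℝ) : ℂ))
    (Y : Matrix (Fin P) n ℂ) (x : Fin P → ℝ)
    (hY : Y * Y.conjTranspose = Matrix.diagonal fun l => (x l : ℂ))
    (hν : ν₀ * ∑ l, x l ≤ ν) (B : Matrix m (Fin P) ℂ) :
    -∑ l ∈ Finset.range P, σ l ^ 2 * wf (ζ * σ l) / (wf (ζ * σ l) + 1) ≤
      ∑ l, (x l + ν) * ∑ p, ‖B p l‖ ^ 2 - 2 * (B * Y * H.conjTranspose).trace.re := by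
  have hx : ∀ l, x l = ∑ i, ‖Y l i‖ ^ 2 := by
    intro l
    have := mul_conjTranspose_apply_self Y l
    rw [hY, Matrix.diagonal_apply_eq] at this
    exact_mod_cast this
  have hx0 : ∀ l, 0 ≤ x l := fun l => by rw [hx]; positivity
  have hν0 : 0 ≤ ν := le_trans (mul_nonneg hν₀.le (Finset.sum_nonneg fun l _ => hx0 l)) hν
  have hrow : ∀ l, ∑ p, ‖(Y * H.conjTranspose) l p‖ ^ 2 = ∑ i, s i ^ 2 * ‖Y l i‖ ^ 2 := by
    intro l
    have h1 := mul_conjTranspose_apply_self (Y * H.conjTranspose) l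
    rw [Matrix.conjTranspose_mul, Matrix.conjTranspose_conjTranspose, Matrix.mul_assoc,
      ← Matrix.mul_assoc H.conjTranspose, hH, ← Matrix.mul_assoc, Matrix.mul_apply] at h1
    have h2 : (∑ j, (Y * Matrix.diagonal fun i => ((s i ^ 2 : ℝ) : ℂ)) l j *
        Y.conjTranspose j l) = ((∑ i, s i ^ 2 * ‖Y l i‖ ^ 2 : ℝ) : ℂ) := by
      push_cast
      refine Finset.sum_congr rfl fun i _ => ?_
      rw [Matrix.mul_diagonal, Matrix.conjTranspose_apply, RCLike.star_def, mul_right_comm,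
        Complex.mul_conj, Complex.normSq_eq_norm_sq]
      push_cast
      ring
    rw [h2] at h1
    exact_mod_cast h1.symm
  have hzero : ∀ l p, x l + ν = 0 → (Y * H.conjTranspose) l p = 0 := by
    intro l p h
    have hxl : x l = 0 := by linarith [hx0 l]
    rw [hx, Finset.sum_eq_zero_iff_of_nonneg fun _ _ => by positivity] at hxl
    rw [Matrix.mul_apply]
    refine Finset.sum_eq_zero fun i hi => ?_
    have : Y l i = 0 := by simpa using hxl i hi
    rw [this, zero_mul]
  have htr : (B * Y * H.conjTranspose).trace.re =
      ∑ l, ∑ p, (B p l * (Y * H.conjTranspose) l p).re := by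
    rw [Matrix.mul_assoc, Matrix.trace]
    simp only [Matrix.diag_apply, Matrix.mul_apply (M := B), Complex.re_sum]
    exact Finset.sum_comm
  rw [htr, Finset.mul_sum, ← Finset.sum_sub_distrib]
  refine le_trans (neg_le_neg (sum_sum_le_waterfilling hs e hP hPd hσ hσ0 hσs hζ hν₀ hlevel
    Y x hY hν)) ?_
  rw [← Finset.sum_neg_distrib]
  refine Finset.sum_le_sum fun l _ => ?_
  rw [← hrow, Finset.mul_sum, Finset.mul_sum, ← Finset.sum_sub_distrib, Finset.sum_div,
    ← Finset.sum_neg_distrib]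
  exact Finset.sum_le_sum fun p _ =>
    neg_div_le_quadratic (add_nonneg (hx0 l) hν0) _ _ (hzero l p)

/-- No processing matrices beat the waterfilling value. -/
theorem neg_waterfilling_le {s : n → ℝ} (hs : ∀ i, 0 ≤ s i) {d P : ℕ} (e : n ≃ Fin d)
    (hP : 1 ≤ P) (hPd : P ≤ d) {σ : ℕ → ℝ} (hσ : Antitone σ) (hσ0 : ∀ l, 0 ≤ σ l)
    (hσs : ∀ l : Fin d, σ l = s (e.symm l)) {ζ ν₀ ν : ℝ} (hζ : 0 < ζ) (hν₀ : 0 < ν₀)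
    (hlevel : ν₀ * ∑ l ∈ Finset.range P, wf (ζ * σ l) = 1)
    (H : Matrix m n ℂ) (W : Matrix n n ℂ) (hW : W ∈ Matrix.unitaryGroup n ℂ)
    (hH : H.conjTranspose * H =
      W * Matrix.diagonal (fun i => ((s i ^ 2 : ℝ) : ℂ)) * W.conjTranspose)
    (X : Matrix (Fin P) n ℂ) (hν : ν₀ * (X * X.conjTranspose).trace.re ≤ ν)
    (B : Matrix m (Fin P) ℂ) :
    -∑ l ∈ Finset.range P, σ l ^ 2 * wf (ζ * σ l) / (wf (ζ * σ l) + 1) ≤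
      (B * (X * X.conjTranspose + (ν : ℂ) • (1 : Matrix (Fin P) (Fin P) ℂ)) *
        B.conjTranspose).trace.re - 2 * (B * X * H.conjTranspose).trace.re := by
  have hXX : (X * X.conjTranspose).PosSemidef := Matrix.posSemidef_self_mul_conjTranspose X
  set x := hXX.1.eigenvalues with hx
  have hspec := hXX.1.spectral_theorem
  rw [Unitary.conjStarAlgAut_apply] at hspec
  set T : Matrix (Fin P) (Fin P) ℂ := hXX.1.eigenvectorUnitary.1 with hT
  have hTT : T.conjTranspose * T = 1 := Matrix.mem_unitaryGroup_iff'.1 hXX.1.eigenvectorUnitary.2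
  have hTT' : T * T.conjTranspose = 1 := Matrix.mem_unitaryGroup_iff.1 hXX.1.eigenvectorUnitary.2
  have hWW : W.conjTranspose * W = 1 := Matrix.mem_unitaryGroup_iff'.1 hW
  have hWW' : W * W.conjTranspose = 1 := Matrix.mem_unitaryGroup_iff.1 hW
  have hXX' : X * X.conjTranspose =
      T * Matrix.diagonal (fun l => (x l : ℂ)) * T.conjTranspose := hspec
  -- The objective does not change when `X`, `B`, `H` are replaced by `Tᴴ X W`, `B T`, `H W`; the
  -- new matrices satisfy the diagonal hypotheses.
  set Y : Matrix (Fin P) n ℂ := T.conjTranspose * X * W with hYdef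
  have hY : Y * Y.conjTranspose = Matrix.diagonal fun l => (x l : ℂ) := by
    calc Y * Y.conjTranspose
        = T.conjTranspose * X * (W * W.conjTranspose) * X.conjTranspose * T := by
          simp only [hYdef, Matrix.conjTranspose_mul, Matrix.conjTranspose_conjTranspose,
            Matrix.mul_assoc]
      _ = T.conjTranspose * (X * X.conjTranspose) * T := by
          rw [hWW', Matrix.mul_one, ← Matrix.mul_assoc]
      _ = (T.conjTranspose * T) * Matrix.diagonal (fun l => (x l : ℂ)) *
            (T.conjTranspose * T) := by
          rw [hXX']; simp only [Matrix.mul_assoc]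
      _ = _ := by rw [hTT, Matrix.one_mul, Matrix.mul_one]
  have hH' : (H * W).conjTranspose * (H * W) =
      Matrix.diagonal fun i => ((s i ^ 2 : ℝ) : ℂ) := by
    calc (H * W).conjTranspose * (H * W)
        = W.conjTranspose * (H.conjTranspose * H) * W := by
          simp only [Matrix.conjTranspose_mul, Matrix.mul_assoc]
      _ = (W.conjTranspose * W) * Matrix.diagonal (fun i => ((s i ^ 2 : ℝ) : ℂ)) *
            (W.conjTranspose * W) := by
          rw [hH]; simp only [Matrix.mul_assoc]
      _ = _ := by rw [hWW, Matrix.one_mul, Matrix.mul_one]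
  have htrace : (X * X.conjTranspose).trace.re = ∑ l, x l := by
    rw [hXX', Matrix.trace_mul_comm, ← Matrix.mul_assoc, hTT, Matrix.one_mul,
      Matrix.trace_diagonal, Complex.re_sum]
    simp
  rw [htrace] at hν
  refine (neg_waterfilling_le_of_diagonal hs e hP hPd hσ hσ0 hσs hζ hν₀ hlevel (H * W) hH' Y x hY
    hν (B * T)).trans (le_of_eq ?_)
  congr 1
  · have h1 : B * (X * X.conjTranspose + (ν : ℂ) • (1 : Matrix (Fin P) (Fin P) ℂ)) *
        B.conjTranspose = B * T * Matrix.diagonal (fun l => ((x l + ν : ℝ) : ℂ)) *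
          (B * T).conjTranspose := by
      have h2 : X * X.conjTranspose + (ν : ℂ) • (1 : Matrix (Fin P) (Fin P) ℂ) =
          T * Matrix.diagonal (fun l => ((x l + ν : ℝ) : ℂ)) * T.conjTranspose := by
        have h3 : Matrix.diagonal (fun l => ((x l + ν : ℝ) : ℂ)) =
            Matrix.diagonal (fun l => (x l : ℂ)) +
              (ν : ℂ) • (1 : Matrix (Fin P) (Fin P) ℂ) := by
          rw [← Matrix.diagonal_one, ← Matrix.diagonal_smul, Matrix.diagonal_add]
          congr 1
          ext l
          simp
        rw [h3, Matrix.mul_add, Matrix.add_mul, ← hXX', Matrix.mul_smul, Matrix.smul_mul,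
          Matrix.mul_one, hTT']
      rw [h2]
      simp only [Matrix.conjTranspose_mul, Matrix.mul_assoc]
    rw [h1, Matrix.trace_mul_comm, ← Matrix.mul_assoc, Matrix.trace, Complex.re_sum]
    refine Finset.sum_congr rfl fun l _ => ?_
    rw [Matrix.diag_apply, Matrix.mul_diagonal, conjTranspose_mul_apply_self,
      ← Complex.ofReal_mul, Complex.ofReal_re, mul_comm]
  · congr 3
    calc B * T * Y * (H * W).conjTranspose
        = B * (T * T.conjTranspose) * X * (W * W.conjTranspose) * H.conjTranspose := by
          simp only [hYdef, Matrix.conjTranspose_mul, Matrix.mul_assoc]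
      _ = _ := by rw [hTT', hWW', Matrix.mul_one, Matrix.mul_one]

end LowerBound

/-! ### Cross-correlation matrices and the MSE of linear estimates -/

section CrossCorrelation

variable {Ω : Type*} [MeasurableSpace Ω] {μ : Measure Ω}

/-- The cross-correlation matrix `E {u vᴴ}` of two random vectors. -/
noncomputable def crossCorr {ι κ : Type*} (μ : Measure Ω) (u : Ω → ι → ℂ) (v : Ω → κ → ℂ) :
    Matrix ι κ ℂ :=
  Matrix.of fun i j => ∫ ω, u ω i * conj (v ω j) ∂μ

theorem integrable_mul_conj {u v : Ω → ℂ} (hu : MemLp u 2 μ) (hv : MemLp v 2 μ) :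
    Integrable (fun ω => u ω * conj (v ω)) μ :=
  hu.integrable_mul hv.star

theorem crossCorr_conjTranspose {ι κ : Type*} (u : Ω → ι → ℂ) (v : Ω → κ → ℂ) :
    (crossCorr μ u v).conjTranspose = crossCorr μ v u := by
  ext i j
  simp only [crossCorr, Matrix.conjTranspose_apply, Matrix.of_apply, RCLike.star_def]
  rw [← integral_conj]
  simp [mul_comm]

theorem crossCorr_add_left {ι κ : Type*} {u u' : Ω → ι → ℂ} {v : Ω → κ → ℂ}
    (hu : ∀ i, MemLp (fun ω => u ω i) 2 μ) (hu' : ∀ i, MemLp (fun ω => u' ω i) 2 μ)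
    (hv : ∀ i, MemLp (fun ω => v ω i) 2 μ) :
    crossCorr μ (fun ω => u ω + u' ω) v = crossCorr μ u v + crossCorr μ u' v := by
  ext i j
  simp only [crossCorr, Matrix.add_apply, Matrix.of_apply, Pi.add_apply, add_mul]
  exact integral_add (integrable_mul_conj (hu i) (hv j)) (integrable_mul_conj (hu' i) (hv j))

theorem crossCorr_sub_left {ι κ : Type*} {u u' : Ω → ι → ℂ} {v : Ω → κ → ℂ}
    (hu : ∀ i, MemLp (fun ω => u ω i) 2 μ) (hu' : ∀ i, MemLp (fun ω => u' ω i) 2 μ)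
    (hv : ∀ i, MemLp (fun ω => v ω i) 2 μ) :
    crossCorr μ (fun ω => u ω - u' ω) v = crossCorr μ u v - crossCorr μ u' v := by
  ext i j
  simp only [crossCorr, Matrix.sub_apply, Matrix.of_apply, Pi.sub_apply, sub_mul]
  exact integral_sub (integrable_mul_conj (hu i) (hv j)) (integrable_mul_conj (hu' i) (hv j))

theorem memLp_mulVec {ι κ : Type*} [Fintype κ] (B : Matrix ι κ ℂ) {u : Ω → κ → ℂ}
    (hu : ∀ i, MemLp (fun ω => u ω i) 2 μ) (i : ι) :
    MemLp (fun ω => (B.mulVec (u ω)) i) 2 μ := by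
  simp only [Matrix.mulVec, dotProduct]
  exact memLp_finsetSum _ fun k _ => (hu k).const_mul _

theorem crossCorr_mulVec_left {ι κ l : Type*} [Fintype κ] (B : Matrix ι κ ℂ)
    {u : Ω → κ → ℂ} {v : Ω → l → ℂ} (hu : ∀ i, MemLp (fun ω => u ω i) 2 μ)
    (hv : ∀ i, MemLp (fun ω => v ω i) 2 μ) :
    crossCorr μ (fun ω => B.mulVec (u ω)) v = B * crossCorr μ u v := by
  ext i j
  simp only [crossCorr, Matrix.of_apply, Matrix.mulVec, dotProduct, Matrix.mul_apply,
    Finset.sum_mul]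
  rw [integral_finsetSum _ fun k _ => ?_]
  · refine Finset.sum_congr rfl fun k _ => ?_
    simp only [mul_assoc]
    exact integral_const_mul _ _
  · simp only [mul_assoc]
    exact (integrable_mul_conj (hu k) (hv j)).const_mul _

theorem crossCorr_mulVec_right {ι κ l : Type*} [Fintype κ] (B : Matrix ι κ ℂ)
    {u : Ω → κ → ℂ} {v : Ω → l → ℂ} (hu : ∀ i, MemLp (fun ω => u ω i) 2 μ)
    (hv : ∀ i, MemLp (fun ω => v ω i) 2 μ) :
    crossCorr μ v (fun ω => B.mulVec (u ω)) = crossCorr μ v u * B.conjTranspose := by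
  rw [← crossCorr_conjTranspose, crossCorr_mulVec_left B hu hv, Matrix.conjTranspose_mul,
    crossCorr_conjTranspose]

theorem integral_norm_sq_eq {u : Ω → ℂ} :
    ((∫ ω, ‖u ω‖ ^ 2 ∂μ : ℝ) : ℂ) = ∫ ω, u ω * conj (u ω) ∂μ := by
  rw [← integral_complex_ofReal]
  simp [Complex.mul_conj']

theorem integral_norm_sq_eq_crossCorr {ι : Type*} (u : Ω → ι → ℂ) (i : ι) :
    ((∫ ω, ‖u ω i‖ ^ 2 ∂μ : ℝ) : ℂ) = crossCorr μ u u i i := by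
  rw [integral_norm_sq_eq, crossCorr, Matrix.of_apply]

theorem integral_sum_norm_sq {ι : Type*} [Fintype ι] {u : Ω → ι → ℂ}
    (hu : ∀ i, MemLp (fun ω => u ω i) 2 μ) :
    ∫ ω, ∑ i, ‖u ω i‖ ^ 2 ∂μ = (crossCorr μ u u).trace.re := by
  rw [integral_finsetSum _ fun i _ => (hu i).integrable_norm_pow two_ne_zero, Matrix.trace,
    Complex.re_sum]
  refine Finset.sum_congr rfl fun i _ => ?_
  rw [Matrix.diag_apply, ← integral_norm_sq_eq_crossCorr, Complex.ofReal_re]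

/-- The quadratic form at `x` is E|xᴴu|². The row vector `xᴴ` appears as a matrix indexed by `Unit`,
so that the rules for `mulVec` apply. -/
theorem posSemidef_crossCorr_self {ι : Type*} [Fintype ι] {u : Ω → ι → ℂ}
    (hu : ∀ i, MemLp (fun ω => u ω i) 2 μ) : (crossCorr μ u u).PosSemidef := by
  rw [Matrix.posSemidef_iff_dotProduct_mulVec]
  refine ⟨crossCorr_conjTranspose u u, fun x => ?_⟩
  have h1 := crossCorr_mulVec_left (μ := μ) (Matrix.of fun (_ : Unit) i => conj (x i)) hu hu
  have h2 := crossCorr_mulVec_right (μ := μ) (Matrix.of fun (_ : Unit) i => conj (x i)) hu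
    (memLp_mulVec (Matrix.of fun (_ : Unit) i => conj (x i)) hu)
  rw [h1] at h2
  have h3 := integral_norm_sq_eq_crossCorr (μ := μ)
    (fun ω => (Matrix.of fun (_ : Unit) i => conj (x i)).mulVec (u ω)) ()
  rw [h2] at h3
  have h4 : star x ⬝ᵥ (crossCorr μ u u).mulVec x =
      ((Matrix.of fun (_ : Unit) i => conj (x i)) * crossCorr μ u u *
        (Matrix.of fun (_ : Unit) i => conj (x i)).conjTranspose) () () := by
    rw [Matrix.mul_assoc]
    simp [Matrix.mul_apply, dotProduct, Matrix.mulVec]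
  rw [h4, ← h3, Complex.zero_le_real]
  positivity

/-- The MSE of a linear estimate, in terms of second-order statistics. -/
theorem integral_sum_norm_sub_sq {ι P : Type*} [Fintype ι] [Fintype P] {G : Ω → ι → ℂ}
    {q : Ω → P → ℂ} (hG : ∀ i, MemLp (fun ω => G ω i) 2 μ) (hq : ∀ i, MemLp (fun ω => q ω i) 2 μ)
    (B : Matrix ι P ℂ) :
    ∫ ω, ∑ p, ‖G ω p - (B.mulVec (q ω)) p‖ ^ 2 ∂μ = (crossCorr μ G G).trace.re +
      ((B * crossCorr μ q q * B.conjTranspose).trace.re -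
        2 * (B * crossCorr μ q G).trace.re) := by
  have hBq := memLp_mulVec B hq
  have hd : ∀ i, MemLp (fun ω => (G ω - B.mulVec (q ω)) i) 2 μ := fun i => (hG i).sub (hBq i)
  have h := integral_sum_norm_sq hd
  simp only [Pi.sub_apply] at h
  have h1 : crossCorr μ G (fun ω => G ω - B.mulVec (q ω)) =
      crossCorr μ G G - (B * crossCorr μ q G).conjTranspose := by
    rw [← crossCorr_conjTranspose, crossCorr_sub_left hG hBq hG, Matrix.conjTranspose_sub,
      crossCorr_conjTranspose, crossCorr_mulVec_left B hq hG]
  have h2 : crossCorr μ (fun ω => B.mulVec (q ω)) (fun ω => G ω - B.mulVec (q ω)) =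
      B * crossCorr μ q G - B * crossCorr μ q q * B.conjTranspose := by
    rw [← crossCorr_conjTranspose, crossCorr_sub_left hG hBq hBq, Matrix.conjTranspose_sub,
      crossCorr_conjTranspose, crossCorr_conjTranspose, crossCorr_mulVec_left B hq hG,
      crossCorr_mulVec_right B hq hBq, crossCorr_mulVec_left B hq hq]
  rw [h, crossCorr_sub_left hG hBq hd, h1, h2]
  simp only [Matrix.trace_sub, Matrix.trace_conjTranspose, Complex.sub_re, RCLike.star_def,
    Complex.conj_re]
  ring

end CrossCorrelation

/-! ### The MSE of a system with additive white quantization noise -/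

section ADC

variable {Ω : Type*} [MeasurableSpace Ω] {μ : Measure Ω}

theorem IsADCOutput.memLp_output {ι κ : Type*} {P M : ℕ} {γ : ℝ} {G : Ω → ι → ℂ} {Y : Ω → κ → ℂ}
    {x q : Ω → Fin P → ℂ} (h : IsADCOutput μ G Y M γ x q)
    (hx : ∀ i, MemLp (fun ω => x ω i) 2 μ) (i : Fin P) : MemLp (fun ω => q ω i) 2 μ := by
  have := (h.memLp i).add (hx i)
  refine this.congr_norm ?_ ?_
  · have h2 := this.1
    refine h2.congr (Eventually.of_forall fun ω => ?_)
    simp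
  · exact Eventually.of_forall fun ω => by simp

/-- The MSE of a system with ADCs, in terms of the second-order statistics of the signals. -/
theorem IsADCOutput.integral_sum_norm_sub_sq {ι κ : Type*} [Fintype ι] [Fintype κ] {P M : ℕ}
    {γ : ℝ} {G : Ω → ι → ℂ} {Y : Ω → κ → ℂ} {A : Matrix (Fin P) κ ℂ} {q : Ω → Fin P → ℂ}
    (h : IsADCOutput μ G Y M γ (fun ω => A.mulVec (Y ω)) q)
    (hG : ∀ i, MemLp (fun ω => G ω i) 2 μ) (hY : ∀ i, MemLp (fun ω => Y ω i) 2 μ)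
    (B : Matrix ι (Fin P) ℂ) :
    ∫ ω, ∑ p, ‖G ω p - (B.mulVec (q ω)) p‖ ^ 2 ∂μ = (crossCorr μ G G).trace.re +
      ((B * (A * crossCorr μ Y Y * A.conjTranspose +
        (((2 * γ / M) ^ 2 / 3 : ℝ) : ℂ) • (1 : Matrix (Fin P) (Fin P) ℂ)) *
          B.conjTranspose).trace.re -
        2 * (B * A * (crossCorr μ G Y).conjTranspose).trace.re) := by
  have hAY := memLp_mulVec A hY
  have hq := h.memLp_output hAY
  set E : Ω → Fin P → ℂ := fun ω => q ω - A.mulVec (Y ω) with hE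
  have hEm : ∀ i, MemLp (fun ω => E ω i) 2 μ := h.memLp
  have hqE : q = fun ω => A.mulVec (Y ω) + E ω := by
    funext ω; simp [hE]
  have hEY : crossCorr μ E Y = 0 := by
    ext l p
    exact h.uncorr_y l p
  have hEG : crossCorr μ E G = 0 := by
    ext l p
    exact h.uncorr_g l p
  have hYE : crossCorr μ Y E = 0 := by
    rw [← crossCorr_conjTranspose, hEY, Matrix.conjTranspose_zero]
  have hEE : crossCorr μ E E = (((2 * γ / M) ^ 2 / 3 : ℝ) : ℂ) • (1 : Matrix (Fin P) (Fin P) ℂ) := by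
    ext l m
    simp only [crossCorr, Matrix.of_apply, Matrix.smul_apply, Matrix.one_apply, smul_eq_mul,
      mul_ite, mul_one, mul_zero]
    exact h.white l m
  have hqG : crossCorr μ q G = A * (crossCorr μ G Y).conjTranspose := by
    rw [hqE, crossCorr_add_left hAY hEm hG, hEG, add_zero, crossCorr_mulVec_left A hY hG,
      crossCorr_conjTranspose]
  have hAYq : crossCorr μ (fun ω => A.mulVec (Y ω)) q =
      A * crossCorr μ Y Y * A.conjTranspose := by
    rw [← crossCorr_conjTranspose, hqE, crossCorr_add_left hAY hEm hAY,
      Matrix.conjTranspose_add, crossCorr_conjTranspose, crossCorr_conjTranspose,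
      crossCorr_mulVec_left A hY hEm, hYE, Matrix.mul_zero, add_zero,
      crossCorr_mulVec_left A hY hAY, crossCorr_mulVec_right A hY hY, Matrix.mul_assoc]
  have hEq : crossCorr μ E q =
      (((2 * γ / M) ^ 2 / 3 : ℝ) : ℂ) • (1 : Matrix (Fin P) (Fin P) ℂ) := by
    rw [← crossCorr_conjTranspose, hqE, crossCorr_add_left hAY hEm hEm,
      Matrix.conjTranspose_add, crossCorr_conjTranspose, crossCorr_conjTranspose, hEE,
      crossCorr_mulVec_right A hY hEm, hEY, Matrix.zero_mul, zero_add]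
  have hqq : crossCorr μ q q = A * crossCorr μ Y Y * A.conjTranspose +
      (((2 * γ / M) ^ 2 / 3 : ℝ) : ℂ) • (1 : Matrix (Fin P) (Fin P) ℂ) := by
    have := crossCorr_add_left hAY hEm hq
    rw [← hqE, hAYq, hEq] at this
    exact this
  rw [TaskQuant.integral_sum_norm_sub_sq hG hq B, hqG, hqq, Matrix.mul_assoc B A]

end ADC

/-! ### Second-order statistics of the signal model -/

section Model

variable {Ω : Type*} [MeasurableSpace Ω] {μ : Measure Ω} [IsProbabilityMeasure μ] {K L : ℕ}
  {g : ℕ → Ω → Fin K → ℂ} {y : ℕ → Ω → Fin L → ℂ} {Cg : Matrix (Fin K) (Fin K) ℂ}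
  {Cy : Matrix (Fin L) (Fin L) ℂ} {Γ : Matrix (Fin K) (Fin L) ℂ} {c : ℤ → ℂ}

omit [IsProbabilityMeasure μ] in
theorem SignalModel.memLp_stack_g (h : SignalModel μ g y Cg Cy Γ c) (N : ℕ) (p : Fin K × Fin N) :
    MemLp (fun ω => stack g N ω p) 2 μ := h.memLp_g _ _

omit [IsProbabilityMeasure μ] in
theorem SignalModel.memLp_stack_y (h : SignalModel μ g y Cg Cy Γ c) (N : ℕ) (p : Fin L × Fin N) :
    MemLp (fun ω => stack y N ω p) 2 μ := h.memLp_y _ _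

omit [IsProbabilityMeasure μ] in
theorem SignalModel.crossCorr_g (h : SignalModel μ g y Cg Cy Γ c) (N : ℕ) :
    crossCorr μ (stack g N) (stack g N) = Cg ⊗ₖ toeplitz c N := by
  ext p p'
  exact h.corr_g _ _ _ _

omit [IsProbabilityMeasure μ] in
theorem SignalModel.crossCorr_y (h : SignalModel μ g y Cg Cy Γ c) (N : ℕ) :
    crossCorr μ (stack y N) (stack y N) = Cy ⊗ₖ toeplitz c N := by
  ext p p'
  exact h.corr_y _ _ _ _

-- Orthogonality of the estimation error: the conjugate of `v` is measurable for the conditioning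
-- σ-algebra and can be pulled out of the conditional expectation.
omit [MeasurableSpace Ω] in
theorem integral_mul_conj_eq_of_condExp_ae_eq {m m₀ : MeasurableSpace Ω} {μ : Measure Ω}
    [IsFiniteMeasure μ] (hm : m ≤ m₀) {u v w : Ω → ℂ} (hu : MemLp u 2 μ) (hv : MemLp v 2 μ)
    (hvm : StronglyMeasurable[m] v) (h : μ[u | m] =ᵐ[μ] w) :
    ∫ ω, u ω * conj (v ω) ∂μ = ∫ ω, w ω * conj (v ω) ∂μ := by
  have hpull := condExp_bilin_of_stronglyMeasurable_right (μ := μ) (m := m)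
    (ContinuousLinearMap.mul ℝ ℂ) (Complex.continuous_conj.comp_stronglyMeasurable hvm) (f := u)
    (integrable_mul_conj hu hv) (hu.integrable one_le_two)
  calc ∫ ω, u ω * conj (v ω) ∂μ
      = ∫ ω, (μ[fun ω => u ω * conj (v ω) | m]) ω ∂μ := (integral_condExp hm).symm
    _ = ∫ ω, w ω * conj (v ω) ∂μ := by
        refine integral_congr_ae ?_
        filter_upwards [hpull, h] with ω h1 h2
        refine Eq.trans h1 ?_
        rw [h2]
        rfl

/-- The cross-correlation of desired and observed process follows from the MMSE estimate. -/
theorem SignalModel.corr_gy (h : SignalModel μ g y Cg Cy Γ c) (i j : ℕ) (k : Fin K)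
    (l : Fin L) : ∫ ω, g i ω k * conj (y j ω l) ∂μ = (Γ * Cy) k l * c ((i : ℤ) - j) := by
  -- A block long enough to contain both times: the MMSE hypothesis then covers `g i`, and `y j` is
  -- among the observations that are conditioned on.
  set N := max i j + 1 with hN
  have hi : i < N := by omega
  have hj : j < N := by omega
  have hyl : StronglyMeasurable[MeasurableSpace.comap (fun ω (j : Fin N) => y (j : ℕ) ω)
      inferInstance] fun ω => y j ω l := by
    have h2 : Measurable fun (z : Fin N → Fin L → ℂ) => z ⟨j, hj⟩ l :=
      (measurable_pi_apply l).comp (measurable_pi_apply _)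
    exact (h2.comp (comap_measurable _)).stronglyMeasurable
  calc ∫ ω, g i ω k * conj (y j ω l) ∂μ
      = ∫ ω, (Γ.mulVec (y i ω)) k * conj (y j ω l) ∂μ :=
        integral_mul_conj_eq_of_condExp_ae_eq
          (Measurable.comap_le (measurable_pi_lambda (fun ω (j : Fin N) => y (j : ℕ) ω)
            fun j => h.measurable_y j)) (h.memLp_g i k) (h.memLp_y j l) hyl (h.mmse N i hi k)
    _ = crossCorr μ (fun ω => Γ.mulVec (y i ω)) (y j) k l := rfl
    _ = (Γ * Cy) k l * c ((i : ℤ) - j) := by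
        rw [crossCorr_mulVec_left Γ (h.memLp_y i) (h.memLp_y j), Matrix.mul_apply,
          Matrix.mul_apply, Finset.sum_mul]
        exact Finset.sum_congr rfl fun l' _ => by
          rw [crossCorr, Matrix.of_apply, h.corr_y, mul_assoc]

theorem SignalModel.crossCorr_gy (h : SignalModel μ g y Cg Cy Γ c) (N : ℕ) :
    crossCorr μ (stack g N) (stack y N) = (Γ * Cy) ⊗ₖ toeplitz c N := by
  ext p p'
  exact h.corr_gy _ _ _ _

-- Fixing one coordinate `l` of `y` selects a principal submatrix of the covariance `Cy ⊗ₖ toeplitz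
-- c N`, equal to `toeplitz c N` times the positive number `Cy l l`.
omit [IsProbabilityMeasure μ] in
theorem SignalModel.posSemidef_toeplitz (h : SignalModel μ g y Cg Cy Γ c) (hCy : Cy.PosDef)
    (hL : 0 < L) (N : ℕ) : (toeplitz c N).PosSemidef := by
  set l : Fin L := ⟨0, hL⟩
  have h1 := (posSemidef_crossCorr_self (h.memLp_stack_y N)).submatrix
    (fun i : Fin N => ((l, i) : Fin L × Fin N))
  have h2 : (crossCorr μ (stack y N) (stack y N)).submatrix
      (fun i : Fin N => ((l, i) : Fin L × Fin N)) (fun i : Fin N => ((l, i) : Fin L × Fin N)) =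
      Cy l l • toeplitz c N := by
    rw [h.crossCorr_y]
    ext i j
    simp
  rw [h2] at h1
  have hpos : 0 < Cy l l := hCy.diag_pos
  have h3 := h1.smul (inv_pos.2 hpos).le
  rwa [smul_smul, inv_mul_cancel₀ hpos.ne', one_smul] at h3

end Model

/-! ### Fourier coefficients of powers of the spectral density -/

section Fourier

theorem hasSum_of_forall_eq {ι : Type*} {f g : ι → ℂ} {a : ℂ} (h : HasSum g a)
    (hfg : ∀ s, f s = g s) : HasSum f a :=
  (funext hfg : f = g) ▸ h

/-- The complex exponential with integer frequency. -/
noncomputable def expI (w : ℝ) (τ : ℤ) : ℂ := Complex.exp (Complex.I * w * τ)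

theorem norm_expI (w : ℝ) (τ : ℤ) : ‖expI w τ‖ = 1 := by
  rw [expI, show Complex.I * w * τ = ((w * τ : ℝ) : ℂ) * Complex.I by push_cast; ring]
  exact Complex.norm_exp_ofReal_mul_I _

theorem expI_add (w : ℝ) (σ τ : ℤ) : expI w (σ + τ) = expI w σ * expI w τ := by
  rw [expI, expI, expI, ← Complex.exp_add]
  congr 1
  push_cast
  ring

theorem expI_zero (w : ℝ) : expI w 0 = 1 := by simp [expI]

theorem conj_expI (w : ℝ) (τ : ℤ) : conj (expI w τ) = expI w (-τ) := by
  simp [expI, ← Complex.exp_conj]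

theorem continuous_expI (τ : ℤ) : Continuous fun w => expI w τ := by
  unfold expI; fun_prop

theorem integral_expI (τ : ℤ) :
    ∫ w in (0 : ℝ)..(2 * Real.pi), expI w τ = if τ = 0 then (2 * Real.pi : ℂ) else 0 := by
  split_ifs with h
  · subst h; simp [expI_zero]
  · have hc : Complex.I * (τ : ℂ) ≠ 0 := mul_ne_zero Complex.I_ne_zero (by exact_mod_cast h)
    have h1 : ∀ w : ℝ, expI w τ = Complex.exp (Complex.I * τ * w) := fun w => by
      rw [expI]; congr 1; ring
    simp only [h1]
    rw [integral_exp_mul_complex hc]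
    have h2 : Complex.exp (Complex.I * τ * ((2 * Real.pi : ℝ) : ℂ)) = 1 := by
      rw [Complex.exp_eq_one_iff]
      exact ⟨τ, by push_cast; ring⟩
    rw [h2]
    simp

/-- The complex-valued Fourier series of an autocorrelation. -/
noncomputable def psdC (c : ℤ → ℂ) (w : ℝ) : ℂ := ∑' τ : ℤ, c τ * expI w (-τ)

theorem psd_eq_re (c : ℤ → ℂ) (w : ℝ) : psd c w = (psdC c w).re := by
  simp [psd, psdC, expI]

variable {c : ℤ → ℂ}

theorem hasSum_psdC (hc : Summable fun τ => ‖c τ‖) (w : ℝ) :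
    HasSum (fun τ => c τ * expI w (-τ)) (psdC c w) := by
  refine Summable.hasSum (Summable.of_norm ?_)
  simpa [norm_expI] using hc

theorem continuous_psdC (hc : Summable fun τ => ‖c τ‖) : Continuous (psdC c) := by
  refine continuous_tsum (fun τ => continuous_const.mul (continuous_expI _)) hc fun τ w => ?_
  simp [norm_expI]

theorem norm_psdC_le (hc : Summable fun τ => ‖c τ‖) (w : ℝ) : ‖psdC c w‖ ≤ ∑' τ, ‖c τ‖ := by
  refine (norm_tsum_le_tsum_norm ?_).trans_eq ?_
  · simpa [norm_expI] using hc
  · simp [norm_expI]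

theorem psdC_eq_psd (hsymm : ∀ τ, c (-τ) = conj (c τ)) (w : ℝ) :
    psdC c w = (psd c w : ℂ) := by
  rw [psd_eq_re, eq_comm, ← Complex.conj_eq_iff_re, psdC, Complex.conj_tsum,
    ← (Equiv.neg ℤ).tsum_eq]
  refine tsum_congr fun τ => ?_
  simp [conj_expI, hsymm]

/-- The Fourier coefficients of the powers of the spectral density. -/
noncomputable def psdPowCoeff (c : ℤ → ℂ) (k : ℕ) (τ : ℤ) : ℂ :=
  (1 / (2 * Real.pi)) * ∫ w in (0 : ℝ)..(2 * Real.pi), psdC c w ^ k * expI w τ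

theorem two_pi_ne_zero_complex : (2 * Real.pi : ℂ) ≠ 0 := by
  exact_mod_cast Real.two_pi_pos.ne'

theorem psdPowCoeff_zero (τ : ℤ) : psdPowCoeff c 0 τ = if τ = 0 then 1 else 0 := by
  simp only [psdPowCoeff, pow_zero, one_mul, integral_expI]
  split_ifs
  · rw [one_div, inv_mul_cancel₀ two_pi_ne_zero_complex]
  · simp

/-- Multiplying by one more factor S convolves the coefficients with `c`. Term-by-term integration
is dominated by `‖c s‖` times a power of the bound `∑' ‖c τ‖` on |S|. -/
theorem hasSum_psdPowCoeff_succ (hc : Summable fun τ => ‖c τ‖) (k : ℕ) (τ : ℤ) :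
    HasSum (fun s => c s * psdPowCoeff c k (τ - s)) (psdPowCoeff c (k + 1) τ) := by
  have hS := continuous_psdC hc
  have h := intervalIntegral.hasSum_integral_of_dominated_convergence (μ := volume) (a := 0)
    (b := 2 * Real.pi)
    (F := fun (s : ℤ) w => c s * (psdC c w ^ k * expI w (τ - s)))
    (f := fun w => psdC c w ^ (k + 1) * expI w τ)
    (fun s _ => ‖c s‖ * (∑' τ, ‖c τ‖) ^ k)
    (fun s => (continuous_const.mul ((hS.pow k).mul
      (continuous_expI _))).aestronglyMeasurable)
    (fun s => Eventually.of_forall fun w _ => by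
      rw [norm_mul, norm_mul, norm_expI, mul_one, norm_pow]
      gcongr
      exact norm_psdC_le hc w)
    (Eventually.of_forall fun w _ => hc.mul_right _)
    intervalIntegrable_const
    (Eventually.of_forall fun w _ => by
      have h1 := (hasSum_psdC hc w).mul_right (psdC c w ^ k * expI w τ)
      rw [show psdC c w ^ (k + 1) * expI w τ = psdC c w * (psdC c w ^ k * expI w τ) by ring]
      refine hasSum_of_forall_eq h1 fun s => ?_
      rw [sub_eq_neg_add, expI_add]
      ring)
  have h2 := h.mul_left (1 / (2 * Real.pi) : ℂ)
  refine hasSum_of_forall_eq h2 fun s => ?_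
  rw [intervalIntegral.integral_const_mul, psdPowCoeff]
  ring

theorem psdPowCoeff_one (hc : Summable fun τ => ‖c τ‖) (τ : ℤ) : psdPowCoeff c 1 τ = c τ := by
  have h := hasSum_psdPowCoeff_succ hc 0 τ
  simp only [psdPowCoeff_zero] at h
  have h2 := hasSum_single (f := fun s => c s * if τ - s = 0 then 1 else 0) τ (by
    intro s hs
    have : τ - s ≠ 0 := sub_ne_zero.2 (Ne.symm hs)
    simp [this])
  simpa using h.unique h2

/-- Absolutely summable sequences are closed under convolution, so the powers of S keep absolutely
summable coefficients. -/
theorem summable_psdPowCoeff (hc : Summable fun τ => ‖c τ‖) (k : ℕ) :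
    Summable fun τ => ‖psdPowCoeff c k τ‖ := by
  induction k with
  | zero =>
    refine summable_of_ne_finset_zero (s := {0}) fun τ hτ => ?_
    rw [psdPowCoeff_zero, if_neg (by simpa using hτ), norm_zero]
  | succ k ih =>
    have h1 : Summable fun p : ℤ × ℤ => ‖c p.1‖ * ‖psdPowCoeff c k p.2‖ :=
      hc.mul_of_nonneg ih (fun _ => norm_nonneg _) fun _ => norm_nonneg _
    -- The shear `(τ, s) ↦ (s, τ - s)` turns the product family into the terms of the convolution.
    let φ : ℤ × ℤ ≃ ℤ × ℤ :=
      { toFun := fun p => (p.2, p.1 - p.2)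
        invFun := fun p => (p.2 + p.1, p.1)
        left_inv := fun p => by simp
        right_inv := fun p => by simp }
    have h2 : Summable fun p : ℤ × ℤ => ‖c p.2‖ * ‖psdPowCoeff c k (p.1 - p.2)‖ :=
      (φ.summable_iff (f := fun p : ℤ × ℤ => ‖c p.1‖ * ‖psdPowCoeff c k p.2‖)).2 h1
    have h3 := h2.prod
    refine Summable.of_nonneg_of_le (fun _ => norm_nonneg _) (fun τ => ?_) h3
    rw [← (hasSum_psdPowCoeff_succ hc k τ).tsum_eq]
    refine (norm_tsum_le_tsum_norm ?_).trans_eq ?_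
    · simpa using h2.prod_factor τ
    · simp

end Fourier

/-! ### Trace moments of Toeplitz matrices -/

section Trace

variable {c d d' : ℤ → ℂ}

/-- The mass of a sequence that a Toeplitz matrix of size `N` cuts off. -/
noncomputable def cutoffMass (c : ℤ → ℂ) (N : ℕ) : ℝ :=
  ∑ i : Fin N, ∑' l : ℤ, if 0 ≤ l ∧ l < N then 0 else ‖c (i - l)‖

theorem summable_sub_left {f : ℤ → ℝ} (hf : Summable f) (i : ℤ) :
    Summable fun l => f (i - l) :=
  (Equiv.subLeft i).summable_iff.2 hf

theorem tsum_sub_left (f : ℤ → ℝ) (i : ℤ) : ∑' l, f (i - l) = ∑' l, f l :=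
  (Equiv.subLeft i).tsum_eq f

theorem summable_ite_zero {f : ℤ → ℝ} (hf : Summable f) (hf0 : ∀ i, 0 ≤ f i) (p : ℤ → Prop)
    [DecidablePred p] : Summable fun l => if p l then 0 else f l :=
  Summable.of_nonneg_of_le (fun l => by split_ifs <;> simp [hf0])
    (fun l => by split_ifs <;> simp [hf0]) hf

/-- With `s = i - l`, the coefficient `c s` is cut off in at most `|s|` of the `N` rows. Its share
after division by `N` tends to 0 for each `s` and never exceeds 1, so dominated convergence applies
with bound `‖c s‖`. -/
theorem tendsto_cutoffMass_div (hc : Summable fun τ => ‖c τ‖) :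
    Tendsto (fun N : ℕ => cutoffMass c N / N) atTop (𝓝 0) := by
  have hrew : ∀ N : ℕ, cutoffMass c N / N =
      ∑' s : ℤ, ‖c s‖ * ((∑ i : Fin N, if 0 ≤ (i : ℤ) - s ∧ (i : ℤ) - s < N then (0 : ℝ) else 1) /
        N) := by
    intro N
    have h1 : ∀ i : Fin N, (∑' l : ℤ, if 0 ≤ l ∧ l < N then 0 else ‖c (i - l)‖) =
        ∑' s : ℤ, if 0 ≤ (i : ℤ) - s ∧ (i : ℤ) - s < N then 0 else ‖c s‖ := by
      intro i
      rw [← tsum_sub_left (fun s => if 0 ≤ (i : ℤ) - s ∧ (i : ℤ) - s < N then 0 else ‖c s‖) i]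
      exact tsum_congr fun l => by simp
    simp only [cutoffMass, h1]
    rw [← Summable.tsum_finsetSum (f := fun (i : Fin N) (s : ℤ) =>
      if 0 ≤ (i : ℤ) - s ∧ (i : ℤ) - s < N then 0 else ‖c s‖) fun i _ =>
      summable_ite_zero hc (fun _ => norm_nonneg _) fun s => 0 ≤ (i : ℤ) - s ∧ (i : ℤ) - s < N,
      ← tsum_div_const]
    refine tsum_congr fun s => ?_
    rw [← mul_div_assoc, Finset.mul_sum]
    simp only [mul_ite, mul_zero, mul_one]
  simp only [hrew]
  have hcount : ∀ (N : ℕ) (s : ℤ),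
      (∑ i : Fin N, if 0 ≤ (i : ℤ) - s ∧ (i : ℤ) - s < N then (0 : ℝ) else 1) ≤ s.natAbs := by
    intro N s
    have h1 : (∑ i : Fin N, if 0 ≤ (i : ℤ) - s ∧ (i : ℤ) - s < N then (0 : ℝ) else 1) =
        ((Finset.univ.filter fun i : Fin N => ¬ (0 ≤ (i : ℤ) - s ∧ (i : ℤ) - s < N)).card : ℝ) := by
      rw [Finset.card_filter]
      push_cast
      refine Finset.sum_congr rfl fun i _ => ?_
      split_ifs <;> simp_all
    rw [h1, Nat.cast_le]
    have h2 : (Finset.univ.filter fun i : Fin N => ¬ (0 ≤ (i : ℤ) - s ∧ (i : ℤ) - s < N)).card ≤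
        (Finset.range s.natAbs).card := by
      -- For `s ≥ 0` the affected rows are the first ones, `i < s`; for `s < 0` they are the last
      -- `|s|`, counted from the end.
      refine Finset.card_le_card_of_injOn
        (fun i => if 0 ≤ s then (i : ℕ) else N - 1 - (i : ℕ)) ?_ ?_
      · intro i hi
        have hi' := (Finset.mem_filter.1 hi).2
        have := i.2
        simp only [Finset.coe_range, Set.mem_Iio]
        split_ifs <;> omega
      · intro i hi j hj hij
        have := i.2
        have := j.2
        ext
        simp only at hij
        split_ifs at hij <;> omega
    simpa using h2
  have hcount' : ∀ (N : ℕ) (s : ℤ),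
      (∑ i : Fin N, if 0 ≤ (i : ℤ) - s ∧ (i : ℤ) - s < N then (0 : ℝ) else 1) ≤ N := by
    intro N s
    calc _ ≤ ∑ _i : Fin N, (1 : ℝ) := Finset.sum_le_sum fun i _ => by split_ifs <;> simp
      _ = N := by simp
  have hnn : ∀ (N : ℕ) (s : ℤ),
      (0 : ℝ) ≤ (∑ i : Fin N, if 0 ≤ (i : ℤ) - s ∧ (i : ℤ) - s < N then (0 : ℝ) else 1) :=
    fun N s => Finset.sum_nonneg fun i _ => by split_ifs <;> simp
  have hlim := tendsto_tsum_of_dominated_convergence (𝓕 := atTop)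
    (f := fun (N : ℕ) (s : ℤ) => ‖c s‖ *
      ((∑ i : Fin N, if 0 ≤ (i : ℤ) - s ∧ (i : ℤ) - s < N then (0 : ℝ) else 1) / N))
    (g := fun _ => 0) (bound := fun s => ‖c s‖) hc
    (fun s => by
      show Tendsto _ atTop (𝓝 (0 : ℝ))
      rw [show 𝓝 (0 : ℝ) = 𝓝 (‖c s‖ * 0) by rw [mul_zero]]
      refine Tendsto.const_mul _ ?_
      refine squeeze_zero (fun N => div_nonneg (hnn N s) (Nat.cast_nonneg _))
        (fun N => div_le_div_of_nonneg_right (hcount N s) (Nat.cast_nonneg _)) ?_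
      exact tendsto_const_div_atTop_nhds_zero_nat _)
    (Eventually.of_forall fun N s => by
      rw [Real.norm_of_nonneg (mul_nonneg (norm_nonneg _)
        (div_nonneg (hnn N s) (Nat.cast_nonneg _)))]
      exact mul_le_of_le_one_right (norm_nonneg _)
        (div_le_one_of_le₀ (hcount' N s) (Nat.cast_nonneg _)))
  simpa using hlim

theorem sum_fin_le_tsum {f : ℤ → ℝ} (hf : Summable f) (hf0 : ∀ i, 0 ≤ f i) (N : ℕ)
    (φ : Fin N → ℤ) (hφ : Function.Injective φ) : ∑ i, f (φ i) ≤ ∑' s, f s := by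
  have h := hf.sum_le_tsum (Finset.univ.map ⟨φ, hφ⟩) fun i _ => hf0 i
  simpa using h

/-- The entrywise `ℓ¹` distance between a product of Toeplitz matrices and the Toeplitz matrix of
the convolution is controlled by the cut-off mass. -/
theorem sum_norm_toeplitz_mul_sub_le (hc : Summable fun τ => ‖c τ‖)
    (hd : Summable fun τ => ‖d τ‖) (hcd : ∀ τ, HasSum (fun s => c s * d (τ - s)) (d' τ))
    (N : ℕ) : ∑ i, ∑ j, ‖(toeplitz c N * toeplitz d N - toeplitz d' N) i j‖ ≤
      cutoffMass c N * ∑' τ, ‖d τ‖ := by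
  have hdsum : ∀ l : ℤ, Summable fun j : ℤ => ‖d (l - j)‖ := fun l =>
    summable_sub_left (f := fun τ => ‖d τ‖) hd l
  -- The matrix product sums over `0 ≤ l < N` and the convolution over all integers `l`, so the
  -- difference is the sum over the remaining `l`.
  have hentry : ∀ i j : Fin N, ‖(toeplitz c N * toeplitz d N - toeplitz d' N) i j‖ ≤
      ∑' l : ℤ, if 0 ≤ l ∧ l < N then 0 else ‖c (i - l)‖ * ‖d (l - j)‖ := by
    intro i j
    have h1 : HasSum (fun l : ℤ => c (i - l) * d (l - j)) (d' (i - j)) := by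
      have h2 := (Equiv.subLeft (i : ℤ)).hasSum_iff.2 (hcd (i - j))
      convert h2 using 1
      funext l
      simp only [Function.comp_apply, Equiv.subLeft_apply]
      congr 2
      ring
    have hprodsum : Summable fun l : ℤ => ‖c (i - l)‖ * ‖d (l - j)‖ := by
      refine Summable.of_nonneg_of_le (fun l => by positivity) (fun l => ?_)
        ((summable_sub_left (f := fun τ => ‖c τ‖) hc i).mul_right (∑' τ, ‖d τ‖))
      exact mul_le_mul_of_nonneg_left (hd.le_tsum _ fun _ _ => norm_nonneg _) (norm_nonneg _)
    have h3 : (toeplitz c N * toeplitz d N) i j =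
        ∑ l ∈ (Finset.univ : Finset (Fin N)).map (Fin.valEmbedding.trans Nat.castEmbedding), c (i - l) * d (l - j) := by
      simp [Matrix.mul_apply, toeplitz, Finset.sum_map]
    have h4 : HasSum (fun l : ℤ => if 0 ≤ l ∧ l < N then c (i - l) * d (l - j) else 0)
        ((toeplitz c N * toeplitz d N) i j) := by
      rw [h3]
      have := hasSum_sum_of_ne_finset_zero (L := .unconditional ℤ) (f := fun l : ℤ =>
        if 0 ≤ l ∧ l < N then c (i - l) * d (l - j) else 0)
        (s := (Finset.univ : Finset (Fin N)).map (Fin.valEmbedding.trans Nat.castEmbedding)) (by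
          intro l hl
          rw [if_neg]
          rintro ⟨ha, hb⟩
          apply hl
          simp only [Finset.mem_map, Finset.mem_univ, true_and,
            Function.Embedding.trans_apply, Fin.valEmbedding_apply, Nat.castEmbedding_apply]
          exact ⟨⟨l.toNat, by omega⟩, by simp; omega⟩)
      convert this using 1
      refine Finset.sum_congr rfl fun l hl => ?_
      rw [if_pos]
      simp only [Finset.mem_map, Finset.mem_univ, true_and,
            Function.Embedding.trans_apply, Fin.valEmbedding_apply, Nat.castEmbedding_apply] at hl
      obtain ⟨a, rfl⟩ := hl
      have := a.2
      omega
    have h5 := h4.sub h1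
    have h6 : (toeplitz c N * toeplitz d N - toeplitz d' N) i j =
        (toeplitz c N * toeplitz d N) i j - d' (i - j) := rfl
    rw [h6, ← h5.tsum_eq]
    have hle : ∀ l : ℤ, ‖(if 0 ≤ l ∧ l < N then c (i - l) * d (l - j) else 0) -
        c (i - l) * d (l - j)‖ = if 0 ≤ l ∧ l < N then 0 else ‖c (i - l)‖ * ‖d (l - j)‖ := by
      intro l
      split_ifs <;> simp
    refine (norm_tsum_le_tsum_norm ?_).trans_eq (tsum_congr hle)
    simp only [hle]
    exact summable_ite_zero hprodsum (fun l => by positivity) fun l => 0 ≤ l ∧ l < N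
  rw [cutoffMass, Finset.sum_mul]
  refine Finset.sum_le_sum fun i _ => (Finset.sum_le_sum fun j _ => hentry i j).trans ?_
  have hsm : ∀ j : Fin N, Summable fun l : ℤ =>
      if 0 ≤ l ∧ l < N then 0 else ‖c (i - l)‖ * ‖d (l - j)‖ := by
    intro j
    refine summable_ite_zero (Summable.of_nonneg_of_le (fun l => by positivity) (fun l => ?_)
      ((summable_sub_left (f := fun τ => ‖c τ‖) hc i).mul_right (∑' τ, ‖d τ‖)))
      (fun l => by positivity) fun l => 0 ≤ l ∧ l < N
    exact mul_le_mul_of_nonneg_left (hd.le_tsum _ fun _ _ => norm_nonneg _) (norm_nonneg _)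
  have hsc : Summable fun l : ℤ => if 0 ≤ l ∧ l < N then 0 else ‖c (i - l)‖ :=
    summable_ite_zero (summable_sub_left (f := fun τ => ‖c τ‖) hc i) (fun _ => norm_nonneg _)
      fun l => 0 ≤ l ∧ l < N
  rw [← Summable.tsum_finsetSum fun j _ => hsm j, ← tsum_mul_right]
  refine Summable.tsum_le_tsum (fun l => ?_) (summable_sum fun j _ => hsm j)
    (hsc.mul_right _)
  split_ifs
  · simp
  · rw [← Finset.mul_sum]
    refine mul_le_mul_of_nonneg_left ?_ (norm_nonneg _)
    exact sum_fin_le_tsum hd (fun _ => norm_nonneg _) N (fun j => l - j) fun a b h => by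
      ext
      simpa using h

theorem sum_norm_mul_le {N : ℕ} (A B : Matrix (Fin N) (Fin N) ℂ) {a : ℝ}
    (hA : ∀ l, ∑ i, ‖A i l‖ ≤ a) :
    ∑ i, ∑ j, ‖(A * B) i j‖ ≤ a * ∑ i, ∑ j, ‖B i j‖ := by
  calc ∑ i, ∑ j, ‖(A * B) i j‖ ≤ ∑ i, ∑ j, ∑ l, ‖A i l‖ * ‖B l j‖ := by
        refine Finset.sum_le_sum fun i _ => Finset.sum_le_sum fun j _ => ?_
        rw [Matrix.mul_apply]
        exact (norm_sum_le _ _).trans_eq (by simp)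
    _ = ∑ l, (∑ i, ‖A i l‖) * ∑ j, ‖B l j‖ := by
        simp only [Finset.sum_mul, Finset.mul_sum]
        rw [Finset.sum_congr rfl fun i _ => Finset.sum_comm, Finset.sum_comm]
        exact Finset.sum_congr rfl fun l _ => Finset.sum_comm
    _ ≤ ∑ l, a * ∑ j, ‖B l j‖ := Finset.sum_le_sum fun l _ =>
        mul_le_mul_of_nonneg_right (hA l) (by positivity)
    _ = _ := (Finset.mul_sum _ _ _).symm

theorem toeplitz_col_sum_le (hc : Summable fun τ => ‖c τ‖) (N : ℕ) (l : Fin N) :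
    ∑ i, ‖toeplitz c N i l‖ ≤ ∑' τ, ‖c τ‖ :=
  sum_fin_le_tsum hc (fun _ => norm_nonneg _) N (fun i => (i : ℤ) - l) fun a b h => by
    ext
    simpa using h

theorem toeplitz_row_sum_le (hc : Summable fun τ => ‖c τ‖) (N : ℕ) (i : Fin N) :
    ∑ l, ‖toeplitz c N i l‖ ≤ ∑' τ, ‖c τ‖ :=
  sum_fin_le_tsum hc (fun _ => norm_nonneg _) N (fun l => (i : ℤ) - l) fun a b h => by
    ext
    simpa using h

/-- Induction on the power: one more factor splits the error into the old error multiplied by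
`toeplitz c N`, whose column sums are at most `∑' ‖c τ‖`, and one new truncation error controlled by
the cut-off mass. Both are o(N). -/
theorem tendsto_sum_norm_toeplitz_pow_sub (hc : Summable fun τ => ‖c τ‖) (k : ℕ) :
    Tendsto (fun N : ℕ => (∑ i, ∑ j, ‖(toeplitz c N ^ k - toeplitz (psdPowCoeff c k) N) i j‖) / N)
      atTop (𝓝 0) := by
  induction k with
  | zero =>
    have : ∀ N : ℕ, toeplitz c N ^ 0 - toeplitz (psdPowCoeff c 0) N = 0 := by
      intro N
      rw [pow_zero, sub_eq_zero]
      ext i j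
      simp [toeplitz, psdPowCoeff_zero, Matrix.one_apply, sub_eq_zero, Fin.ext_iff]
    simp only [this]
    simp
  | succ k ih =>
    have hbd : ∀ N : ℕ,
        (∑ i, ∑ j, ‖(toeplitz c N ^ (k + 1) - toeplitz (psdPowCoeff c (k + 1)) N) i j‖) / N ≤
        (∑' τ, ‖c τ‖) *
          ((∑ i, ∑ j, ‖(toeplitz c N ^ k - toeplitz (psdPowCoeff c k) N) i j‖) / N) +
        cutoffMass c N / N * ∑' τ, ‖psdPowCoeff c k τ‖ := by
      intro N
      have h1 : toeplitz c N ^ (k + 1) - toeplitz (psdPowCoeff c (k + 1)) N =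
          toeplitz c N * (toeplitz c N ^ k - toeplitz (psdPowCoeff c k) N) +
          (toeplitz c N * toeplitz (psdPowCoeff c k) N - toeplitz (psdPowCoeff c (k + 1)) N) := by
        rw [pow_succ', Matrix.mul_sub]
        abel
      rw [mul_div_assoc', div_mul_eq_mul_div, ← add_div]
      refine div_le_div_of_nonneg_right ?_ (Nat.cast_nonneg _)
      rw [h1]
      refine le_trans ?_ (add_le_add
        (sum_norm_mul_le (toeplitz c N) (toeplitz c N ^ k - toeplitz (psdPowCoeff c k) N)
          (toeplitz_col_sum_le hc N))
        (sum_norm_toeplitz_mul_sub_le hc (summable_psdPowCoeff hc k)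
          (hasSum_psdPowCoeff_succ hc k) N))
      simp only [← Finset.sum_add_distrib]
      exact Finset.sum_le_sum fun i _ => Finset.sum_le_sum fun j _ => norm_add_le _ _
    refine squeeze_zero (fun N => by positivity) hbd ?_
    have := (ih.const_mul (∑' τ, ‖c τ‖)).add
      ((tendsto_cutoffMass_div hc).mul_const (∑' τ, ‖psdPowCoeff c k τ‖))
    simpa using this

/-- The normalized trace moments of Toeplitz matrices converge to the moments of the spectral
density. -/
theorem tendsto_trace_toeplitz_pow (hc : Summable fun τ => ‖c τ‖) (k : ℕ) :
    Tendsto (fun N : ℕ => (toeplitz c N ^ k).trace / N) atTop (𝓝 (psdPowCoeff c k 0)) := by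
  rw [← tendsto_sub_nhds_zero_iff]
  refine squeeze_zero_norm' ?_ (tendsto_sum_norm_toeplitz_pow_sub hc k)
  filter_upwards [eventually_ge_atTop 1] with N hN
  have hN' : (N : ℂ) ≠ 0 := by exact_mod_cast (by omega : N ≠ 0)
  have h1 : (toeplitz c N ^ k).trace / N - psdPowCoeff c k 0 =
      (toeplitz c N ^ k - toeplitz (psdPowCoeff c k) N).trace / N := by
    have : (toeplitz (psdPowCoeff c k) N).trace = N * psdPowCoeff c k 0 := by
      simp [Matrix.trace, toeplitz]
    rw [Matrix.trace_sub, this]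
    field_simp
  rw [h1, norm_div, Complex.norm_natCast]
  refine div_le_div_of_nonneg_right ?_ (Nat.cast_nonneg _)
  rw [Matrix.trace]
  refine (norm_sum_le _ _).trans (Finset.sum_le_sum fun i _ => ?_)
  exact Finset.single_le_sum (f := fun j =>
    ‖(toeplitz c N ^ k - toeplitz (psdPowCoeff c k) N) i j‖) (fun j _ => norm_nonneg _)
    (Finset.mem_univ i)

end Trace

/-! ### Szegő's theorem for continuous functions -/

section Szego

variable {c : ℤ → ℂ}

theorem unitary_conj_pow {n : Type*} [Fintype n] [DecidableEq n] {Q D : Matrix n n ℂ}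
    (hQ : Q ∈ Matrix.unitaryGroup n ℂ) (k : ℕ) :
    (Q * D * Q.conjTranspose) ^ k = Q * D ^ k * Q.conjTranspose := by
  have h1 : Q.conjTranspose * Q = 1 := Matrix.mem_unitaryGroup_iff'.1 hQ
  have h2 : Q * Q.conjTranspose = 1 := Matrix.mem_unitaryGroup_iff.1 hQ
  induction k with
  | zero => simp [h2]
  | succ k ih =>
    calc (Q * D * Q.conjTranspose) ^ (k + 1)
        = Q * D ^ k * (Q.conjTranspose * Q) * D * Q.conjTranspose := by
          rw [pow_succ, ih]; simp only [Matrix.mul_assoc]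
      _ = _ := by rw [h1, Matrix.mul_one, pow_succ, Matrix.mul_assoc Q]

theorem trace_pow_of_diagonalization {n : Type*} [Fintype n] [DecidableEq n] {T Q : Matrix n n ℂ}
    (hQ : Q ∈ Matrix.unitaryGroup n ℂ) {eig : n → ℝ}
    (hT : T = Q * Matrix.diagonal (fun i => (eig i : ℂ)) * Q.conjTranspose) (k : ℕ) :
    (T ^ k).trace = ((∑ i, eig i ^ k : ℝ) : ℂ) := by
  have h1 : Q.conjTranspose * Q = 1 := Matrix.mem_unitaryGroup_iff'.1 hQ
  rw [hT, unitary_conj_pow hQ, Matrix.trace_mul_comm, ← Matrix.mul_assoc, h1, Matrix.one_mul,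
    Matrix.diagonal_pow, Matrix.trace_diagonal]
  simp

theorem hasEigenvalue_of_diagonalization {n : Type*} [Fintype n] [DecidableEq n]
    {T Q : Matrix n n ℂ} (hQ : Q ∈ Matrix.unitaryGroup n ℂ) {eig : n → ℝ}
    (hT : T = Q * Matrix.diagonal (fun i => (eig i : ℂ)) * Q.conjTranspose) (i : n) :
    Module.End.HasEigenvalue (Matrix.toLin' T) (eig i : ℂ) := by
  have h1 : Q.conjTranspose * Q = 1 := Matrix.mem_unitaryGroup_iff'.1 hQ
  refine Module.End.hasEigenvalue_of_hasEigenvector (x := Q.mulVec (Pi.single i 1)) ⟨?_, ?_⟩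
  · rw [Module.End.mem_eigenspace_iff, Matrix.toLin'_apply, Matrix.mulVec_mulVec, hT,
      Matrix.mul_assoc, h1, Matrix.mul_one, ← Matrix.mulVec_mulVec, ← Matrix.mulVec_smul]
    congr 1
    rw [Matrix.diagonal_mulVec_single]
    ext j
    simp [Pi.single_apply]
  · intro h0
    have h2 : (Q.conjTranspose * Q).mulVec (Pi.single i (1 : ℂ)) = 0 := by
      rw [← Matrix.mulVec_mulVec, h0, Matrix.mulVec_zero]
    rw [h1, Matrix.one_mulVec] at h2
    have := congrFun h2 i
    simp at this

/-- Gershgorin: an eigenvalue is at most an absolute row sum, which is bounded uniformly in `N`. -/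
theorem abs_eig_toeplitz_le (hc : Summable fun τ => ‖c τ‖) {N : ℕ} {Q : Matrix (Fin N) (Fin N) ℂ}
    (hQ : Q ∈ Matrix.unitaryGroup (Fin N) ℂ) {eig : Fin N → ℝ}
    (hT : toeplitz c N = Q * Matrix.diagonal (fun i => (eig i : ℂ)) * Q.conjTranspose)
    (i : Fin N) : |eig i| ≤ ∑' τ, ‖c τ‖ := by
  obtain ⟨k, hk⟩ := eigenvalue_mem_ball (hasEigenvalue_of_diagonalization hQ hT i)
  rw [mem_closedBall_iff_norm] at hk
  have h1 : ‖(eig i : ℂ)‖ ≤ ‖(eig i : ℂ) - toeplitz c N k k‖ + ‖toeplitz c N k k‖ := by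
    simpa using norm_add_le ((eig i : ℂ) - toeplitz c N k k) (toeplitz c N k k)
  rw [Complex.norm_real, Real.norm_eq_abs] at h1
  have h2 := Finset.sum_erase_add Finset.univ (fun j => ‖toeplitz c N k j‖) (Finset.mem_univ k)
  have h3 := toeplitz_row_sum_le hc N k
  linarith

theorem continuous_psd (hc : Summable fun τ => ‖c τ‖) : Continuous (psd c) := by
  have : psd c = fun w => (psdC c w).re := funext (psd_eq_re c)
  rw [this]
  exact Complex.continuous_re.comp (continuous_psdC hc)

theorem abs_psd_le (hc : Summable fun τ => ‖c τ‖) (w : ℝ) : |psd c w| ≤ ∑' τ, ‖c τ‖ := by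
  rw [psd_eq_re]
  exact (Complex.abs_re_le_norm _).trans (norm_psdC_le hc w)

/-- The mean over a period. -/
noncomputable def periodMean (f : ℝ → ℝ) : ℝ :=
  (1 / (2 * Real.pi)) * ∫ w in (0 : ℝ)..(2 * Real.pi), f w

theorem psdPowCoeff_apply_zero (hsymm : ∀ τ, c (-τ) = conj (c τ)) (k : ℕ) :
    psdPowCoeff c k 0 = (periodMean fun w => psd c w ^ k : ℝ) := by
  rw [psdPowCoeff, periodMean, Complex.ofReal_mul, ← intervalIntegral.integral_ofReal]
  simp [expI_zero, psdC_eq_psd hsymm]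

theorem periodMean_sub {f g : ℝ → ℝ} (hf : Continuous f) (hg : Continuous g) :
    (periodMean fun w => f w - g w) = periodMean f - periodMean g := by
  rw [periodMean, intervalIntegral.integral_sub (hf.intervalIntegrable _ _)
    (hg.intervalIntegrable _ _), mul_sub]
  rfl

theorem periodMean_const_mul (a : ℝ) (f : ℝ → ℝ) :
    (periodMean fun w => a * f w) = a * periodMean f := by
  rw [periodMean, intervalIntegral.integral_const_mul, periodMean]
  ring

theorem periodMean_sum {ι : Type*} (s : Finset ι) {f : ι → ℝ → ℝ}
    (hf : ∀ i ∈ s, Continuous (f i)) :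
    (periodMean fun w => ∑ i ∈ s, f i w) = ∑ i ∈ s, periodMean (f i) := by
  rw [periodMean, intervalIntegral.integral_finsetSum fun i hi => (hf i hi).intervalIntegrable _ _,
    Finset.mul_sum]
  rfl

theorem periodMean_const (a : ℝ) : (periodMean fun _ => a) = a := by
  have := Real.pi_pos.ne'
  simp [periodMean]
  field_simp

theorem periodMean_mono {f g : ℝ → ℝ} (hf : Continuous f) (hg : Continuous g)
    (h : ∀ w, f w ≤ g w) : periodMean f ≤ periodMean g := by
  unfold periodMean
  refine mul_le_mul_of_nonneg_left ?_ (by positivity)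
  exact intervalIntegral.integral_mono Real.two_pi_pos.le (hf.intervalIntegrable _ _)
    (hg.intervalIntegrable _ _) h

theorem abs_periodMean_sub_le {f g : ℝ → ℝ} (hf : Continuous f) (hg : Continuous g) {ε : ℝ}
    (h : ∀ w, |f w - g w| ≤ ε) : |periodMean f - periodMean g| ≤ ε := by
  rw [← periodMean_sub hf hg, abs_le]
  have hd : Continuous fun w => f w - g w := hf.sub hg
  constructor
  · rw [← periodMean_const (-ε)]
    exact periodMean_mono continuous_const hd fun w => (abs_le.1 (h w)).1
  · rw [← periodMean_const ε]
    exact periodMean_mono hd continuous_const fun w => (abs_le.1 (h w)).2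

theorem periodMean_pos {f : ℝ → ℝ} (hf : Continuous f) (h0 : ∀ w ∈ Set.Icc 0 (2 * Real.pi), 0 ≤ f w)
    (h : ∃ w ∈ Set.Icc 0 (2 * Real.pi), 0 < f w) : 0 < periodMean f :=
  mul_pos (by positivity) (intervalIntegral.integral_pos Real.two_pi_pos hf.continuousOn
    (fun w hw => h0 w (Set.Ioc_subset_Icc_self hw)) h)

/-- A unitary diagonalization of the Toeplitz matrix of size `N`. -/
def IsToeplitzEig (c : ℤ → ℂ) (N : ℕ) (eig : Fin N → ℝ) : Prop :=
  ∃ Q ∈ Matrix.unitaryGroup (Fin N) ℂ,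
    toeplitz c N = Q * Matrix.diagonal (fun i => (eig i : ℂ)) * Q.conjTranspose

theorem tendsto_eig_pow (hc : Summable fun τ => ‖c τ‖) (hsymm : ∀ τ, c (-τ) = conj (c τ))
    {N : ℕ → ℕ} (hN : Tendsto N atTop atTop) {eig : ∀ n, Fin (N n) → ℝ}
    (heig : ∀ n, IsToeplitzEig c (N n) (eig n)) (k : ℕ) :
    Tendsto (fun n => (∑ i, eig n i ^ k) / N n) atTop (𝓝 (periodMean fun w => psd c w ^ k)) := by
  have h := (tendsto_trace_toeplitz_pow hc k).comp hN
  rw [psdPowCoeff_apply_zero hsymm] at h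
  have h2 := (Complex.continuous_re.tendsto _).comp h
  rw [Complex.ofReal_re] at h2
  refine h2.congr fun n => ?_
  obtain ⟨Q, hQ, hT⟩ := heig n
  simp only [Function.comp_apply]
  rw [trace_pow_of_diagonalization hQ hT, ← Complex.ofReal_natCast, ← Complex.ofReal_div,
    Complex.ofReal_re]

theorem tendsto_eig_polynomial (hc : Summable fun τ => ‖c τ‖) (hsymm : ∀ τ, c (-τ) = conj (c τ))
    {N : ℕ → ℕ} (hN : Tendsto N atTop atTop) {eig : ∀ n, Fin (N n) → ℝ}
    (heig : ∀ n, IsToeplitzEig c (N n) (eig n)) (p : Polynomial ℝ) :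
    Tendsto (fun n => (∑ i, p.eval (eig n i)) / N n) atTop
      (𝓝 (periodMean fun w => p.eval (psd c w))) := by
  have h := tendsto_finsetSum (Finset.range (p.natDegree + 1)) fun k _ =>
    (tendsto_eig_pow hc hsymm hN heig k).const_mul (p.coeff k)
  have h1 : (periodMean fun w => p.eval (psd c w)) =
      ∑ k ∈ Finset.range (p.natDegree + 1), p.coeff k * periodMean fun w => psd c w ^ k := by
    simp only [Polynomial.eval_eq_sum_range]
    rw [periodMean_sum _ (f := fun k w => p.coeff k * psd c w ^ k) fun k _ => continuous_const.mul ((continuous_psd hc).pow k)]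
    exact Finset.sum_congr rfl fun k _ => periodMean_const_mul _ _
  rw [h1]
  refine h.congr fun n => ?_
  simp only [Polynomial.eval_eq_sum_range]
  rw [Finset.sum_comm, Finset.sum_div]
  refine Finset.sum_congr rfl fun k _ => ?_
  rw [← Finset.mul_sum, mul_div_assoc]

/-- **Szegő's theorem** on the eigenvalue distribution of Toeplitz matrices with absolutely summable
entries. -/
theorem tendsto_eig_continuous (hc : Summable fun τ => ‖c τ‖) (hsymm : ∀ τ, c (-τ) = conj (c τ))
    {N : ℕ → ℕ} (hN : Tendsto N atTop atTop) {eig : ∀ n, Fin (N n) → ℝ}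
    (heig : ∀ n, IsToeplitzEig c (N n) (eig n)) {f : ℝ → ℝ} (hf : Continuous f) :
    Tendsto (fun n => (∑ i, f (eig n i)) / N n) atTop (𝓝 (periodMean fun w => f (psd c w))) := by
  rw [Metric.tendsto_atTop']
  intro ε hε
  set b := ∑' τ, ‖c τ‖ with hb
  -- The interval `[-b, b]` contains the eigenvalues for all sizes and all values of the spectral
  -- density, so one polynomial serves both averages.
  obtain ⟨p, hp⟩ := exists_polynomial_near_of_continuousOn (-b) b f hf.continuousOn (ε / 3)
    (by positivity)
  have hpabs : ∀ x, |x| ≤ b → |p.eval x - f x| ≤ ε / 3 := fun x hx => (hp x (abs_le.1 hx)).le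
  have hlim := tendsto_eig_polynomial hc hsymm hN heig p
  rw [Metric.tendsto_atTop'] at hlim
  obtain ⟨n₀, hn₀⟩ := hlim (ε / 3) (by positivity)
  refine ⟨n₀, fun n hn => ?_⟩
  have h1 := hn₀ n hn
  rw [Real.dist_eq] at h1 ⊢
  have h2 : |(periodMean fun w => p.eval (psd c w)) - periodMean fun w => f (psd c w)| ≤ ε / 3 :=
    abs_periodMean_sub_le (p.continuous.comp (continuous_psd hc)) (hf.comp (continuous_psd hc))
      fun w => hpabs _ (abs_psd_le hc w)
  have h3 : |(∑ i, p.eval (eig n i)) / N n - (∑ i, f (eig n i)) / N n| ≤ ε / 3 := by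
    obtain ⟨Q, hQ, hT⟩ := heig n
    rw [← sub_div, ← Finset.sum_sub_distrib, abs_div, Nat.abs_cast]
    refine div_le_of_le_mul₀ (Nat.cast_nonneg _) (by positivity) ?_
    refine (Finset.abs_sum_le_sum_abs _ _).trans ?_
    calc ∑ i, |p.eval (eig n i) - f (eig n i)| ≤ ∑ _i : Fin (N n), ε / 3 :=
          Finset.sum_le_sum fun i _ => hpabs _ (abs_eig_toeplitz_le hc hQ hT i)
      _ = ε / 3 * N n := by simp [mul_comm]
  rw [abs_lt] at h1 ⊢
  rw [abs_le] at h2 h3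
  constructor <;> linarith

end Szego

/-! ### Positivity of the spectral density and of the Toeplitz matrices -/

section PosDef

variable {c : ℤ → ℂ}

theorem exists_isToeplitzEig {N : ℕ} (hT : (toeplitz c N).PosSemidef) :
    ∃ eig, IsToeplitzEig c N eig ∧ ∀ i, 0 ≤ eig i := by
  have hspec := hT.1.spectral_theorem
  rw [Unitary.conjStarAlgAut_apply] at hspec
  exact ⟨hT.1.eigenvalues, ⟨hT.1.eigenvectorUnitary.1, hT.1.eigenvectorUnitary.2, hspec⟩,
    hT.eigenvalues_nonneg⟩

/-- Szegő's theorem for the negative part: all eigenvalues are nonnegative, so the negative part of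
S has mean zero, which continuity forbids if S is negative somewhere in the period. -/
theorem psd_nonneg (hc : Summable fun τ => ‖c τ‖) (hsymm : ∀ τ, c (-τ) = conj (c τ))
    (hT : ∀ N, (toeplitz c N).PosSemidef) {w : ℝ} (hw : w ∈ Set.Icc 0 (2 * Real.pi)) :
    0 ≤ psd c w := by
  by_contra! hneg
  choose eig heig hnn using fun N => exists_isToeplitzEig (hT N)
  have hf : Continuous fun x : ℝ => max (-x) 0 := by fun_prop
  have h1 := tendsto_eig_continuous hc hsymm tendsto_id (eig := eig) heig hf
  have h2 : ∀ n : ℕ, (∑ i, max (-(eig n i)) 0) / (id n : ℕ) = 0 := by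
    intro n
    rw [Finset.sum_eq_zero fun i _ => max_eq_right (neg_nonpos.2 (hnn n i)), zero_div]
  have h3 : (periodMean fun w => max (-(psd c w)) 0) = 0 :=
    tendsto_nhds_unique h1 ((tendsto_congr h2).2 tendsto_const_nhds)
  have h4 := periodMean_pos (hf.comp (continuous_psd hc)) (fun w _ => le_max_right _ _)
    ⟨w, hw, lt_max_of_lt_left (neg_pos.2 hneg)⟩
  simp only [Function.comp_def] at h4
  linarith

theorem periodMean_psd (hc : Summable fun τ => ‖c τ‖) (hsymm : ∀ τ, c (-τ) = conj (c τ))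
    (h0 : c 0 = 1) : periodMean (psd c) = 1 := by
  have h1 := psdPowCoeff_apply_zero hsymm 1
  rw [psdPowCoeff_one hc, h0] at h1
  simp only [pow_one] at h1
  exact_mod_cast h1.symm

/-- The mean of S over a period is `c 0 = 1`. The open interval leaves room for a neighbourhood of
the point. -/
theorem exists_psd_pos (hc : Summable fun τ => ‖c τ‖) (hsymm : ∀ τ, c (-τ) = conj (c τ))
    (h0 : c 0 = 1) : ∃ w ∈ Set.Ioo 0 (2 * Real.pi), 0 < psd c w := by
  by_contra! hcon
  have h1 := periodMean_psd hc hsymm h0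
  have h2 : ∫ w in (0 : ℝ)..(2 * Real.pi), psd c w ≤ ∫ _w in (0 : ℝ)..(2 * Real.pi), (0 : ℝ) := by
    refine intervalIntegral.integral_mono_on_of_le_Ioo Real.two_pi_pos.le
      ((continuous_psd hc).intervalIntegrable _ _) intervalIntegrable_const hcon
  rw [intervalIntegral.integral_zero] at h2
  rw [periodMean] at h1
  have h3 : (1 / (2 * Real.pi)) * ∫ w in (0 : ℝ)..(2 * Real.pi), psd c w ≤ 0 :=
    mul_nonpos_of_nonneg_of_nonpos (by positivity) h2
  linarith

/-- Writing `c (i - j)` as a Fourier coefficient of S turns the double sum into the mean of S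
against a squared modulus. -/
theorem dotProduct_toeplitz_mulVec (hc : Summable fun τ => ‖c τ‖)
    (hsymm : ∀ τ, c (-τ) = conj (c τ)) {N : ℕ} (v : Fin N → ℂ) :
    star v ⬝ᵥ (toeplitz c N).mulVec v =
      (periodMean fun w => psd c w * ‖∑ j : Fin N, v j * expI w (-(j : ℤ))‖ ^ 2 : ℝ) := by
  have hS := continuous_psdC hc
  have h1 : ∀ i j : Fin N, conj (v i) * (c (i - j) * v j) = (1 / (2 * Real.pi)) *
      ∫ w in (0 : ℝ)..(2 * Real.pi), psdC c w *
        (conj (v i * expI w (-(i : ℤ))) * (v j * expI w (-(j : ℤ)))) := by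
    intro i j
    rw [← psdPowCoeff_one hc, psdPowCoeff, mul_comm _ (v j), mul_left_comm (v j),
      mul_left_comm (conj (v i)), ← intervalIntegral.integral_const_mul,
      ← intervalIntegral.integral_const_mul]
    congr 1
    refine intervalIntegral.integral_congr fun w _ => ?_
    simp only [pow_one, map_mul, conj_expI, neg_neg, sub_eq_add_neg, expI_add]
    ring
  have h2 : star v ⬝ᵥ (toeplitz c N).mulVec v =
      ∑ i : Fin N, ∑ j : Fin N, conj (v i) * (c (i - j) * v j) := by
    simp only [dotProduct, Matrix.mulVec, toeplitz, Matrix.of_apply, Pi.star_apply,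
      RCLike.star_def, Finset.mul_sum]
  have hcont : ∀ i : Fin N, Continuous fun w => v i * expI w (-(i : ℤ)) := fun i =>
    continuous_const.mul (continuous_expI _)
  have hci : ∀ i j : Fin N, Continuous fun w => psdC c w *
      (conj (v i * expI w (-(i : ℤ))) * (v j * expI w (-(j : ℤ)))) := fun i j =>
    hS.mul ((Complex.continuous_conj.comp (hcont i)).mul (hcont j))
  rw [h2, periodMean, Complex.ofReal_mul, ← intervalIntegral.integral_ofReal]
  simp only [h1]
  simp only [← Finset.mul_sum]
  rw [Finset.sum_congr rfl fun i _ =>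
    (intervalIntegral.integral_finsetSum fun j _ => (hci i j).intervalIntegrable _ _).symm,
    ← intervalIntegral.integral_finsetSum fun i _ =>
      (continuous_finsetSum _ fun j _ => hci i j).intervalIntegrable _ _]
  congr 1
  · push_cast; rfl
  · refine intervalIntegral.integral_congr fun w _ => ?_
    rw [Complex.ofReal_mul, ← psdC_eq_psd hsymm, Complex.ofReal_pow, ← Complex.conj_mul', map_sum,
      Finset.sum_mul_sum, Finset.mul_sum]
    exact Finset.sum_congr rfl fun i _ => (Finset.mul_sum _ _ _).symm

/-- A trigonometric polynomial that vanishes on an interval vanishes. -/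
theorem eq_zero_of_trigPoly_eq_zero {N : ℕ} (v : Fin N → ℂ) {a b : ℝ} (ha : 0 ≤ a) (hab : a < b)
    (hb : b ≤ 2 * Real.pi)
    (h : ∀ w ∈ Set.Ioo a b, ∑ j : Fin N, v j * expI w (-(j : ℤ)) = 0) : v = 0 := by
  set p : Polynomial ℂ := ∑ j : Fin N, Polynomial.C (v j) * Polynomial.X ^ (j : ℕ) with hp
  -- Any two of these frequencies differ by less than 2π, so they give distinct points of the unit
  -- circle and the polynomial `p` has infinitely many roots.
  have hinj : Set.InjOn (fun w => expI w (-1)) (Set.Ioo a b) := by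
    intro w hw w' hw' hww
    simp only [expI, Complex.exp_eq_exp_iff_exists_int] at hww
    obtain ⟨n, hn⟩ := hww
    have h1 : (w : ℂ) = w' - 2 * Real.pi * n := by
      have : Complex.I * (w : ℂ) = Complex.I * (w' - 2 * Real.pi * n) := by
        push_cast at hn
        linear_combination -hn
      exact mul_left_cancel₀ Complex.I_ne_zero this
    have h2 : w = w' - 2 * Real.pi * n := by exact_mod_cast h1
    have h3 : |w - w'| < 2 * Real.pi := by
      rw [abs_lt]
      constructor <;> linarith [hw.1, hw.2, hw'.1, hw'.2]
    have h4 : n = 0 := by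
      by_contra hn0
      have h5 : (1 : ℝ) ≤ |(n : ℝ)| := by
        exact_mod_cast Int.one_le_abs hn0
      rw [show w - w' = -(2 * Real.pi * n) by rw [h2]; ring, abs_neg, abs_mul,
        abs_of_pos Real.two_pi_pos] at h3
      nlinarith [Real.two_pi_pos]
    rw [h2, h4]
    simp
  have hroots : Set.Infinite {z | p.IsRoot z} := by
    refine ((Set.Ioo_infinite hab).image hinj).mono ?_
    rintro _ ⟨w, hw, rfl⟩
    simp only [Set.mem_ofPred_eq, Polynomial.IsRoot, hp, Polynomial.eval_finsetSum,
      Polynomial.eval_mul, Polynomial.eval_C, Polynomial.eval_pow, Polynomial.eval_X]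
    rw [← h w hw]
    refine Finset.sum_congr rfl fun j _ => ?_
    rw [expI, expI, ← Complex.exp_nat_mul]
    congr 2
    push_cast
    ring
  have hp0 : p = 0 := Polynomial.eq_zero_of_infinite_isRoot p hroots
  ext j
  have := congrArg (fun q => Polynomial.coeff q (j : ℕ)) hp0
  simpa [hp, Polynomial.finsetSum_coeff, Polynomial.coeff_C_mul, Polynomial.coeff_X_pow,
    Fin.val_inj] using this

/-- The quadratic form is the mean of a nonnegative function. If it were not positive, the
trigonometric polynomial of `v` would vanish on a neighbourhood where S > 0, hence `v = 0`. -/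
theorem posDef_toeplitz (hc : Summable fun τ => ‖c τ‖) (hsymm : ∀ τ, c (-τ) = conj (c τ))
    (h0 : c 0 = 1) (hT : ∀ N, (toeplitz c N).PosSemidef) (N : ℕ) : (toeplitz c N).PosDef := by
  rw [Matrix.posDef_iff_dotProduct_mulVec]
  refine ⟨(hT N).1, fun {v} hv => ?_⟩
  rw [dotProduct_toeplitz_mulVec hc hsymm, Complex.zero_lt_real]
  have hcont : Continuous fun w => psd c w * ‖∑ j : Fin N, v j * expI w (-(j : ℤ))‖ ^ 2 :=
    (continuous_psd hc).mul ((continuous_finsetSum _ fun j _ =>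
      continuous_const.mul (continuous_expI _)).norm.pow 2)
  refine periodMean_pos hcont (fun w hw => mul_nonneg (psd_nonneg hc hsymm hT hw) (by positivity)) ?_
  obtain ⟨w₀, hw₀, hpos⟩ := exists_psd_pos hc hsymm h0
  by_contra! hcon
  have hopen : IsOpen ({w | 0 < psd c w} ∩ Set.Ioo 0 (2 * Real.pi)) :=
    (isOpen_lt continuous_const (continuous_psd hc)).inter isOpen_Ioo
  obtain ⟨δ, hδ, hball⟩ := Metric.isOpen_iff.1 hopen w₀ ⟨hpos, hw₀⟩
  rw [Real.ball_eq_Ioo] at hball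
  have hmem : ∀ w ∈ Set.Ioo (w₀ - δ) (w₀ + δ), 0 < psd c w ∧ 0 < w ∧ w < 2 * Real.pi :=
    fun w hw => ⟨(hball hw).1, (hball hw).2.1, (hball hw).2.2⟩
  refine hv (eq_zero_of_trigPoly_eq_zero v (a := max 0 (w₀ - δ)) (b := min (2 * Real.pi) (w₀ + δ))
    (le_max_left _ _) ?_ (min_le_left _ _) ?_)
  · exact (max_lt hw₀.1 (by linarith)).trans (lt_min hw₀.2 (by linarith))
  · intro w hw
    have hw' : w ∈ Set.Ioo (w₀ - δ) (w₀ + δ) :=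
      ⟨(le_max_right _ _).trans_lt hw.1, hw.2.trans_le (min_le_right _ _)⟩
    obtain ⟨h1, h2, h3⟩ := hmem w hw'
    have h4 := hcon w ⟨h2.le, h3.le⟩
    have h5 : ‖∑ j : Fin N, v j * expI w (-(j : ℤ))‖ ^ 2 ≤ 0 := by
      by_contra! h6
      linarith [mul_pos h1 h6]
    have h7 := le_antisymm h5 (by positivity)
    simpa using h7

variable {Ω : Type*} [MeasurableSpace Ω] {μ : Measure Ω} {K L : ℕ}
  {g : ℕ → Ω → Fin K → ℂ} {y : ℕ → Ω → Fin L → ℂ} {Cg : Matrix (Fin K) (Fin K) ℂ}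
  {Cy : Matrix (Fin L) (Fin L) ℂ} {Γ : Matrix (Fin K) (Fin L) ℂ}

theorem conj_symm_of_toeplitz (hT : ∀ N, (toeplitz c N).PosSemidef) (τ : ℤ) :
    c (-τ) = conj (c τ) := by
  have h := (hT (τ.natAbs + 1)).1
  -- One of the two truncated numbers is 0 and the other is `|τ|`, so this entry of the Hermitian
  -- identity compares `c (-τ)` with `c τ` for either sign of `τ`.
  have h1 := congrFun (congrFun h ⟨(-τ).toNat, by omega⟩) ⟨τ.toNat, by omega⟩
  simp only [toeplitz, Matrix.conjTranspose_apply, Matrix.of_apply, RCLike.star_def] at h1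
  rw [show ((τ.toNat : ℤ) - ((-τ).toNat : ℤ)) = τ by omega,
    show (((-τ).toNat : ℤ) - (τ.toNat : ℤ)) = -τ by omega] at h1
  exact h1.symm

theorem SignalModel.conj_symm (h : SignalModel μ g y Cg Cy Γ c) (hCy : Cy.PosDef) (hL : 0 < L)
    (τ : ℤ) : c (-τ) = conj (c τ) :=
  conj_symm_of_toeplitz (h.posSemidef_toeplitz hCy hL) τ

theorem SignalModel.posDef_toeplitz (h : SignalModel μ g y Cg Cy Γ c) (hCy : Cy.PosDef)
    (hL : 0 < L) (N : ℕ) : (toeplitz c N).PosDef :=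
  TaskQuant.posDef_toeplitz h.summable_c (h.conj_symm hCy hL) h.c_zero
    (h.posSemidef_toeplitz hCy hL) N

end PosDef

/-! ### Square roots of positive matrices -/

section Sqrt

variable {n : Type*} [Fintype n] [DecidableEq n]

theorem conjTranspose_sqrt (A : Matrix n n ℂ) : (CFC.sqrt A).conjTranspose = CFC.sqrt A :=
  (Matrix.nonneg_iff_posSemidef.1 (CFC.sqrt_nonneg A)).1

theorem sqrt_mul_sqrt {A : Matrix n n ℂ} (hA : A.PosSemidef) : CFC.sqrt A * CFC.sqrt A = A :=
  CFC.sqrt_mul_sqrt_self A (Matrix.nonneg_iff_posSemidef.2 hA)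

theorem inv_sqrt_mul_sqrt {A : Matrix n n ℂ} (hA : A.PosDef) :
    (CFC.sqrt A)⁻¹ * CFC.sqrt A = 1 := by
  refine Matrix.nonsing_inv_mul _ ?_
  have h1 : IsUnit A.det := hA.det_pos.ne'.isUnit
  rw [← sqrt_mul_sqrt hA.posSemidef, Matrix.det_mul] at h1
  exact isUnit_of_mul_isUnit_left h1

theorem eig_nonneg_of_posSemidef {T Q : Matrix n n ℂ} (hT : T.PosSemidef)
    (hQ : Q ∈ Matrix.unitaryGroup n ℂ) {eig : n → ℝ}
    (hspec : T = Q * Matrix.diagonal (fun i => (eig i : ℂ)) * Q.conjTranspose) (i : n) :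
    0 ≤ eig i := by
  have h1 : Q.conjTranspose * Q = 1 := Matrix.mem_unitaryGroup_iff'.1 hQ
  have h2 := hT.conjTranspose_mul_mul_same Q
  have h3 : Q.conjTranspose * T * Q = Matrix.diagonal (fun i => (eig i : ℂ)) := by
    calc Q.conjTranspose * T * Q = (Q.conjTranspose * Q) *
          Matrix.diagonal (fun i => (eig i : ℂ)) * (Q.conjTranspose * Q) := by
          rw [hspec]; simp only [Matrix.mul_assoc]
      _ = _ := by rw [h1, Matrix.one_mul, Matrix.mul_one]
  rw [h3, Matrix.posSemidef_diagonal_iff] at h2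
  exact_mod_cast h2 i

end Sqrt

/-! ### Singular values of the Kronecker product -/

section Kronecker

variable {K L N : ℕ} {Cy : Matrix (Fin L) (Fin L) ℂ} {Γ : Matrix (Fin K) (Fin L) ℂ} {c : ℤ → ℂ}

/-- The Gram matrix of Γ̃ ⊗ Σ^{1/2} is Γ̃ᴴΓ̃ ⊗ Σ, and `V ⊗ₖ Q` diagonalizes both factors at once.
With `sv_eq_of_diagonalization` this yields the singular values φ_i √λ_k. -/
theorem gram_kronecker_diagonalization (hT : (toeplitz c N).PosSemidef)
    {V : Matrix (Fin L) (Fin L) ℂ} {Q : Matrix (Fin N) (Fin N) ℂ} {eig : Fin N → ℝ}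
    (hV : (gammaTilde Cy Γ).conjTranspose * gammaTilde Cy Γ =
      V * Matrix.diagonal (fun i : Fin L => ((sv (gammaTilde Cy Γ) i ^ 2 : ℝ) : ℂ)) *
        V.conjTranspose)
    (hQ : Q ∈ Matrix.unitaryGroup (Fin N) ℂ)
    (hQs : toeplitz c N = Q * Matrix.diagonal (fun i => (eig i : ℂ)) * Q.conjTranspose) :
    (gammaTilde Cy Γ ⊗ₖ CFC.sqrt (toeplitz c N)).conjTranspose *
      (gammaTilde Cy Γ ⊗ₖ CFC.sqrt (toeplitz c N)) =
      (V ⊗ₖ Q) * Matrix.diagonal (fun p : Fin L × Fin N =>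
        (((sv (gammaTilde Cy Γ) p.1 * √(eig p.2)) ^ 2 : ℝ) : ℂ)) * (V ⊗ₖ Q).conjTranspose := by
  have hnn := eig_nonneg_of_posSemidef hT hQ hQs
  rw [Matrix.conjTranspose_kronecker, ← Matrix.mul_kronecker_mul, hV, conjTranspose_sqrt,
    sqrt_mul_sqrt hT]
  conv_lhs => rw [hQs]
  rw [Matrix.mul_kronecker_mul, Matrix.mul_kronecker_mul, Matrix.diagonal_kronecker_diagonal,
    ← Matrix.conjTranspose_kronecker]
  congr 3
  ext p
  rw [mul_pow, Real.sq_sqrt (hnn _)]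
  push_cast
  rfl

theorem svKron_eq (hT : (toeplitz c N).PosSemidef)
    {V : Matrix (Fin L) (Fin L) ℂ} {Q : Matrix (Fin N) (Fin N) ℂ} {eig : Fin N → ℝ}
    (hVu : V ∈ Matrix.unitaryGroup (Fin L) ℂ)
    (hV : (gammaTilde Cy Γ).conjTranspose * gammaTilde Cy Γ =
      V * Matrix.diagonal (fun i : Fin L => ((sv (gammaTilde Cy Γ) i ^ 2 : ℝ) : ℂ)) *
        V.conjTranspose)
    (hQ : Q ∈ Matrix.unitaryGroup (Fin N) ℂ)
    (hQs : toeplitz c N = Q * Matrix.diagonal (fun i => (eig i : ℂ)) * Q.conjTranspose)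
    (e : Fin L × Fin N ≃ Fin (L * N))
    (he : Antitone fun l : Fin (L * N) =>
      sv (gammaTilde Cy Γ) (e.symm l).1 * √(eig (e.symm l).2)) (l : Fin (L * N)) :
    svKron Cy Γ c N l = sv (gammaTilde Cy Γ) (e.symm l).1 * √(eig (e.symm l).2) :=
  sv_eq_of_diagonalization _ (V ⊗ₖ Q) (Matrix.kronecker_mem_unitary hVu hQ)
    (fun p => sv (gammaTilde Cy Γ) p.1 * √(eig p.2))
    (fun _ => mul_nonneg (sv_nonneg _ _) (Real.sqrt_nonneg _))
    (gram_kronecker_diagonalization hT hV hQ hQs) e he l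

theorem gammaTilde_ne_zero (hCy : Cy.PosDef) (hΓ : Γ ≠ 0) : gammaTilde Cy Γ ≠ 0 := by
  intro h
  apply hΓ
  have h1 : Γ * Cy = 0 := by
    rw [← sqrt_mul_sqrt hCy.posSemidef, ← Matrix.mul_assoc]
    change gammaTilde Cy Γ * _ = 0
    rw [h, Matrix.zero_mul]
  have h2 : IsUnit Cy.det := hCy.det_pos.ne'.isUnit
  rw [← Matrix.mul_nonsing_inv_cancel_right Cy Γ h2, h1, Matrix.zero_mul]

theorem svKron_zero_pos (hCy : Cy.PosDef) (hΓ : Γ ≠ 0) (hN : 1 ≤ N)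
    (hT : (toeplitz c N).PosDef) : 0 < svKron Cy Γ c N 0 := by
  refine sv_zero_pos fun h => gammaTilde_ne_zero hCy hΓ ?_
  have hs : CFC.sqrt (toeplitz c N) ≠ 0 := by
    intro h0
    have h1 := inv_sqrt_mul_sqrt hT
    rw [h0, Matrix.mul_zero] at h1
    have := congrFun (congrFun h1 ⟨0, hN⟩) ⟨0, hN⟩
    simp at this
  obtain ⟨i, j, hij⟩ : ∃ i j, CFC.sqrt (toeplitz c N) i j ≠ 0 := by
    by_contra! hcon
    exact hs (by ext i j; exact hcon i j)
  ext k l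
  have := congrFun (congrFun h (k, i)) (l, j)
  simpa [hij] using this

end Kronecker

/-! ### Positivity of the parameters -/

section Params

theorem kappa_pos {η : ℝ} {M : ℕ} (hη : 0 < η) (hM : η < √(3 / 2) * M) : 0 < kappa η M := by
  have hM0 : (0 : ℝ) < M := by
    by_contra! h
    have : (M : ℝ) = 0 := le_antisymm h (Nat.cast_nonneg _)
    rw [this, mul_zero] at hM
    linarith
  have h1 : η ^ 2 < 3 / 2 * (M : ℝ) ^ 2 := by
    have := pow_lt_pow_left₀ hM hη.le two_ne_zero
    rwa [mul_pow, Real.sq_sqrt (by norm_num)] at this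
  unfold kappa
  refine mul_pos (by positivity) (inv_pos.2 ?_)
  rw [sub_pos, div_lt_one (by positivity)]
  linarith

theorem resolution_pos_of_lt {η : ℝ} {M : ℕ} (hη : 0 < η) (hM : η < √(3 / 2) * M) :
    (0 : ℝ) < M := by
  by_contra! h
  have : (M : ℝ) = 0 := le_antisymm h (Nat.cast_nonneg _)
  rw [this, mul_zero] at hM
  linarith

theorem pos_of_gamma_ne_zero {K L : ℕ} {Γ : Matrix (Fin K) (Fin L) ℂ} (hΓ : Γ ≠ 0) : 0 < L := by
  by_contra h
  have : L = 0 := by omega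
  subst this
  exact hΓ (by ext i j; exact j.elim0)

end Params

/-! ### Existence of the water level and of a design -/

section Existence

variable {K L N P M : ℕ} {Cy : Matrix (Fin L) (Fin L) ℂ} {Γ : Matrix (Fin K) (Fin L) ℂ}
  {c : ℤ → ℂ} {η : ℝ}

theorem existsUnique_isWaterLevel (hCy : Cy.PosDef) (hΓ : Γ ≠ 0) (hN : 1 ≤ N) (hP : 1 ≤ P)
    (hT : (toeplitz c N).PosDef) (hη : 0 < η) (hM : η < √(3 / 2) * M) :
    ∃! ζ : ℝ, IsWaterLevel Cy Γ c (kappa η M) M N P ζ := by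
  have hκ := kappa_pos hη hM
  have hM0 := resolution_pos_of_lt hη hM
  have hP0 : (0 : ℝ) < P := by exact_mod_cast hP
  exact existsUnique_level hP (by positivity) (fun l => sv_nonneg _ _)
    (svKron_zero_pos hCy hΓ hN hT)

/-- The unitary matrix of the discrete Fourier transform. -/
noncomputable def dftMatrix (P : ℕ) : Matrix (Fin P) (Fin P) ℂ :=
  Matrix.of fun l m => ((√P : ℝ) : ℂ)⁻¹ *
    (Complex.exp (2 * Real.pi * Complex.I / P) ^ (l : ℕ)) ^ (m : ℕ)

/-- Constant modulus is what makes the Fourier matrix an equalizer: conjugating a diagonal matrix by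
it spreads the trace evenly over the diagonal. -/
theorem dftMatrix_mul_conj (l m : Fin P) :
    dftMatrix P l m * conj (dftMatrix P l m) = (P : ℂ)⁻¹ := by
  have hP : P ≠ 0 := by have := l.2; omega
  have hz : ‖Complex.exp (2 * Real.pi * Complex.I / P)‖ = 1 :=
    (Complex.isPrimitiveRoot_exp P hP).norm'_eq_one hP
  rw [Complex.mul_conj', dftMatrix, Matrix.of_apply, norm_mul, norm_pow, norm_pow, hz, one_pow,
    one_pow, mul_one, norm_inv, Complex.norm_real, Real.norm_of_nonneg (Real.sqrt_nonneg _),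
    ← Complex.ofReal_pow, inv_pow, Real.sq_sqrt (Nat.cast_nonneg _)]
  simp

theorem dftMatrix_mem_unitaryGroup (P : ℕ) : dftMatrix P ∈ Matrix.unitaryGroup (Fin P) ℂ := by
  rw [Matrix.mem_unitaryGroup_iff]
  ext l l'
  have hP : P ≠ 0 := by have := l.2; omega
  have hPc : (P : ℂ) ≠ 0 := by exact_mod_cast hP
  rw [Matrix.mul_apply, Matrix.one_apply]
  simp only [Matrix.star_apply, RCLike.star_def]
  split_ifs with h
  · subst h
    rw [Finset.sum_congr rfl fun m _ => dftMatrix_mul_conj l m]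
    simp [hPc]
  · set z := Complex.exp (2 * Real.pi * Complex.I / P) with hz
    have hprim : IsPrimitiveRoot z P := Complex.isPrimitiveRoot_exp P hP
    have hnorm : ‖z‖ = 1 := hprim.norm'_eq_one hP
    have hzc : z * conj z = 1 := by rw [Complex.mul_conj', hnorm]; simp
    have hzpow : ∀ k : ℕ, z ^ k * conj z ^ k = 1 := fun k => by rw [← mul_pow, hzc, one_pow]
    set u := z ^ (l : ℕ) * conj z ^ (l' : ℕ) with hu
    have hu1 : u ≠ 1 := by
      intro h1
      apply h
      have h2 : z ^ (l : ℕ) = z ^ (l' : ℕ) := by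
        calc z ^ (l : ℕ) = u * z ^ (l' : ℕ) := by
              rw [hu, mul_assoc, mul_comm (conj z ^ _), hzpow, mul_one]
          _ = z ^ (l' : ℕ) := by rw [h1, one_mul]
      exact Fin.ext (hprim.pow_inj l.2 l'.2 h2)
    have huP : u ^ P = 1 := by
      rw [hu, mul_pow, ← pow_mul, ← pow_mul, mul_comm (l : ℕ), mul_comm (l' : ℕ), pow_mul, pow_mul,
        hprim.pow_eq_one, one_pow, one_mul, ← map_pow, hprim.pow_eq_one, map_one, one_pow]
    have hsum : ∑ m : Fin P, u ^ (m : ℕ) = 0 := by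
      rw [Fin.sum_univ_eq_sum_range (fun m => u ^ m) P]
      have := geom_sum_mul u P
      rw [huP, sub_self] at this
      exact (mul_eq_zero.1 this).resolve_right (sub_ne_zero.2 hu1)
    have hterm : ∀ m : Fin P, dftMatrix P l m * conj (dftMatrix P l' m) =
        (((√P : ℝ) : ℂ)⁻¹ * ((√P : ℝ) : ℂ)⁻¹) * u ^ (m : ℕ) := by
      intro m
      simp only [dftMatrix, Matrix.of_apply, map_mul, map_pow, map_inv₀, Complex.conj_ofReal]
      rw [hu, mul_pow]
      ring
    rw [Finset.sum_congr rfl fun m _ => hterm m, ← Finset.mul_sum, hsum, mul_zero]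

/-- A design fixes only the squares of the entries of `Λ`; as these are nonnegative, the squared
moduli are determined whatever the signs. -/
theorem mul_conj_eq_of_sq {z : ℂ} {a : ℝ} (ha : 0 ≤ a) (h : z ^ 2 = (a : ℂ)) :
    z * conj z = (a : ℂ) := by
  rw [Complex.mul_conj', ← Complex.ofReal_pow, ← norm_pow, h, Complex.norm_real,
    Real.norm_of_nonneg ha]

/-- A rectangular diagonal matrix acts on diagonal matrices through the squares of its entries. -/
theorem mul_diagonal_mul_conjTranspose {P n : ℕ} (hPn : P ≤ n) {Λ : Matrix (Fin P) (Fin n) ℂ}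
    {a : ℕ → ℝ} (ha : ∀ l, 0 ≤ a l)
    (hoff : ∀ (l : Fin P) (j : Fin n), (l : ℕ) ≠ (j : ℕ) → Λ l j = 0)
    (hdiag : ∀ (l : Fin P) (j : Fin n), (l : ℕ) = (j : ℕ) → Λ l j ^ 2 = (a l : ℂ))
    (d : Fin n → ℂ) :
    Λ * Matrix.diagonal d * Λ.conjTranspose =
      Matrix.diagonal fun l : Fin P => (a l : ℂ) * d (Fin.castLE hPn l) := by
  ext l l'
  rw [Matrix.mul_apply, Matrix.diagonal_apply,
    Finset.sum_eq_single (Fin.castLE hPn l)]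
  · rw [Matrix.mul_diagonal, Matrix.conjTranspose_apply, RCLike.star_def]
    split_ifs with h
    · subst h
      rw [mul_right_comm, mul_conj_eq_of_sq (ha l) (hdiag l _ rfl)]
    · rw [hoff l' (Fin.castLE hPn l) fun h' => h (Fin.ext h'.symm)]
      simp
  · intro j _ hj
    rw [Matrix.mul_diagonal, hoff l j fun h' => hj (Fin.ext h'.symm)]
    simp
  · simp

theorem ratio_pos (hL : 0 < L) (hN : 1 ≤ N) (hP : 1 ≤ P) : 0 < ratio L N P := by
  have hL' : (0 : ℝ) < L := by exact_mod_cast hL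
  have hN' : (0 : ℝ) < N := by exact_mod_cast hN
  have hP' : (0 : ℝ) < P := by exact_mod_cast hP
  unfold ratio
  positivity

theorem exists_sorting_equiv {ι : Type*} {n : ℕ} (e₀ : ι ≃ Fin n) (f : ι → ℝ) :
    ∃ e : ι ≃ Fin n, Antitone fun l => f (e.symm l) := by
  set σ := Tuple.sort fun l => -f (e₀.symm l) with hσ
  have hmono : Monotone ((fun l => -f (e₀.symm l)) ∘ σ) := Tuple.monotone_sort _
  refine ⟨e₀.trans σ.symm, fun a b hab => ?_⟩
  simpa using hmono hab

theorem nonempty_design (hCy : Cy.PosDef) (hΓ : Γ ≠ 0) (hN : 1 ≤ N) (hP : 1 ≤ P)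
    (hPLN : P ≤ L * N) (hT : (toeplitz c N).PosDef) (hη : 0 < η) (hM : η < √(3 / 2) * M) :
    Nonempty (Design Cy Γ c η M N P) := by
  obtain ⟨ζ, hζ, -⟩ := existsUnique_isWaterLevel hCy hΓ hN hP hT hη hM
  obtain ⟨V, hVu, hV⟩ := exists_diagonalization_sv (gammaTilde Cy Γ)
  obtain ⟨eig, ⟨Q, hQu, hQ⟩, -⟩ := exists_isToeplitzEig hT.posSemidef
  obtain ⟨e, he⟩ := exists_sorting_equiv (finProdFinEquiv (m := L) (n := N))
    fun p => sv (gammaTilde Cy Γ) p.1 * √(eig p.2)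
  have hκ := kappa_pos hη hM
  have hr := ratio_pos (pos_of_gamma_ne_zero hΓ) hN hP
  set a : ℕ → ℝ := fun l =>
    4 * kappa η M / (3 * (M : ℝ) ^ 2 * ratio L N P) * wf (ζ * svKron Cy Γ c N l) with ha
  have ha0 : ∀ l, 0 ≤ a l := fun l => mul_nonneg (by positivity) (wf_nonneg _)
  set Λ : Matrix (Fin P) (Fin (L * N)) ℂ := Matrix.of fun l j =>
    if (l : ℕ) = (j : ℕ) then ((√(a l) : ℝ) : ℂ) else 0 with hΛ
  have hoff : ∀ (l : Fin P) (j : Fin (L * N)), (l : ℕ) ≠ (j : ℕ) → Λ l j = 0 := fun l j h => by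
    simp [hΛ, h]
  have hdiag : ∀ (l : Fin P) (j : Fin (L * N)), (l : ℕ) = (j : ℕ) → Λ l j ^ 2 = (a l : ℂ) :=
    fun l j h => by
      rw [hΛ, Matrix.of_apply, if_pos h, ← Complex.ofReal_pow, Real.sq_sqrt (ha0 l)]
  refine ⟨⟨ζ, V, Q, eig, e, Λ, dftMatrix P, hζ, hVu, hV, hQu, hQ, he, hoff, hdiag,
    dftMatrix_mem_unitaryGroup P, ?_⟩⟩
  have hΛΛ := mul_diagonal_mul_conjTranspose hPLN ha0 hoff hdiag fun _ => 1
  rw [Matrix.diagonal_one, Matrix.mul_one] at hΛΛ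
  have hentry : ∀ l : Fin P, (dftMatrix P * Λ * Λ.conjTranspose * (dftMatrix P).conjTranspose) l l =
      ∑ m : Fin P, (P : ℂ)⁻¹ * a m := by
    intro l
    rw [Matrix.mul_assoc (dftMatrix P), hΛΛ, Matrix.mul_apply]
    refine Finset.sum_congr rfl fun m _ => ?_
    rw [Matrix.mul_diagonal, Matrix.conjTranspose_apply, RCLike.star_def, mul_right_comm,
      dftMatrix_mul_conj, mul_one]
  intro l m
  rw [hentry, hentry]

end Existence

/-! ### Matrix algebra of the waterfilling design -/

section DesignAlgebra

variable {K L N P M : ℕ} {Cy : Matrix (Fin L) (Fin L) ℂ} {Γ : Matrix (Fin K) (Fin L) ℂ}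
  {c : ℤ → ℂ} {η : ℝ}

/-- The noise power per quantizer of the waterfilling design. -/
noncomputable def designNoise (η : ℝ) (L M N P : ℕ) : ℝ :=
  4 * kappa η M / (3 * (M : ℝ) ^ 2 * ratio L N P)

/-- The value of the waterfilling design: the part of the energy of the MMSE estimate that the
system recovers. -/
noncomputable def waterValue (Cy : Matrix (Fin L) (Fin L) ℂ) (Γ : Matrix (Fin K) (Fin L) ℂ)
    (c : ℤ → ℂ) (N P : ℕ) (ζ : ℝ) : ℝ :=
  ∑ l ∈ Finset.range P, svKron Cy Γ c N l ^ 2 * wf (ζ * svKron Cy Γ c N l) /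
    (wf (ζ * svKron Cy Γ c N l) + 1)

theorem conjTranspose_sqrtKron (Cy : Matrix (Fin L) (Fin L) ℂ) (T : Matrix (Fin N) (Fin N) ℂ) :
    (CFC.sqrt Cy ⊗ₖ CFC.sqrt T).conjTranspose = CFC.sqrt Cy ⊗ₖ CFC.sqrt T := by
  rw [Matrix.conjTranspose_kronecker, conjTranspose_sqrt, conjTranspose_sqrt]

theorem sqrtKron_mul_self {T : Matrix (Fin N) (Fin N) ℂ} (hCy : Cy.PosSemidef)
    (hT : T.PosSemidef) :
    (CFC.sqrt Cy ⊗ₖ CFC.sqrt T) * (CFC.sqrt Cy ⊗ₖ CFC.sqrt T) = Cy ⊗ₖ T := by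
  rw [← Matrix.mul_kronecker_mul, sqrt_mul_sqrt hCy, sqrt_mul_sqrt hT]

theorem gammaKron_mul_sqrtKron {T : Matrix (Fin N) (Fin N) ℂ} (hCy : Cy.PosSemidef)
    (hT : T.PosSemidef) :
    (gammaTilde Cy Γ ⊗ₖ CFC.sqrt T) * (CFC.sqrt Cy ⊗ₖ CFC.sqrt T) = (Γ * Cy) ⊗ₖ T := by
  rw [← Matrix.mul_kronecker_mul, sqrt_mul_sqrt hT, gammaTilde, Matrix.mul_assoc,
    sqrt_mul_sqrt hCy]

/-- This is the level equation multiplied by `P / r`. The left side is the trace of `Λ Λᴴ`, the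
total power of the quantizer inputs. -/
theorem Design.ratio_mul (D : Design Cy Γ c η M N P) (hP : 1 ≤ P) (hη : 0 < η)
    (hM : η < √(3 / 2) * M) (hr : 0 < ratio L N P) :
    ∑ l ∈ Finset.range P, designNoise η L M N P * wf (D.ζ * svKron Cy Γ c N l) =
      P / ratio L N P := by
  have hκ := kappa_pos hη hM
  have hM0 := resolution_pos_of_lt hη hM
  have hP0 : (0 : ℝ) < P := by exact_mod_cast hP
  have h := D.level.2
  rw [← Finset.mul_sum]
  set s := ∑ l ∈ Finset.range P, wf (D.ζ * svKron Cy Γ c N l)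
  rw [designNoise]
  field_simp at h ⊢
  linarith

/-- The whitened combining matrix of the design. -/
theorem Design.analog_mul_sqrtKron (D : Design Cy Γ c η M N P) (hCy : Cy.PosDef)
    (hT : (toeplitz c N).PosDef) :
    D.analog * (CFC.sqrt Cy ⊗ₖ CFC.sqrt (toeplitz c N)) =
      D.U * D.Λ * ((D.V ⊗ₖ D.Q).conjTranspose).submatrix D.e.symm id := by
  have h : ((D.V.conjTranspose * (CFC.sqrt Cy)⁻¹) ⊗ₖ
      (D.Q.conjTranspose * (CFC.sqrt (toeplitz c N))⁻¹)) *
      (CFC.sqrt Cy ⊗ₖ CFC.sqrt (toeplitz c N)) = (D.V ⊗ₖ D.Q).conjTranspose := by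
    rw [← Matrix.mul_kronecker_mul, Matrix.mul_assoc, Matrix.mul_assoc, inv_sqrt_mul_sqrt hCy,
      inv_sqrt_mul_sqrt hT, Matrix.mul_one, Matrix.mul_one, Matrix.conjTranspose_kronecker]
  rw [Design.analog, Matrix.mul_assoc]
  congr 1
  rw [← h, Matrix.submatrix_mul _ _ D.e.symm id id Function.bijective_id, Matrix.submatrix_id_id]

theorem Design.rows_mul_conjTranspose (D : Design Cy Γ c η M N P) :
    ((D.V ⊗ₖ D.Q).conjTranspose).submatrix D.e.symm id *
      (((D.V ⊗ₖ D.Q).conjTranspose).submatrix D.e.symm id).conjTranspose = 1 := by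
  have h : (D.V ⊗ₖ D.Q).conjTranspose * (D.V ⊗ₖ D.Q) = 1 :=
    Matrix.mem_unitaryGroup_iff'.1 (Matrix.kronecker_mem_unitary D.V_unitary D.Q_unitary)
  rw [Matrix.conjTranspose_submatrix, Matrix.conjTranspose_conjTranspose,
    ← Matrix.submatrix_mul _ _ D.e.symm id D.e.symm Function.bijective_id, h]
  simp

theorem Design.rows_mul_gram (D : Design Cy Γ c η M N P) (hT : (toeplitz c N).PosDef) :
    ((D.V ⊗ₖ D.Q).conjTranspose).submatrix D.e.symm id *
      ((gammaTilde Cy Γ ⊗ₖ CFC.sqrt (toeplitz c N)).conjTranspose *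
        (gammaTilde Cy Γ ⊗ₖ CFC.sqrt (toeplitz c N))) *
      (((D.V ⊗ₖ D.Q).conjTranspose).submatrix D.e.symm id).conjTranspose =
      Matrix.diagonal fun l : Fin (L * N) => ((svKron Cy Γ c N l ^ 2 : ℝ) : ℂ) := by
  have h : (D.V ⊗ₖ D.Q).conjTranspose * (D.V ⊗ₖ D.Q) = 1 :=
    Matrix.mem_unitaryGroup_iff'.1 (Matrix.kronecker_mem_unitary D.V_unitary D.Q_unitary)
  rw [gram_kronecker_diagonalization hT.posSemidef D.V_spec D.Q_unitary D.Q_spec]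
  set W := D.V ⊗ₖ D.Q
  set E := Matrix.diagonal (fun p : Fin L × Fin N =>
    (((sv (gammaTilde Cy Γ) p.1 * √(D.eig p.2)) ^ 2 : ℝ) : ℂ))
  have h1 : W.conjTranspose.submatrix D.e.symm id * (W * E * W.conjTranspose) *
      (W.conjTranspose.submatrix D.e.symm id).conjTranspose =
      (W.conjTranspose * (W * E * W.conjTranspose) * W).submatrix D.e.symm D.e.symm := by
    rw [Matrix.conjTranspose_submatrix, Matrix.conjTranspose_conjTranspose,
      Matrix.submatrix_mul _ _ D.e.symm id D.e.symm Function.bijective_id,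
      Matrix.submatrix_mul _ _ D.e.symm id id Function.bijective_id, Matrix.submatrix_id_id]
  have h2 : W.conjTranspose * (W * E * W.conjTranspose) * W = E := by
    calc _ = (W.conjTranspose * W) * E * (W.conjTranspose * W) := by
          simp only [Matrix.mul_assoc]
      _ = E := by rw [h, Matrix.one_mul, Matrix.mul_one]
  rw [h1, h2, Matrix.submatrix_diagonal_equiv]
  congr 1
  ext l
  rw [svKron_eq hT.posSemidef D.V_unitary D.V_spec D.Q_unitary D.Q_spec D.e D.e_sorted]
  rfl

theorem Design.Λ_mul_diagonal (D : Design Cy Γ c η M N P) (hη : 0 < η)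
    (hM : η < √(3 / 2) * M) (hPLN : P ≤ L * N) (hr : 0 < ratio L N P) (d : Fin (L * N) → ℂ) :
    D.Λ * Matrix.diagonal d * D.Λ.conjTranspose =
      Matrix.diagonal fun l : Fin P =>
        ((designNoise η L M N P * wf (D.ζ * svKron Cy Γ c N l) : ℝ) : ℂ) *
          d (Fin.castLE hPLN l) := by
  have hκ := kappa_pos hη hM
  exact mul_diagonal_mul_conjTranspose hPLN
    (a := fun l => designNoise η L M N P * wf (D.ζ * svKron Cy Γ c N l))
    (fun l => mul_nonneg (by unfold designNoise; positivity) (wf_nonneg _)) D.Λ_off D.Λ_diag d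

theorem Design.gram_analog (D : Design Cy Γ c η M N P) (hCy : Cy.PosDef)
    (hT : (toeplitz c N).PosDef) :
    D.analog * (Cy ⊗ₖ toeplitz c N) * D.analog.conjTranspose =
      D.U * (D.Λ * D.Λ.conjTranspose) * D.U.conjTranspose := by
  set S := CFC.sqrt Cy ⊗ₖ CFC.sqrt (toeplitz c N) with hS
  set R := ((D.V ⊗ₖ D.Q).conjTranspose).submatrix D.e.symm id with hR
  have hX : D.analog * S = D.U * D.Λ * R := D.analog_mul_sqrtKron hCy hT
  calc D.analog * (Cy ⊗ₖ toeplitz c N) * D.analog.conjTranspose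
      = (D.analog * S) * (D.analog * S).conjTranspose := by
        rw [← sqrtKron_mul_self hCy.posSemidef hT.posSemidef, Matrix.conjTranspose_mul, hS,
          conjTranspose_sqrtKron]
        simp only [Matrix.mul_assoc]
    _ = D.U * D.Λ * (R * R.conjTranspose) * D.Λ.conjTranspose * D.U.conjTranspose := by
        rw [hX]
        simp only [Matrix.conjTranspose_mul, Matrix.mul_assoc]
    _ = _ := by
        rw [hR, D.rows_mul_conjTranspose, Matrix.mul_one]
        simp only [Matrix.mul_assoc]

/-- `U` preserves the trace `P / r` of `Λ Λᴴ` and makes the `P` diagonal entries equal, so each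
input has variance `1 / r`. -/
theorem Design.gram_analog_diag (D : Design Cy Γ c η M N P) (hCy : Cy.PosDef)
    (hT : (toeplitz c N).PosDef) (hη : 0 < η) (hM : η < √(3 / 2) * M) (hP : 1 ≤ P)
    (hPLN : P ≤ L * N) (hr : 0 < ratio L N P) (l : Fin P) :
    (D.analog * (Cy ⊗ₖ toeplitz c N) * D.analog.conjTranspose) l l =
      ((1 / ratio L N P : ℝ) : ℂ) := by
  have hUU : D.U.conjTranspose * D.U = 1 := Matrix.mem_unitaryGroup_iff'.1 D.U_unitary
  have hΛ := D.Λ_mul_diagonal hη hM hPLN hr fun _ => 1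
  rw [Matrix.diagonal_one, Matrix.mul_one] at hΛ
  have hassoc : D.U * (D.Λ * D.Λ.conjTranspose) * D.U.conjTranspose =
      D.U * D.Λ * D.Λ.conjTranspose * D.U.conjTranspose := by simp only [Matrix.mul_assoc]
  have htrace : (D.U * (D.Λ * D.Λ.conjTranspose) * D.U.conjTranspose).trace =
      ((P / ratio L N P : ℝ) : ℂ) := by
    rw [Matrix.trace_mul_comm, ← Matrix.mul_assoc, hUU, Matrix.one_mul, hΛ, Matrix.trace_diagonal,
      ← D.ratio_mul hP hη hM hr, ← Fin.sum_univ_eq_sum_range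
        (fun l => designNoise η L M N P * wf (D.ζ * svKron Cy Γ c N l)) P]
    push_cast
    simp
  have htrace2 : (D.U * (D.Λ * D.Λ.conjTranspose) * D.U.conjTranspose).trace =
      P * (D.U * (D.Λ * D.Λ.conjTranspose) * D.U.conjTranspose) l l := by
    rw [Matrix.trace, Finset.sum_congr rfl fun m _ => show
      (D.U * (D.Λ * D.Λ.conjTranspose) * D.U.conjTranspose).diag m =
        (D.U * (D.Λ * D.Λ.conjTranspose) * D.U.conjTranspose) l l by
      rw [hassoc]; exact D.U_equalizes m l]
    simp
  have hP0 : (P : ℂ) ≠ 0 := by exact_mod_cast (by omega : P ≠ 0)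
  rw [D.gram_analog hCy hT]
  apply mul_left_cancel₀ hP0
  rw [← htrace2, htrace]
  push_cast
  ring

/-- The quadratic part of the MSE of the waterfilling design. -/
theorem Design.quadratic_eq (D : Design Cy Γ c η M N P) (hCy : Cy.PosDef)
    (hT : (toeplitz c N).PosDef) (hη : 0 < η) (hM : η < √(3 / 2) * M)
    (hPLN : P ≤ L * N) (hr : 0 < ratio L N P) :
    (D.dig * (D.analog * (Cy ⊗ₖ toeplitz c N) * D.analog.conjTranspose +
        ((designNoise η L M N P : ℝ) : ℂ) • (1 : Matrix (Fin P) (Fin P) ℂ)) *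
          D.dig.conjTranspose).trace.re -
      2 * (D.dig * D.analog * ((Γ * Cy) ⊗ₖ toeplitz c N).conjTranspose).trace.re =
      -waterValue Cy Γ c N P D.ζ := by
  have hκ := kappa_pos hη hM
  have hM0 := resolution_pos_of_lt hη hM
  set ν := designNoise η L M N P with hνdef
  have hν : 0 < ν := by rw [hνdef]; unfold designNoise; positivity
  set w : ℕ → ℝ := fun l => wf (D.ζ * svKron Cy Γ c N l) with hw
  have hw0 : ∀ l, 0 ≤ w l := fun l => wf_nonneg _
  set G := (Γ * Cy) ⊗ₖ toeplitz c N with hG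
  set A := D.analog with hA
  set Z := A * (Cy ⊗ₖ toeplitz c N) * A.conjTranspose +
    ((ν : ℝ) : ℂ) • (1 : Matrix (Fin P) (Fin P) ℂ) with hZ
  have hUU : D.U.conjTranspose * D.U = 1 := Matrix.mem_unitaryGroup_iff'.1 D.U_unitary
  have hUU' : D.U * D.U.conjTranspose = 1 := Matrix.mem_unitaryGroup_iff.1 D.U_unitary
  have hΛ := D.Λ_mul_diagonal hη hM hPLN hr fun _ => 1
  rw [Matrix.diagonal_one, Matrix.mul_one] at hΛ
  set F : Matrix (Fin P) (Fin P) ℂ :=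
    Matrix.diagonal fun l : Fin P => ((ν * (w l + 1) : ℝ) : ℂ) with hF
  set E : Matrix (Fin P) (Fin P) ℂ :=
    Matrix.diagonal fun l : Fin P => (((ν * (w l + 1))⁻¹ : ℝ) : ℂ) with hE
  have hFE : F * E = 1 := by
    rw [hF, hE, Matrix.diagonal_mul_diagonal, ← Matrix.diagonal_one]
    congr 1
    ext l
    have : ν * (w l + 1) ≠ 0 := by have := hw0 l; positivity
    rw [← Complex.ofReal_mul, mul_inv_cancel₀ this, Complex.ofReal_one]
  -- `Λ Λᴴ` has diagonal `ν w` and the noise adds `ν`, so `U` diagonalizes the output covariance `Z`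
  -- with eigenvalues `ν (w + 1)`; `E` inverts them.
  have hZF : Z = D.U * F * D.U.conjTranspose := by
    have h1 : F = D.Λ * D.Λ.conjTranspose + ((ν : ℝ) : ℂ) • (1 : Matrix (Fin P) (Fin P) ℂ) := by
      rw [hΛ, ← Matrix.diagonal_one, ← Matrix.diagonal_smul, Matrix.diagonal_add, hF]
      congr 1
      ext l
      simp only [Pi.smul_apply, smul_eq_mul, mul_one]
      push_cast
      ring
    rw [hZ, D.gram_analog hCy hT, h1, Matrix.mul_add, Matrix.add_mul, Matrix.mul_smul,
      Matrix.smul_mul, Matrix.mul_one, hUU']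
  set I := D.U * E * D.U.conjTranspose with hI
  have hZI : Z * I = 1 := by
    calc Z * I = D.U * (F * (D.U.conjTranspose * D.U) * E) * D.U.conjTranspose := by
          rw [hZF, hI]; simp only [Matrix.mul_assoc]
      _ = 1 := by rw [hUU, Matrix.mul_one, hFE, Matrix.mul_one, hUU']
  have hIH : I.conjTranspose = I := by
    rw [hI, Matrix.conjTranspose_mul, Matrix.conjTranspose_mul, Matrix.conjTranspose_conjTranspose,
      hE, Matrix.diagonal_conjTranspose, ← Matrix.mul_assoc]
    congr 3
    ext l
    simp
  have hdig : D.dig = G * A.conjTranspose * I := by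
    have h1 : ((4 * (kappa η M / ratio L N P) / (3 * (M : ℝ) ^ 2) : ℝ) : ℂ) = ((ν : ℝ) : ℂ) := by
      rw [hνdef, designNoise]
      congr 1
      field_simp
    rw [Design.dig, digital, h1]
    change G * A.conjTranspose * Z⁻¹ = _
    rw [Matrix.inv_eq_right_inv hZI]
  -- For the linear MMSE filter the quadratic term equals the cross term, so the sum is minus one
  -- copy of it.
  have hBZB : D.dig * Z * D.dig.conjTranspose = G * A.conjTranspose * I * A * G.conjTranspose := by
    have hIZ : I * Z = 1 := mul_eq_one_comm.1 hZI
    calc D.dig * Z * D.dig.conjTranspose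
        = G * A.conjTranspose * (I * Z) * I * A * G.conjTranspose := by
          rw [hdig, Matrix.conjTranspose_mul (G * A.conjTranspose) I, hIH,
            Matrix.conjTranspose_mul, Matrix.conjTranspose_conjTranspose]
          simp only [Matrix.mul_assoc]
      _ = _ := by rw [hIZ, Matrix.mul_one]
  rw [hBZB, hdig]
  set S := CFC.sqrt Cy ⊗ₖ CFC.sqrt (toeplitz c N) with hS
  set H := gammaTilde Cy Γ ⊗ₖ CFC.sqrt (toeplitz c N) with hH
  set R := ((D.V ⊗ₖ D.Q).conjTranspose).submatrix D.e.symm id with hR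
  have hGA : A * G.conjTranspose = D.U * D.Λ * R * H.conjTranspose := by
    rw [hG, ← gammaKron_mul_sqrtKron hCy.posSemidef hT.posSemidef, Matrix.conjTranspose_mul,
      conjTranspose_sqrtKron, ← Matrix.mul_assoc, hA, D.analog_mul_sqrtKron hCy hT]
  have hGA' : G * A.conjTranspose = (D.U * D.Λ * R * H.conjTranspose).conjTranspose := by
    rw [← hGA, Matrix.conjTranspose_mul, Matrix.conjTranspose_conjTranspose]
  -- All unitaries cancel, and channel `l` contributes `(ν (w + 1))⁻¹ * (ν w) * σ²`: the noise power
  -- drops out.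
  have htrace : (G * A.conjTranspose * I * A * G.conjTranspose).trace =
      (waterValue Cy Γ c N P D.ζ : ℂ) := by
    calc (G * A.conjTranspose * I * A * G.conjTranspose).trace
        = (H * (R.conjTranspose * D.Λ.conjTranspose * ((D.U.conjTranspose * D.U) * E *
            (D.U.conjTranspose * D.U)) * D.Λ * R * H.conjTranspose)).trace := by
          rw [Matrix.mul_assoc _ A, hGA, hGA', hI]
          simp only [Matrix.conjTranspose_mul, Matrix.conjTranspose_conjTranspose,
            Matrix.mul_assoc]
      _ = (E * (D.Λ * (R * (H.conjTranspose * H) * R.conjTranspose) *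
            D.Λ.conjTranspose)).trace := by
          rw [hUU, Matrix.one_mul, Matrix.mul_one]
          have h1 : H * (R.conjTranspose * D.Λ.conjTranspose * E * D.Λ * R * H.conjTranspose) =
              (H * R.conjTranspose * D.Λ.conjTranspose) * (E * D.Λ * R * H.conjTranspose) := by
            simp only [Matrix.mul_assoc]
          rw [h1, Matrix.trace_mul_comm]
          simp only [Matrix.mul_assoc]
      _ = _ := by
          rw [hR, hH, D.rows_mul_gram hT, D.Λ_mul_diagonal hη hM hPLN hr, hE,
            Matrix.diagonal_mul_diagonal, Matrix.trace_diagonal, waterValue,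
            ← Fin.sum_univ_eq_sum_range (fun l => svKron Cy Γ c N l ^ 2 *
              wf (D.ζ * svKron Cy Γ c N l) / (wf (D.ζ * svKron Cy Γ c N l) + 1)) P,
            Complex.ofReal_sum]
          refine Finset.sum_congr rfl fun l _ => ?_
          rw [← Complex.ofReal_mul, ← Complex.ofReal_mul]
          congr 1
          have h1 := hw0 l
          simp only [hw] at h1 ⊢
          rw [← hνdef]
          have h2 : wf (D.ζ * svKron Cy Γ c N l) + 1 ≠ 0 := by positivity
          simp only [Fin.val_castLE]
          field_simp
  rw [htrace, Complex.ofReal_re]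
  ring

end DesignAlgebra

/-! ### The MSE of the design and its optimality -/

section Performance

variable {Ω : Type*} [MeasurableSpace Ω] {μ : Measure Ω} [IsProbabilityMeasure μ] {K L : ℕ}
  {g : ℕ → Ω → Fin K → ℂ} {y : ℕ → Ω → Fin L → ℂ} {Cg : Matrix (Fin K) (Fin K) ℂ}
  {Cy : Matrix (Fin L) (Fin L) ℂ} {Γ : Matrix (Fin K) (Fin L) ℂ} {c : ℤ → ℂ}
  {N P M : ℕ} {η : ℝ}

omit [IsProbabilityMeasure μ] in
theorem SignalModel.integral_norm_sq_combined (h : SignalModel μ g y Cg Cy Γ c)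
    (A : Matrix (Fin P) (Fin L × Fin N) ℂ) (l : Fin P) :
    ∫ ω, ‖combined A y ω l‖ ^ 2 ∂μ =
      ((A * (Cy ⊗ₖ toeplitz c N) * A.conjTranspose) l l).re := by
  have hY := h.memLp_stack_y N
  have h1 := integral_norm_sq_eq_crossCorr (μ := μ) (combined A y) l
  have h2 : crossCorr μ (combined A y) (combined A y) =
      A * (Cy ⊗ₖ toeplitz c N) * A.conjTranspose := by
    change crossCorr μ (fun ω => A.mulVec (stack y N ω)) (fun ω => A.mulVec (stack y N ω)) = _
    rw [crossCorr_mulVec_left A hY (memLp_mulVec A hY), crossCorr_mulVec_right A hY hY,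
      h.crossCorr_y, Matrix.mul_assoc]
  rw [h2] at h1
  rw [← h1, Complex.ofReal_re]

omit [IsProbabilityMeasure μ] in
theorem sq_adcSupport (hκ : 0 ≤ kappa η M) (x : Ω → Fin P → ℂ) :
    adcSupport μ η M x ^ 2 = kappa η M * ⨆ l, ∫ ω, ‖x ω l‖ ^ 2 ∂μ := by
  rw [adcSupport, Real.sq_sqrt]
  exact mul_nonneg hκ (Real.iSup_nonneg fun l => integral_nonneg fun ω => by positivity)

omit [IsProbabilityMeasure μ] in
theorem SignalModel.sq_adcSupport_design (h : SignalModel μ g y Cg Cy Γ c) (hCy : Cy.PosDef)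
    (hT : (toeplitz c N).PosDef) (hη : 0 < η) (hM : η < √(3 / 2) * M) (hP : 1 ≤ P)
    (hPLN : P ≤ L * N) (hr : 0 < ratio L N P) (D : Design Cy Γ c η M N P) :
    adcSupport μ η M (combined D.analog y) ^ 2 = kappa η M / ratio L N P := by
  have : Nonempty (Fin P) := ⟨⟨0, hP⟩⟩
  rw [sq_adcSupport (kappa_pos hη hM).le]
  have h1 : ∀ l, ∫ ω, ‖combined D.analog y ω l‖ ^ 2 ∂μ = 1 / ratio L N P := fun l => by
    rw [h.integral_norm_sq_combined, D.gram_analog_diag hCy hT hη hM hP hPLN hr,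
      Complex.ofReal_re]
  simp only [h1, ciSup_const]
  ring

-- The largest of the `P` input variances is at least their mean. This is the power constraint of
-- the lower bound, and the equalizing rotation of the design is there to make it an equality.
omit [IsProbabilityMeasure μ] in
theorem SignalModel.trace_le_sq_adcSupport (h : SignalModel μ g y Cg Cy Γ c)
    (hκ : 0 < kappa η M) (A : Matrix (Fin P) (Fin L × Fin N) ℂ) :
    kappa η M * (A * (Cy ⊗ₖ toeplitz c N) * A.conjTranspose).trace.re ≤
      P * adcSupport μ η M (combined A y) ^ 2 := by
  rw [sq_adcSupport hκ.le, mul_left_comm]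
  refine mul_le_mul_of_nonneg_left ?_ hκ.le
  rw [Matrix.trace, Complex.re_sum]
  have hbdd : BddAbove (Set.range fun l => ∫ ω, ‖combined A y ω l‖ ^ 2 ∂μ) :=
    Set.Finite.bddAbove (Set.finite_range _)
  calc ∑ l, ((A * (Cy ⊗ₖ toeplitz c N) * A.conjTranspose).diag l).re
      ≤ ∑ _l : Fin P, ⨆ l, ∫ ω, ‖combined A y ω l‖ ^ 2 ∂μ := by
        refine Finset.sum_le_sum fun l _ => ?_
        rw [Matrix.diag_apply, ← h.integral_norm_sq_combined]
        exact le_ciSup hbdd l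
    _ = _ := by simp

/-- The MSE of any system in terms of second-order statistics. -/
theorem SignalModel.avgMSE_eq (h : SignalModel μ g y Cg Cy Γ c)
    {A : Matrix (Fin P) (Fin L × Fin N) ℂ} (B : Matrix (Fin K × Fin N) (Fin P) ℂ)
    {q : Ω → Fin P → ℂ} (hq : IsSystemOutput μ g y η M A q) :
    avgMSE μ (stack g N) B q = (1 / ((K : ℝ) * N)) * ((Cg ⊗ₖ toeplitz c N).trace.re +
      ((B * (A * (Cy ⊗ₖ toeplitz c N) * A.conjTranspose +
        (((2 * adcSupport μ η M (combined A y) / M) ^ 2 / 3 : ℝ) : ℂ) •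
          (1 : Matrix (Fin P) (Fin P) ℂ)) * B.conjTranspose).trace.re -
        2 * (B * A * ((Γ * Cy) ⊗ₖ toeplitz c N).conjTranspose).trace.re)) := by
  have hq' : IsADCOutput μ (stack g N) (stack y N) M (adcSupport μ η M (combined A y))
    (fun ω => A.mulVec (stack y N ω)) q := hq
  rw [avgMSE, hq'.integral_sum_norm_sub_sq (h.memLp_stack_g N) (h.memLp_stack_y N) B,
    h.crossCorr_g, h.crossCorr_y, h.crossCorr_gy]

theorem SignalModel.avgMSE_design (h : SignalModel μ g y Cg Cy Γ c) (hCy : Cy.PosDef)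
    (hT : (toeplitz c N).PosDef) (hη : 0 < η) (hM : η < √(3 / 2) * M) (hP : 1 ≤ P)
    (hPLN : P ≤ L * N) (hr : 0 < ratio L N P) (D : Design Cy Γ c η M N P) {q : Ω → Fin P → ℂ}
    (hq : IsSystemOutput μ g y η M D.analog q) :
    avgMSE μ (stack g N) D.dig q = (1 / ((K : ℝ) * N)) *
      ((Cg ⊗ₖ toeplitz c N).trace.re - waterValue Cy Γ c N P D.ζ) := by
  have hM0 := resolution_pos_of_lt hη hM
  have hν : (2 * adcSupport μ η M (combined D.analog y) / M) ^ 2 / 3 = designNoise η L M N P := by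
    rw [div_pow, mul_pow, h.sq_adcSupport_design hCy hT hη hM hP hPLN hr D, designNoise]
    field_simp
    ring
  rw [h.avgMSE_eq D.dig hq, hν, D.quadratic_eq hCy hT hη hM hPLN hr, ← sub_eq_add_neg]

/-- Whitening with `X = A * S` gives the objective the form treated in `neg_waterfilling_le`, and
`trace_le_sq_adcSupport` supplies the bound of the noise power from below. -/
theorem SignalModel.avgMSE_ge (h : SignalModel μ g y Cg Cy Γ c) (hCy : Cy.PosDef)
    (hT : (toeplitz c N).PosDef) (hη : 0 < η) (hM : η < √(3 / 2) * M) (hP : 1 ≤ P)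
    (hPLN : P ≤ L * N) (D : Design Cy Γ c η M N P)
    {A : Matrix (Fin P) (Fin L × Fin N) ℂ} (B : Matrix (Fin K × Fin N) (Fin P) ℂ)
    {q : Ω → Fin P → ℂ} (hq : IsSystemOutput μ g y η M A q) :
    (1 / ((K : ℝ) * N)) * ((Cg ⊗ₖ toeplitz c N).trace.re - waterValue Cy Γ c N P D.ζ) ≤
      avgMSE μ (stack g N) B q := by
  have hκ := kappa_pos hη hM
  have hM0 := resolution_pos_of_lt hη hM
  have hP0 : (0 : ℝ) < P := by exact_mod_cast hP
  rw [h.avgMSE_eq B hq]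
  refine mul_le_mul_of_nonneg_left ?_ (by positivity)
  rw [sub_eq_add_neg]
  refine add_le_add_right ?_ _
  set S := CFC.sqrt Cy ⊗ₖ CFC.sqrt (toeplitz c N) with hS
  set H := gammaTilde Cy Γ ⊗ₖ CFC.sqrt (toeplitz c N) with hH
  have hXX : A * S * (A * S).conjTranspose = A * (Cy ⊗ₖ toeplitz c N) * A.conjTranspose := by
    rw [← sqrtKron_mul_self hCy.posSemidef hT.posSemidef, Matrix.conjTranspose_mul, hS,
      conjTranspose_sqrtKron]
    simp only [Matrix.mul_assoc]
  have hGH : B * A * ((Γ * Cy) ⊗ₖ toeplitz c N).conjTranspose =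
      B * (A * S) * H.conjTranspose := by
    rw [← gammaKron_mul_sqrtKron hCy.posSemidef hT.posSemidef, Matrix.conjTranspose_mul,
      conjTranspose_sqrtKron]
    simp only [Matrix.mul_assoc, hS, hH]
  have hν : 4 * kappa η M / (3 * (M : ℝ) ^ 2 * P) * (A * S * (A * S).conjTranspose).trace.re ≤
      (2 * adcSupport μ η M (combined A y) / M) ^ 2 / 3 := by
    rw [hXX]
    have h1 := h.trace_le_sq_adcSupport hκ A
    set t := (A * (Cy ⊗ₖ toeplitz c N) * A.conjTranspose).trace.re
    calc 4 * kappa η M / (3 * (M : ℝ) ^ 2 * P) * t = 4 / (3 * (M : ℝ) ^ 2 * P) *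
          (kappa η M * t) := by ring
      _ ≤ 4 / (3 * (M : ℝ) ^ 2 * P) * (P * adcSupport μ η M (combined A y) ^ 2) :=
          mul_le_mul_of_nonneg_left h1 (by positivity)
      _ = _ := by field_simp; ring
  have hmain := neg_waterfilling_le
    (s := fun p : Fin L × Fin N => sv (gammaTilde Cy Γ) p.1 * √(D.eig p.2))
    (fun p => mul_nonneg (sv_nonneg _ _) (Real.sqrt_nonneg _)) D.e hP hPLN
    (σ := svKron Cy Γ c N) (sv_antitone _) (sv_nonneg _)
    (svKron_eq hT.posSemidef D.V_unitary D.V_spec D.Q_unitary D.Q_spec D.e D.e_sorted)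
    D.level.1 (ν₀ := 4 * kappa η M / (3 * (M : ℝ) ^ 2 * P)) (by positivity) D.level.2 H
    (D.V ⊗ₖ D.Q) (Matrix.kronecker_mem_unitary D.V_unitary D.Q_unitary)
    (gram_kronecker_diagonalization hT.posSemidef D.V_spec D.Q_unitary D.Q_spec) (A * S) hν B
  rw [hXX] at hmain
  rw [hGH]
  exact hmain

end Performance

/-! ### The recovered energy as a function of the level -/

section Gain

/-- The energy recovered from a channel with gain `σ` at the level `ζ`. -/
noncomputable def recovered (ζ σ : ℝ) : ℝ := σ ^ 2 * wf (ζ * σ) / (wf (ζ * σ) + 1)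

theorem recovered_zero (ζ : ℝ) : recovered ζ 0 = 0 := by simp [recovered]

theorem continuous_recovered : Continuous fun p : ℝ × ℝ => recovered p.1 p.2 := by
  unfold recovered
  have h : Continuous fun p : ℝ × ℝ => wf (p.1 * p.2) :=
    continuous_wf.comp (continuous_fst.mul continuous_snd)
  refine ((continuous_snd.pow 2).mul h).div (h.add continuous_const) fun p => ?_
  have := wf_nonneg (p.1 * p.2)
  positivity

/-- A Lipschitz bound in the level, uniform over bounded gains. It allows the level of size `N` to
be replaced by its limit inside averages over eigenvalues. -/
theorem abs_recovered_sub_le {ζ ζ' σ C : ℝ} (hσ : 0 ≤ σ) (hC : σ ≤ C) :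
    |recovered ζ σ - recovered ζ' σ| ≤ C ^ 3 * |ζ - ζ'| := by
  set t := wf (ζ * σ) with ht
  set s := wf (ζ' * σ) with hs
  have ht0 : 0 ≤ t := wf_nonneg _
  have hs0 : 0 ≤ s := wf_nonneg _
  have h1 : recovered ζ σ - recovered ζ' σ = σ ^ 2 * ((t - s) / ((t + 1) * (s + 1))) := by
    rw [recovered, recovered, ← ht, ← hs]
    field_simp
    ring
  have h2 : |(t - s) / ((t + 1) * (s + 1))| ≤ |t - s| := by
    rw [abs_div, abs_of_pos (show 0 < (t + 1) * (s + 1) by positivity)]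
    exact div_le_self (abs_nonneg _) (by nlinarith)
  have h3 : |t - s| ≤ |ζ - ζ'| * σ := by
    refine (abs_wf_sub_le _ _).trans_eq ?_
    rw [← sub_mul, abs_mul, abs_of_nonneg hσ]
  rw [h1, abs_mul, abs_of_nonneg (sq_nonneg σ)]
  calc σ ^ 2 * |(t - s) / ((t + 1) * (s + 1))| ≤ σ ^ 2 * (|ζ - ζ'| * σ) := by
        gcongr
        exact h2.trans h3
    _ = σ ^ 3 * |ζ - ζ'| := by ring
    _ ≤ C ^ 3 * |ζ - ζ'| := by gcongr

theorem sub_recovered (ζ σ : ℝ) : σ ^ 2 - recovered ζ σ = σ ^ 2 / (wf (ζ * σ) + 1) := by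
  have h0 := wf_nonneg (ζ * σ)
  have h : wf (ζ * σ) + 1 ≠ 0 := by positivity
  rw [recovered, eq_div_iff h, sub_mul, div_mul_cancel₀ _ h]
  ring

theorem SuperLinear.of_tendsto {F : ℝ → ℝ} {G : ℕ → ℝ → ℝ} (hG : ∀ n, SuperLinear (G n))
    (hlim : ∀ x, 0 ≤ x → Tendsto (fun n => G n x) atTop (𝓝 (F x))) : SuperLinear F where
  nonneg x hx := ge_of_tendsto' (hlim x hx) fun n => (hG n).nonneg x hx
  zero := tendsto_nhds_unique (hlim 0 le_rfl) (by simp only [(hG _).zero]; exact tendsto_const_nhds)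
  dilate t x ht hx := le_of_tendsto_of_tendsto' ((hlim x hx).const_mul t)
    (hlim _ (mul_nonneg (zero_le_one.trans ht) hx)) fun n => (hG n).dilate t x ht hx

end Gain

/-! ### Sums over singular values -/

section SingularSums

variable {K L N P M : ℕ} {Cy : Matrix (Fin L) (Fin L) ℂ} {Γ : Matrix (Fin K) (Fin L) ℂ}
  {c : ℤ → ℂ} {η : ℝ}

theorem sum_range_sv_eq {m n : Type*} [Fintype m] [DecidableEq m] [Fintype n] [DecidableEq n]
    (H : Matrix m n ℂ) {f : ℝ → ℝ} (hf : f 0 = 0) {a b : ℕ} (ha : H.rank ≤ a) (hb : H.rank ≤ b) :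
    ∑ i ∈ Finset.range a, f (sv H i) = ∑ i ∈ Finset.range b, f (sv H i) := by
  have key : ∀ d, H.rank ≤ d →
      ∑ i ∈ Finset.range d, f (sv H i) = ∑ i ∈ Finset.range H.rank, f (sv H i) := by
    intro d hd
    symm
    refine Finset.sum_subset (Finset.range_mono hd) fun i _ hi => ?_
    rw [(sv_eq_zero_iff_rank_le H i).2 (by simpa using hi), hf]
  rw [key a ha, key b hb]

theorem rank_gammaTilde (hCy : Cy.PosDef) :
    (gammaTilde Cy Γ).rank = (Γ * Cy * Γ.conjTranspose).rank := by
  rw [← Matrix.rank_self_mul_conjTranspose, gammaTilde, Matrix.conjTranspose_mul,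
    conjTranspose_sqrt, Matrix.mul_assoc, ← Matrix.mul_assoc (CFC.sqrt Cy),
    sqrt_mul_sqrt hCy.posSemidef, Matrix.mul_assoc]

theorem rank_gammaTilde_le_K : (gammaTilde Cy Γ).rank ≤ K := by
  simpa using Matrix.rank_le_card_height (gammaTilde Cy Γ)

theorem rank_gammaTilde_le_L : (gammaTilde Cy Γ).rank ≤ L := by
  simpa using Matrix.rank_le_card_width (gammaTilde Cy Γ)

theorem sum_sq_sv_gammaTilde (hCy : Cy.PosDef) :
    ∑ i ∈ Finset.range L, sv (gammaTilde Cy Γ) i ^ 2 = (Γ * Cy * Γ.conjTranspose).trace.re := by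
  obtain ⟨V, hVu, hV⟩ := exists_diagonalization_sv (gammaTilde Cy Γ)
  have hVV : V.conjTranspose * V = 1 := Matrix.mem_unitaryGroup_iff'.1 hVu
  have h1 : Γ * Cy * Γ.conjTranspose = gammaTilde Cy Γ * (gammaTilde Cy Γ).conjTranspose := by
    rw [gammaTilde, Matrix.conjTranspose_mul, conjTranspose_sqrt, Matrix.mul_assoc,
      Matrix.mul_assoc, ← Matrix.mul_assoc (CFC.sqrt Cy), sqrt_mul_sqrt hCy.posSemidef]
  rw [h1, Matrix.trace_mul_comm, hV, Matrix.trace_mul_comm, ← Matrix.mul_assoc, hVV,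
    Matrix.one_mul, Matrix.trace_diagonal, ← Complex.ofReal_sum, Complex.ofReal_re,
    Fin.sum_univ_eq_sum_range (fun i => sv (gammaTilde Cy Γ) i ^ 2) L]

/-- If the quantizers suffice for all nonzero channels, sums over the quantizers are sums over all
pairs of eigenvalues. -/
theorem Design.sum_svKron (D : Design Cy Γ c η M N P) (hCy : Cy.PosDef)
    (hT : (toeplitz c N).PosDef) (hPLN : P ≤ L * N)
    (hrank : (Γ * Cy * Γ.conjTranspose).rank * N ≤ P) {f : ℝ → ℝ} (hf : f 0 = 0) :
    ∑ l ∈ Finset.range P, f (svKron Cy Γ c N l) =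
      ∑ i ∈ Finset.range L, ∑ k : Fin N, f (sv (gammaTilde Cy Γ) i * √(D.eig k)) := by
  have hsv := svKron_eq hT.posSemidef D.V_unitary D.V_spec D.Q_unitary D.Q_spec D.e D.e_sorted
  rw [← rank_gammaTilde hCy] at hrank
  -- Pigeonhole: if the value at `l` were nonzero, the first `l + 1` positions would carry distinct
  -- pairs with first index below the rank, so `l + 1 ≤ rank * N ≤ P ≤ l`.
  have hzero : ∀ l, P ≤ l → l < L * N → svKron Cy Γ c N l = 0 := by
    intro l hl hlt
    by_contra hne
    have hpos : 0 < svKron Cy Γ c N l := lt_of_le_of_ne (sv_nonneg _ _) (Ne.symm hne)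
    have hi : ∀ j : Fin (l + 1),
        ((D.e.symm (Fin.castLE hlt j)).1 : ℕ) < (gammaTilde Cy Γ).rank := by
      intro j
      by_contra! hge
      have h1 := hsv (Fin.castLE hlt j)
      rw [(sv_eq_zero_iff_rank_le _ _).2 hge, zero_mul] at h1
      have h2 : svKron Cy Γ c N l ≤ svKron Cy Γ c N j := sv_antitone _ (by omega)
      simp only [Fin.val_castLE] at h1
      linarith
    have hcard := Fintype.card_le_of_injective
      (fun j : Fin (l + 1) => ((⟨_, hi j⟩, (D.e.symm (Fin.castLE hlt j)).2) :
        Fin (gammaTilde Cy Γ).rank × Fin N)) (by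
        intro a b hab
        simp only [Prod.mk.injEq, Fin.mk.injEq] at hab
        have h3 : D.e.symm (Fin.castLE hlt a) = D.e.symm (Fin.castLE hlt b) :=
          Prod.ext (Fin.ext hab.1) hab.2
        exact Fin.castLE_injective hlt (D.e.symm.injective h3))
    simp only [Fintype.card_fin, Fintype.card_prod] at hcard
    omega
  calc ∑ l ∈ Finset.range P, f (svKron Cy Γ c N l)
      = ∑ l ∈ Finset.range (L * N), f (svKron Cy Γ c N l) := by
        refine Finset.sum_subset (Finset.range_mono hPLN) fun l hl hl' => ?_
        rw [hzero l (by simpa using hl') (by simpa using hl), hf]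
    _ = ∑ l : Fin (L * N), f (sv (gammaTilde Cy Γ) (D.e.symm l).1 * √(D.eig (D.e.symm l).2)) := by
        rw [← Fin.sum_univ_eq_sum_range (fun l => f (svKron Cy Γ c N l))]
        exact Finset.sum_congr rfl fun l _ => by rw [hsv]
    _ = ∑ p : Fin L × Fin N, f (sv (gammaTilde Cy Γ) p.1 * √(D.eig p.2)) :=
        Equiv.sum_comp D.e.symm fun p : Fin L × Fin N =>
          f (sv (gammaTilde Cy Γ) p.1 * √(D.eig p.2))
    _ = _ := by
        rw [Fintype.sum_prod_type, ← Fin.sum_univ_eq_sum_range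
          (fun i => ∑ k : Fin N, f (sv (gammaTilde Cy Γ) i * √(D.eig k)))]

theorem toeplitz_eq_one (hc : ∀ τ : ℤ, c τ = if τ = 0 then 1 else 0) : toeplitz c N = 1 := by
  ext i j
  simp [toeplitz, hc, Matrix.one_apply, sub_eq_zero, Fin.ext_iff]

/-- Here Σ = I, so each φ_i occurs `N` times. The ordering `finProdFinEquiv` places these copies in
consecutive blocks, and position `l` lies in block `l / N`. -/
theorem svKron_eq_of_white (hc : ∀ τ : ℤ, c τ = if τ = 0 then 1 else 0) {l : ℕ}
    (hl : l < L * N) : svKron Cy Γ c N l = sv (gammaTilde Cy Γ) (l / N) := by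
  obtain ⟨V, hVu, hV⟩ := exists_diagonalization_sv (gammaTilde Cy Γ)
  have h := svKron_eq (c := c) (N := N) (Q := 1) (eig := fun _ => 1)
    (by rw [toeplitz_eq_one hc]; exact Matrix.PosSemidef.one) hVu hV (one_mem _)
    (by rw [toeplitz_eq_one hc]; simp) finProdFinEquiv
    (fun a b hab => by
      simp only [Real.sqrt_one, mul_one]
      exact sv_antitone _ (Nat.div_le_div_right hab)) ⟨l, hl⟩
  simpa using h

theorem sum_range_div {f : ℕ → ℝ} {N q R : ℕ} (hR : R < N) :
    ∑ l ∈ Finset.range (N * q + R), f (l / N) = N * ∑ i ∈ Finset.range q, f i + R * f q := by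
  have hN : 0 < N := by omega
  have hblock : ∀ q R : ℕ, R ≤ N → ∑ j ∈ Finset.range R, f ((N * q + j) / N) = R * f q := by
    intro q R hR
    rw [Finset.sum_congr rfl fun j hj => show f ((N * q + j) / N) = f q by
      have hj' : j < N := (Finset.mem_range.1 hj).trans_le hR
      rw [Nat.mul_add_div hN, Nat.div_eq_of_lt hj', add_zero]]
    simp
  rw [Finset.sum_range_add, hblock q R hR.le]
  congr 1
  induction q with
  | zero => simp
  | succ q ih =>
    rw [Nat.mul_succ, Finset.sum_range_add, ih, hblock q N le_rfl, Finset.sum_range_succ]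
    ring

/-- The `P` leading positions fill `P / N` whole blocks and `P % N` places of the next; the
coefficient, a real quotient minus a natural one, is that remainder divided by `N`. -/
theorem sum_svKron_of_white (hc : ∀ τ : ℤ, c τ = if τ = 0 then 1 else 0) (hN : 1 ≤ N)
    (hPLN : P ≤ L * N) (f : ℝ → ℝ) :
    (∑ l ∈ Finset.range P, f (svKron Cy Γ c N l)) / N =
      ∑ i ∈ Finset.range (P / N), f (sv (gammaTilde Cy Γ) i) +
        ((P : ℝ) / N - (P / N : ℕ)) * f (sv (gammaTilde Cy Γ) (P / N)) := by
  have hN0 : (N : ℝ) ≠ 0 := by exact_mod_cast (by omega : N ≠ 0)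
  have h1 : ∑ l ∈ Finset.range P, f (svKron Cy Γ c N l) =
      ∑ l ∈ Finset.range (N * (P / N) + P % N), f (sv (gammaTilde Cy Γ) (l / N)) := by
    rw [Nat.div_add_mod]
    refine Finset.sum_congr rfl fun l hl => ?_
    rw [svKron_eq_of_white hc ((Finset.mem_range.1 hl).trans_le hPLN)]
  have h2 : ((P % N : ℕ) : ℝ) = P - N * (P / N : ℕ) := by
    have := Nat.div_add_mod P N
    have h3 : ((N * (P / N) + P % N : ℕ) : ℝ) = P := by rw [this]
    push_cast at h3 ⊢
    linarith
  rw [h1, sum_range_div (f := fun i => f (sv (gammaTilde Cy Γ) i)) (Nat.mod_lt _ (by omega)), h2]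
  field_simp

end SingularSums

/-! ### Asymptotic performance -/

section Limits

variable {Ω : Type*} [MeasurableSpace Ω] {μ : Measure Ω} [IsProbabilityMeasure μ] {K L : ℕ}
  {g : ℕ → Ω → Fin K → ℂ} {y : ℕ → Ω → Fin L → ℂ} {Cg : Matrix (Fin K) (Fin K) ℂ}
  {Cy : Matrix (Fin L) (Fin L) ℂ} {Γ : Matrix (Fin K) (Fin L) ℂ} {c : ℤ → ℂ}
  {M : ℕ} {η : ℝ}

theorem SignalModel.avgMSE_design_eq (h : SignalModel μ g y Cg Cy Γ c) (hCy : Cy.PosDef)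
    {N P : ℕ} (hT : (toeplitz c N).PosDef) (hη : 0 < η) (hM : η < √(3 / 2) * M) (hN : 1 ≤ N)
    (hP : 1 ≤ P) (hPLN : P ≤ L * N) (hr : 0 < ratio L N P) (D : Design Cy Γ c η M N P)
    {q : Ω → Fin P → ℂ} (hq : IsSystemOutput μ g y η M D.analog q) :
    avgMSE μ (stack g N) D.dig q = mmseValue Cg Cy Γ + (1 / (K : ℝ)) *
      (∑ i ∈ Finset.range L, sv (gammaTilde Cy Γ) i ^ 2 -
        (∑ l ∈ Finset.range P, recovered D.ζ (svKron Cy Γ c N l)) / N) := by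
  have hN0 : (N : ℝ) ≠ 0 := by exact_mod_cast (by omega : N ≠ 0)
  have htr : (Cg ⊗ₖ toeplitz c N).trace.re = N * Cg.trace.re := by
    have h1 : (toeplitz c N).trace = N := by simp [Matrix.trace, toeplitz, h.c_zero]
    rw [Matrix.trace_kronecker, h1]
    simp [mul_comm]
  rw [h.avgMSE_design hCy hT hη hM hP hPLN hr D hq, htr, sum_sq_sv_gammaTilde hCy, mmseValue,
    Matrix.trace_sub, Complex.sub_re]
  change _ * (_ - ∑ l ∈ Finset.range P, recovered D.ζ (svKron Cy Γ c N l)) = _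
  rw [one_div_mul_eq_div, one_div_mul_eq_div, one_div_mul_eq_div]
  rcases eq_or_ne (K : ℝ) 0 with hK | hK
  · simp [hK]
  · field_simp
    ring

/-- Substituting `P = r L N` exposes the average over `N`, to which the limit theorems apply. -/
theorem level_factor {N P : ℕ} (hL : 0 < L) (hN : 1 ≤ N) (s : ℝ) :
    4 * kappa η M / (3 * (M : ℝ) ^ 2 * P) * s =
      4 * kappa η M / (3 * (M : ℝ) ^ 2 * (ratio L N P * L)) * (s / N) := by
  have hN0 : (N : ℝ) ≠ 0 := by exact_mod_cast (by omega : N ≠ 0)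
  have hL0 : (L : ℝ) ≠ 0 := by exact_mod_cast (by omega : L ≠ 0)
  have h1 : ratio L N P * L = P / N := by unfold ratio; field_simp
  rw [h1]
  field_simp

theorem tendsto_level_factor {ρ : ℕ → ℝ} {r : ℝ} (hL : 0 < L) (hM : (0 : ℝ) < M) (hr : 0 < r)
    (hρ : Tendsto ρ atTop (𝓝 r)) :
    Tendsto (fun n => 4 * kappa η M / (3 * (M : ℝ) ^ 2 * (ρ n * L))) atTop
      (𝓝 (4 * kappa η M / (3 * (M : ℝ) ^ 2 * (r * L)))) := by
  have hL0 : (0 : ℝ) < L := by exact_mod_cast hL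
  exact tendsto_const_nhds.div ((hρ.mul_const _).const_mul _) (by positivity)

/-- The asymptotic performance if the quantizers suffice for all nonzero channels. -/
theorem SignalModel.asymptotics_of_rank_le (h : SignalModel μ g y Cg Cy Γ c) (hCy : Cy.PosDef)
    (hΓ : Γ ≠ 0) (hη : 0 < η) (hM : η < √(3 / 2) * M) {N P : ℕ → ℕ} {Pq : ℕ} {r : ℝ}
    (hN : Tendsto N atTop atTop) (hN1 : ∀ n, 1 ≤ N n) (hP1 : ∀ n, 1 ≤ P n)
    (hPLN : ∀ n, P n ≤ L * N n) (hPq : ∀ n, P n / N n = Pq) (hr : 0 < r)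
    (hratio : Tendsto (fun n => ratio L (N n) (P n)) atTop (𝓝 r))
    (D : ∀ n, Design Cy Γ c η M (N n) (P n)) (q : ∀ n, Ω → Fin (P n) → ℂ)
    (hq : ∀ n, IsSystemOutput μ g y η M (D n).analog (q n))
    (hrank : (Γ * Cy * Γ.conjTranspose).rank ≤ Pq) :
    ∃ ζ : ℝ, 0 < ζ ∧ Tendsto (fun n => (D n).ζ) atTop (𝓝 ζ) ∧
      4 * kappa η M / (3 * (M : ℝ) ^ 2 * (r * L)) * (periodMean fun w => ∑ i ∈ Finset.range K,
        wf (ζ * (sv (gammaTilde Cy Γ) i * √(psd c w)))) = 1 ∧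
      Tendsto (fun n => avgMSE μ (stack g (N n)) (D n).dig (q n)) atTop
        (𝓝 (mmseValue Cg Cy Γ + periodMean fun w => (1 / (K : ℝ)) * ∑ i ∈ Finset.range K,
          sv (gammaTilde Cy Γ) i ^ 2 * psd c w /
            (wf (ζ * (sv (gammaTilde Cy Γ) i * √(psd c w))) + 1))) := by
  have hL := pos_of_gamma_ne_zero hΓ
  have hL0 : (0 : ℝ) < L := by exact_mod_cast hL
  have hκ := kappa_pos hη hM
  have hM0 := resolution_pos_of_lt hη hM
  have hT := h.posDef_toeplitz hCy hL
  have hsymm := h.conj_symm hCy hL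
  have hcpsd := continuous_psd h.summable_c
  have hρ := fun n => ratio_pos hL (hN1 n) (hP1 n)
  set φ : ℕ → ℝ := sv (gammaTilde Cy Γ) with hφ
  have hφ0 : ∀ i, 0 ≤ φ i := sv_nonneg _
  have heig : ∀ n, IsToeplitzEig c (N n) (D n).eig := fun n =>
    ⟨(D n).Q, (D n).Q_unitary, (D n).Q_spec⟩
  have hrankP : ∀ n, (Γ * Cy * Γ.conjTranspose).rank * N n ≤ P n := fun n => by
    calc _ ≤ Pq * N n := Nat.mul_le_mul_right _ hrank
      _ ≤ P n := by rw [← hPq n]; exact Nat.div_mul_le_self _ _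
  have hsum : ∀ (n : ℕ) (f : ℝ → ℝ), f 0 = 0 →
      (∑ l ∈ Finset.range (P n), f (svKron Cy Γ c (N n) l)) / N n =
      ∑ i ∈ Finset.range L, (∑ k : Fin (N n), f (φ i * √((D n).eig k))) / N n := fun n f hf => by
    rw [(D n).sum_svKron hCy (hT _) (hPLN n) (hrankP n) hf, Finset.sum_div]
  have hszego : ∀ f : ℝ → ℝ, Continuous f → ∀ i, Tendsto (fun n =>
      (∑ k : Fin (N n), f (φ i * √((D n).eig k))) / N n) atTop
      (𝓝 (periodMean fun w => f (φ i * √(psd c w)))) := fun f hf i =>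
    tendsto_eig_continuous h.summable_c hsymm hN heig (f := fun x => f (φ i * √x)) (by fun_prop)
  have hKL : ∀ f : ℝ → ℝ, f 0 = 0 →
      ∑ i ∈ Finset.range L, f (φ i) = ∑ i ∈ Finset.range K, f (φ i) := fun f hf =>
    sum_range_sv_eq _ hf rank_gammaTilde_le_L rank_gammaTilde_le_K
  -- the level equations
  set G : ℕ → ℝ → ℝ := fun n ζ => 4 * kappa η M / (3 * (M : ℝ) ^ 2 * P n) *
    ∑ l ∈ Finset.range (P n), wf (ζ * svKron Cy Γ c (N n) l) with hG
  set F : ℝ → ℝ := fun ζ => 4 * kappa η M / (3 * (M : ℝ) ^ 2 * (r * L)) *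
    ∑ i ∈ Finset.range L, periodMean fun w => wf (ζ * (φ i * √(psd c w))) with hF
  have hGs : ∀ n, SuperLinear (G n) := fun n =>
    (SuperLinear.sum _ fun l _ => superLinear_wf (sv_nonneg _ l)).const_mul (by positivity)
  have hGF : ∀ x, 0 ≤ x → Tendsto (fun n => G n x) atTop (𝓝 (F x)) := by
    intro x _
    have h1 : ∀ n, G n x = 4 * kappa η M / (3 * (M : ℝ) ^ 2 * (ratio L (N n) (P n) * L)) *
        ∑ i ∈ Finset.range L, (∑ k : Fin (N n), wf (x * (φ i * √((D n).eig k)))) / N n := by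
      intro n
      rw [← hsum n (fun σ => wf (x * σ)) (by simp [wf_zero]), ← level_factor hL (hN1 n)]
    simp only [h1]
    exact (tendsto_level_factor hL hM0 hr hratio).mul (tendsto_finsetSum _ fun i _ =>
      hszego (fun σ => wf (x * σ)) (continuous_wf.comp (continuous_const.mul continuous_id)) i)
  have hFs : SuperLinear F := SuperLinear.of_tendsto hGs hGF
  have hFc : Continuous F := by
    refine continuous_const.mul (continuous_finsetSum _ fun i _ => continuous_const.mul ?_)
    refine intervalIntegral.continuous_parametric_intervalIntegral_of_continuous' ?_ _ _
    exact continuous_wf.comp (by fun_prop)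
  have hFpos : ∃ x, 0 < x ∧ 0 < F x := by
    obtain ⟨w, hw, hpos⟩ := exists_psd_pos h.summable_c hsymm h.c_zero
    have hφpos : 0 < φ 0 := sv_zero_pos (gammaTilde_ne_zero hCy hΓ)
    have hpr : 0 < φ 0 * √(psd c w) := mul_pos hφpos (Real.sqrt_pos.2 hpos)
    -- This level gives the strongest channel the value `wf 2 = 1` at a frequency where the spectral
    -- density is positive.
    refine ⟨2 / (φ 0 * √(psd c w)), by positivity, mul_pos (by positivity) ?_⟩
    refine Finset.sum_pos' (fun i _ => ?_) ⟨0, Finset.mem_range.2 hL, ?_⟩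
    · exact mul_nonneg (by positivity)
        (intervalIntegral.integral_nonneg Real.two_pi_pos.le fun _ _ => wf_nonneg _)
    · refine periodMean_pos (continuous_wf.comp (by fun_prop)) (fun _ _ => wf_nonneg _)
        ⟨w, Set.Ioo_subset_Icc_self hw, ?_⟩
      rw [div_mul_cancel₀ _ hpr.ne', wf_of_ge (by norm_num)]
      norm_num
  obtain ⟨ζ, hζ, hFζ⟩ := hFs.exists_level hFc hFpos
  have hlim : Tendsto (fun n => (D n).ζ) atTop (𝓝 ζ) :=
    hFs.tendsto_level hGs hGF hζ hFζ (fun n => (D n).level.1) fun n => (D n).level.2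
  refine ⟨ζ, hζ, hlim, ?_, ?_⟩
  · rw [← hFζ, hF]
    simp only
    congr 1
    rw [← periodMean_sum _ (f := fun i w => wf (ζ * (φ i * √(psd c w))))
      fun i _ => continuous_wf.comp (by fun_prop)]
    congr 1
    funext w
    exact (hKL (fun σ => wf (ζ * (σ * √(psd c w)))) (by simp [wf_zero])).symm
  · -- the mean squared error
    have hrec0 : ∀ ζ, recovered ζ 0 = 0 := recovered_zero
    have hrecc : ∀ ζ, Continuous (recovered ζ) := fun ζ =>
      continuous_recovered.comp (continuous_const.prodMk continuous_id)
    set C := φ 0 * √(∑' τ, ‖c τ‖) with hC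
    have hbound : ∀ i n (k : Fin (N n)), φ i * √((D n).eig k) ≤ C := fun i n k =>
      mul_le_mul (sv_antitone _ (Nat.zero_le i)) (Real.sqrt_le_sqrt ((le_abs_self _).trans
        (abs_eig_toeplitz_le h.summable_c (D n).Q_unitary (D n).Q_spec k)))
        (Real.sqrt_nonneg _) (hφ0 0)
    have hfix : ∀ i, Tendsto (fun n =>
        (∑ k : Fin (N n), recovered (D n).ζ (φ i * √((D n).eig k))) / N n) atTop
        (𝓝 (periodMean fun w => recovered ζ (φ i * √(psd c w)))) := by
      intro i
      -- Szegő's theorem needs a fixed function, so the limit level is used first; the varying level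
      -- changes the average by at most `C ^ 3 * |ζ - (D n).ζ|`.
      refine (tendsto_iff_of_dist ?_).1 (hszego (recovered ζ) (hrecc ζ) i)
      have hz : Tendsto (fun n => C ^ 3 * |ζ - (D n).ζ|) atTop (𝓝 0) := by
        have h1 := ((tendsto_const_nhds (x := ζ)).sub hlim).abs.const_mul (C ^ 3)
        simpa using h1
      refine squeeze_zero (fun n => dist_nonneg) (fun n => ?_) hz
      have hNpos : (0 : ℝ) < N n := by exact_mod_cast hN1 n
      rw [Real.dist_eq, ← sub_div, ← Finset.sum_sub_distrib, abs_div, Nat.abs_cast,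
        div_le_iff₀ hNpos]
      refine (Finset.abs_sum_le_sum_abs _ _).trans ?_
      calc _ ≤ ∑ _k : Fin (N n), C ^ 3 * |ζ - (D n).ζ| := Finset.sum_le_sum fun k _ =>
            abs_recovered_sub_le (mul_nonneg (hφ0 i) (Real.sqrt_nonneg _)) (hbound i n k)
        _ = _ := by simp [mul_comm]
    have hmse : ∀ n, avgMSE μ (stack g (N n)) (D n).dig (q n) = mmseValue Cg Cy Γ +
        (1 / (K : ℝ)) * (∑ i ∈ Finset.range L, φ i ^ 2 - ∑ i ∈ Finset.range L,
          (∑ k : Fin (N n), recovered (D n).ζ (φ i * √((D n).eig k))) / N n) := fun n => by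
      rw [h.avgMSE_design_eq hCy (hT _) hη hM (hN1 n) (hP1 n) (hPLN n) (hρ n) (D n) (hq n),
        hsum n _ (hrec0 _)]
    simp only [hmse]
    have hlimit : periodMean (fun w => (1 / (K : ℝ)) * ∑ i ∈ Finset.range K,
        φ i ^ 2 * psd c w / (wf (ζ * (φ i * √(psd c w))) + 1)) = (1 / (K : ℝ)) *
        (∑ i ∈ Finset.range L, φ i ^ 2 - ∑ i ∈ Finset.range L,
          periodMean fun w => recovered ζ (φ i * √(psd c w))) := by
      rw [periodMean_const_mul, ← Finset.sum_sub_distrib]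
      congr 1
      have h1 : ∀ i w, φ i ^ 2 * psd c w - recovered ζ (φ i * √(psd c w)) =
          φ i ^ 2 * psd c w / (wf (ζ * (φ i * √(psd c w))) + 1) := by
        intro i w
        -- Nonnegativity is available only on one period, but the identity holds for negative values
        -- too: the square root is then 0, so nothing is recovered and the denominator is 1.
        rcases le_total 0 (psd c w) with hs | hs
        · have := sub_recovered ζ (φ i * √(psd c w))
          rwa [mul_pow, Real.sq_sqrt hs] at this
        · rw [Real.sqrt_eq_zero_of_nonpos hs]
          simp [recovered_zero, wf_zero]
      have hc1 : ∀ i, Continuous fun w => φ i ^ 2 * psd c w := fun i =>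
        continuous_const.mul hcpsd
      have hc2 : ∀ i, Continuous fun w => recovered ζ (φ i * √(psd c w)) := fun i =>
        (hrecc ζ).comp (by fun_prop)
      -- Since the spectral density has mean 1, `φ i ^ 2` can be moved under the mean as `φ i ^ 2 *
      -- psd c w`.
      have h2 : ∀ i, φ i ^ 2 - periodMean (fun w => recovered ζ (φ i * √(psd c w))) =
          periodMean fun w => φ i ^ 2 * psd c w - recovered ζ (φ i * √(psd c w)) := by
        intro i
        rw [periodMean_sub (hc1 i) (hc2 i), periodMean_const_mul,
          periodMean_psd h.summable_c hsymm h.c_zero, mul_one]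
      rw [Finset.sum_congr rfl fun i _ => h2 i, ← periodMean_sum _
        (f := fun i w => φ i ^ 2 * psd c w - recovered ζ (φ i * √(psd c w)))
        fun i _ => (hc1 i).sub (hc2 i)]
      congr 1
      funext w
      simp only [h1]
      exact (hKL (fun σ => σ ^ 2 * psd c w / (wf (ζ * (σ * √(psd c w))) + 1)) (by simp)).symm
    rw [hlimit]
    exact tendsto_const_nhds.add ((tendsto_const_nhds.sub
      (tendsto_finsetSum _ fun i _ => hfix i)).const_mul _)

/-- The asymptotic performance for temporally white signals. -/
theorem SignalModel.asymptotics_of_white (h : SignalModel μ g y Cg Cy Γ c) (hCy : Cy.PosDef)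
    (hΓ : Γ ≠ 0) (hη : 0 < η) (hM : η < √(3 / 2) * M) {N P : ℕ → ℕ} {Pq : ℕ} {r : ℝ}
    (hN1 : ∀ n, 1 ≤ N n) (hP1 : ∀ n, 1 ≤ P n)
    (hPLN : ∀ n, P n ≤ L * N n) (hPq : ∀ n, P n / N n = Pq) (hr : 0 < r)
    (hratio : Tendsto (fun n => ratio L (N n) (P n)) atTop (𝓝 r))
    (D : ∀ n, Design Cy Γ c η M (N n) (P n)) (q : ∀ n, Ω → Fin (P n) → ℂ)
    (hq : ∀ n, IsSystemOutput μ g y η M (D n).analog (q n))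
    (hc : ∀ τ : ℤ, c τ = if τ = 0 then 1 else 0) :
    ∃ ζ : ℝ, 0 < ζ ∧ Tendsto (fun n => (D n).ζ) atTop (𝓝 ζ) ∧
      4 * kappa η M / (3 * (M : ℝ) ^ 2 * (r * L)) *
        (∑ i ∈ Finset.range Pq, wf (ζ * sv (gammaTilde Cy Γ) i) +
          (r * L - Pq) * wf (ζ * sv (gammaTilde Cy Γ) Pq)) = 1 ∧
      Tendsto (fun n => avgMSE μ (stack g (N n)) (D n).dig (q n)) atTop
        (𝓝 (mmseValue Cg Cy Γ + (1 / (K : ℝ)) * ∑ i ∈ Finset.range (min K Pq),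
          sv (gammaTilde Cy Γ) i ^ 2 / (wf (ζ * sv (gammaTilde Cy Γ) i) + 1) +
          if Pq < K then (1 / (K : ℝ)) * (∑ i ∈ Finset.Ico Pq K, sv (gammaTilde Cy Γ) i ^ 2 -
            (r * L - Pq) * (sv (gammaTilde Cy Γ) Pq ^ 2 * wf (ζ * sv (gammaTilde Cy Γ) Pq) /
              (wf (ζ * sv (gammaTilde Cy Γ) Pq) + 1))) else 0)) := by
  have hL := pos_of_gamma_ne_zero hΓ
  have hL0 : (0 : ℝ) < L := by exact_mod_cast hL
  have hκ := kappa_pos hη hM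
  have hM0 := resolution_pos_of_lt hη hM
  have hT := h.posDef_toeplitz hCy hL
  have hρ := fun n => ratio_pos hL (hN1 n) (hP1 n)
  set φ : ℕ → ℝ := sv (gammaTilde Cy Γ) with hφ
  have hφ0 : ∀ i, 0 ≤ φ i := sv_nonneg _
  have hφpos : 0 < φ 0 := sv_zero_pos (gammaTilde_ne_zero hCy hΓ)
  have hPN : ∀ n, (P n : ℝ) / N n = ratio L (N n) (P n) * L := fun n => by
    have hN0 : (N n : ℝ) ≠ 0 := by exact_mod_cast (by have := hN1 n; omega : N n ≠ 0)
    unfold ratio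
    field_simp
  have hsum : ∀ (n : ℕ) (f : ℝ → ℝ),
      (∑ l ∈ Finset.range (P n), f (svKron Cy Γ c (N n) l)) / N n =
      ∑ i ∈ Finset.range Pq, f (φ i) + (ratio L (N n) (P n) * L - Pq) * f (φ Pq) := fun n f => by
    rw [sum_svKron_of_white hc (hN1 n) (hPLN n) f, hPq n, hPN n]
  have hfrac : Tendsto (fun n => ratio L (N n) (P n) * L - Pq) atTop (𝓝 (r * L - Pq)) :=
    (hratio.mul_const _).sub_const _
  have hfrac0 : 0 ≤ r * L - Pq := by
    refine ge_of_tendsto' hfrac fun n => ?_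
    have hN0 : (0 : ℝ) < N n := by exact_mod_cast hN1 n
    rw [← hPN, sub_nonneg, le_div_iff₀ hN0, ← hPq n]
    exact_mod_cast Nat.div_mul_le_self _ _
  set G : ℕ → ℝ → ℝ := fun n ζ => 4 * kappa η M / (3 * (M : ℝ) ^ 2 * P n) *
    ∑ l ∈ Finset.range (P n), wf (ζ * svKron Cy Γ c (N n) l) with hG
  set F : ℝ → ℝ := fun ζ => 4 * kappa η M / (3 * (M : ℝ) ^ 2 * (r * L)) *
    (∑ i ∈ Finset.range Pq, wf (ζ * φ i) + (r * L - Pq) * wf (ζ * φ Pq)) with hF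
  have hGs : ∀ n, SuperLinear (G n) := fun n =>
    (SuperLinear.sum _ fun l _ => superLinear_wf (sv_nonneg _ l)).const_mul (by positivity)
  have hFs : SuperLinear F :=
    ((SuperLinear.sum _ fun i _ => superLinear_wf (hφ0 i)).add
      ((superLinear_wf (hφ0 Pq)).const_mul hfrac0)).const_mul (by positivity)
  have hGF : ∀ x, 0 ≤ x → Tendsto (fun n => G n x) atTop (𝓝 (F x)) := by
    intro x _
    have h1 : ∀ n, G n x = 4 * kappa η M / (3 * (M : ℝ) ^ 2 * (ratio L (N n) (P n) * L)) *
        (∑ i ∈ Finset.range Pq, wf (x * φ i) +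
          (ratio L (N n) (P n) * L - Pq) * wf (x * φ Pq)) := fun n => by
      rw [← hsum n fun σ => wf (x * σ), ← level_factor hL (hN1 n)]
    simp only [h1]
    exact (tendsto_level_factor hL hM0 hr hratio).mul
      (tendsto_const_nhds.add (hfrac.mul_const _))
  have hwc : ∀ a : ℝ, Continuous fun ζ => wf (ζ * a) := fun a =>
    continuous_wf.comp (continuous_id.mul continuous_const)
  have hFc : Continuous F := continuous_const.mul
    ((continuous_finsetSum _ fun i _ => hwc _).add (continuous_const.mul (hwc _)))
  have hFpos : ∃ x, 0 < x ∧ 0 < F x := by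
    have hw : 0 < wf (2 / φ 0 * φ 0) := by
      rw [div_mul_cancel₀ _ hφpos.ne', wf_of_ge (by norm_num)]
      norm_num
    refine ⟨2 / φ 0, by positivity, mul_pos (by positivity) ?_⟩
    -- If `Pq = 0`, only the partial block of channel 0 is present, with positive weight `r * L`;
    -- otherwise channel 0 is a whole block.
    rcases Nat.eq_zero_or_pos Pq with h0 | h0
    · subst h0
      simp only [Finset.range_zero, Finset.sum_empty, Nat.cast_zero, sub_zero, zero_add]
      positivity
    · exact add_pos_of_pos_of_nonneg (Finset.sum_pos' (fun i _ => wf_nonneg _)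
        ⟨0, Finset.mem_range.2 h0, hw⟩) (mul_nonneg hfrac0 (wf_nonneg _))
  obtain ⟨ζ, hζ, hFζ⟩ := hFs.exists_level hFc hFpos
  have hlim : Tendsto (fun n => (D n).ζ) atTop (𝓝 ζ) :=
    hFs.tendsto_level hGs hGF hζ hFζ (fun n => (D n).level.1) fun n => (D n).level.2
  refine ⟨ζ, hζ, hlim, hFζ, ?_⟩
  have hrec : ∀ σ, Tendsto (fun n => recovered (D n).ζ σ) atTop (𝓝 (recovered ζ σ)) := fun σ =>
    ((continuous_recovered.comp (continuous_id.prodMk continuous_const)).tendsto ζ).comp hlim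
  have hmse : ∀ n, avgMSE μ (stack g (N n)) (D n).dig (q n) = mmseValue Cg Cy Γ +
      (1 / (K : ℝ)) * (∑ i ∈ Finset.range L, φ i ^ 2 -
        (∑ i ∈ Finset.range Pq, recovered (D n).ζ (φ i) +
          (ratio L (N n) (P n) * L - Pq) * recovered (D n).ζ (φ Pq))) := fun n => by
    rw [h.avgMSE_design_eq hCy (hT _) hη hM (hN1 n) (hP1 n) (hPLN n) (hρ n) (D n) (hq n), hsum n]
  simp only [hmse]
  rw [add_assoc]
  refine tendsto_const_nhds.add ?_
  have hlim2 := (tendsto_const_nhds (x := ∑ i ∈ Finset.range L, φ i ^ 2)).sub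
    ((tendsto_finsetSum (Finset.range Pq) fun i _ => hrec (φ i)).add (hfrac.mul (hrec (φ Pq))))
  refine Eq.mp (congrArg (fun a => Tendsto _ atTop (𝓝 a)) ?_) (hlim2.const_mul (1 / (K : ℝ)))
  have hL2 : ∑ i ∈ Finset.range L, φ i ^ 2 = ∑ i ∈ Finset.range K, φ i ^ 2 :=
    sum_range_sv_eq _ (f := fun σ => σ ^ 2) (by simp) rank_gammaTilde_le_L rank_gammaTilde_le_K
  rw [hL2]
  simp only [← sub_recovered]
  split_ifs with hlt
  · rw [min_eq_right hlt.le, ← Finset.sum_range_add_sum_Ico _ hlt.le, Finset.sum_sub_distrib]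
    simp only [recovered]
    ring
  · have hle : K ≤ Pq := not_lt.1 hlt
    have hz : φ Pq = 0 := (sv_eq_zero_iff_rank_le _ _).2 (rank_gammaTilde_le_K.trans hle)
    have hK : ∑ i ∈ Finset.range Pq, recovered ζ (φ i) =
        ∑ i ∈ Finset.range K, recovered ζ (φ i) :=
      sum_range_sv_eq _ (recovered_zero ζ) (rank_gammaTilde_le_K.trans hle) rank_gammaTilde_le_K
    rw [min_eq_left hle, hz, recovered_zero, hK, Finset.sum_sub_distrib]
    ring

end Limits

/-! ### The error of a uniform quantizer -/

section Quantizer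

theorem measurable_uniformQuantizer (M : ℕ) (γ : ℝ) : Measurable (uniformQuantizer M γ) := by
  unfold uniformQuantizer
  have hsign : Measurable fun a : ℝ => ((SignType.sign a : SignType) : ℝ) := by
    have : (fun a : ℝ => ((SignType.sign a : SignType) : ℝ)) =
        fun a => if 0 < a then 1 else if a < 0 then -1 else 0 := by
      funext a
      rw [sign_apply]
      split_ifs <;> simp
    rw [this]
    exact Measurable.ite measurableSet_Ioi measurable_const
      (Measurable.ite measurableSet_Iio measurable_const measurable_const)
  refine Measurable.ite (measurableSet_lt measurable_const continuous_abs.measurable)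
    (hsign.mul_const _) (measurable_const.add (measurable_const.mul ?_))
  have hk : Measurable fun a : ℝ => ⌊(a + γ) / (2 * γ / M)⌋₊ :=
    Nat.measurable_floor.comp ((measurable_id.add_const γ).div_const _)
  exact (measurable_from_nat (f := fun k : ℕ => ((min k (M - 1) : ℕ) : ℝ) + 1 / 2)).comp hk

theorem abs_uniformQuantizer_le {M : ℕ} {γ : ℝ} (hM : 0 < M) (hγ : 0 < γ) (a : ℝ) :
    |uniformQuantizer M γ a| ≤ γ := by
  have hM1 : (1 : ℝ) ≤ M := by exact_mod_cast hM
  have hΔ : 0 < 2 * γ / M := by positivity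
  have hΔM : 2 * γ / M * M = 2 * γ := div_mul_cancel₀ _ (by positivity)
  have hΔle : 2 * γ / M ≤ 2 * γ := div_le_self (by positivity) hM1
  unfold uniformQuantizer
  split_ifs with h
  · have h1 : |((SignType.sign a : SignType) : ℝ)| ≤ 1 := by
      rcases SignType.sign a with _ | _ | _ <;> simp
    rw [abs_mul, abs_of_nonneg (show 0 ≤ γ - 2 * γ / M / 2 by linarith)]
    nlinarith [abs_nonneg ((SignType.sign a : SignType) : ℝ)]
  · set k := min ⌊(a + γ) / (2 * γ / M)⌋₊ (M - 1) with hk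
    have hkM : (k : ℝ) + 1 ≤ M := by
      have : k + 1 ≤ M := by omega
      exact_mod_cast this
    have hk0 : (0 : ℝ) ≤ k := Nat.cast_nonneg _
    rw [abs_le]
    constructor <;> nlinarith

/-- Inside the support, the error of the dithered quantizer is the dither plus a centred
sawtooth. -/
theorem uniformQuantizer_add_sub {M : ℕ} {γ a u : ℝ} (hM : 0 < M) (hγ : 0 < γ)
    (ha : |a| + 2 * γ / M / 2 ≤ γ) (hu : u ∈ Set.Ioo (-(2 * γ / M / 2)) (2 * γ / M / 2)) :
    uniformQuantizer M γ (a + u) - a =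
      u + 2 * γ / M * (1 / 2 - Int.fract (u / (2 * γ / M) + (a + γ) / (2 * γ / M))) := by
  have hM0 : (0 : ℝ) < M := by exact_mod_cast hM
  have hΔ : 0 < 2 * γ / M := by positivity
  have hΔM : M * (2 * γ / M) = 2 * γ := mul_div_cancel₀ _ hM0.ne'
  set Δ := 2 * γ / M with hΔdef
  have h1 := abs_le.1 (show |a| ≤ γ - Δ / 2 by linarith)
  have hlo : 0 < a + u + γ := by linarith [hu.1]
  have hhi : a + u + γ < 2 * γ := by linarith [hu.2]
  have hw : u / Δ + (a + γ) / Δ = (a + u + γ) / Δ := by rw [← add_div]; ring_nf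
  have hw0 : 0 ≤ (a + u + γ) / Δ := by positivity
  -- The open range of `u` excludes the right end of the support, where the floor would be `M` and
  -- the cap at `M - 1` would act.
  have hwM : ⌊(a + u + γ) / Δ⌋₊ < M := by
    rw [Nat.floor_lt hw0, div_lt_iff₀ hΔ, hΔM]
    exact hhi
  have hnot : ¬ γ < |a + u| := not_lt.2 (abs_le.2 ⟨by linarith, by linarith⟩)
  have hwΔ : Δ * ((a + u + γ) / Δ) = a + u + γ := mul_div_cancel₀ _ hΔ.ne'
  rw [uniformQuantizer, if_neg hnot, ← hΔdef, min_eq_left (by omega), hw,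
    natCast_floor_eq_intCast_floor hw0, ← Int.self_sub_fract]
  linear_combination hwΔ

theorem integral_fract (t : ℝ) : ∫ x in t..t + 1, Int.fract x = 1 / 2 := by
  have hper : Function.Periodic (Int.fract : ℝ → ℝ) 1 := Int.fract_periodic ℝ
  rw [hper.intervalIntegral_add_eq t 0, zero_add]
  have : ∫ x in (0 : ℝ)..1, Int.fract x = ∫ x in (0 : ℝ)..1, x := by
    rw [intervalIntegral.integral_of_le zero_le_one, intervalIntegral.integral_of_le zero_le_one,
      integral_Ioc_eq_integral_Ioo, integral_Ioc_eq_integral_Ioo]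
    refine setIntegral_congr_fun measurableSet_Ioo fun x hx => ?_
    exact Int.fract_eq_self.2 ⟨hx.1.le, hx.2⟩
  rw [this, integral_id]
  norm_num

/-- The dither interval is symmetric, so `u` integrates to 0. It is also exactly one period of the
sawtooth, whose fractional part has mean `1 / 2` whatever the shift by `a`. -/
theorem setIntegral_uniformQuantizer_sub {M : ℕ} {γ a : ℝ} (hM : 0 < M) (hγ : 0 < γ)
    (ha : |a| + 2 * γ / M / 2 ≤ γ) :
    ∫ u in Set.Icc (-(2 * γ / M / 2)) (2 * γ / M / 2),
      (uniformQuantizer M γ (a + u) - a) = 0 := by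
  have hM0 : (0 : ℝ) < M := by exact_mod_cast hM
  have hΔ : 0 < 2 * γ / M := by positivity
  rw [integral_Icc_eq_integral_Ioo, setIntegral_congr_fun measurableSet_Ioo fun u hu =>
    uniformQuantizer_add_sub hM hγ ha hu]
  set Δ := 2 * γ / M with hΔdef
  rw [← integral_Ioc_eq_integral_Ioo, ← intervalIntegral.integral_of_le (by linarith)]
  have hfi2 : IntervalIntegrable (fun u => Int.fract (u / Δ + (a + γ) / Δ)) volume
      (-(Δ / 2)) (Δ / 2) :=
    (intervalIntegrable_const (c := (1 : ℝ))).mono_fun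
      (measurable_fract.comp ((measurable_id.div_const _).add_const _)).aestronglyMeasurable
      (Eventually.of_forall fun x => by
        beta_reduce
        rw [norm_one, Real.norm_of_nonneg (Int.fract_nonneg _)]
        exact (Int.fract_lt_one _).le)
  have hid : IntervalIntegrable (fun u : ℝ => u) volume (-(Δ / 2)) (Δ / 2) :=
    continuous_id.intervalIntegrable _ _
  rw [intervalIntegral.integral_add hid
    ((intervalIntegrable_const.sub hfi2).const_mul _), intervalIntegral.integral_const_mul,
    intervalIntegral.integral_sub intervalIntegrable_const hfi2,
    intervalIntegral.integral_comp_div_add (fun x => Int.fract x) hΔ.ne']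
  have hend : Δ / 2 / Δ + (a + γ) / Δ = -(Δ / 2) / Δ + (a + γ) / Δ + 1 := by
    field_simp
    ring
  rw [hend, integral_fract, intervalIntegral.integral_const, integral_id]
  simp only [smul_eq_mul]
  ring

end Quantizer

/-! ### Dithered quantizers produce uncorrelated white noise -/

section Dither

variable {Ω : Type*} [MeasurableSpace Ω] {μ : Measure Ω} [IsProbabilityMeasure μ]

/-- The error of a dithered quantizer is uncorrelated with every function of variables that are
independent of the dither. -/
theorem integral_uniformQuantizer_sub_mul {α : Type*} [MeasurableSpace α] {M : ℕ} {γ : ℝ}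
    (hM : 0 < M) (hγ : 0 < γ) {X : Ω → α} {U : Ω → ℝ} (hX : Measurable X) (hU : Measurable U)
    (hind : IndepFun X U μ)
    (hunif : pdf.IsUniform U (Set.Icc (-(2 * γ / M / 2)) (2 * γ / M / 2)) μ)
    {a : α → ℝ} (ha : Measurable a) {h : α → ℂ} (hh : Measurable h)
    (hb : ∀ᵐ ω ∂μ, |a (X ω)| + 2 * γ / M / 2 ≤ γ) :
    ∫ ω, ((uniformQuantizer M γ (a (X ω) + U ω) - a (X ω) : ℝ) : ℂ) * h (X ω) ∂μ = 0 := by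
  set F : α × ℝ → ℂ := fun p =>
    ((uniformQuantizer M γ (a p.1 + p.2) - a p.1 : ℝ) : ℂ) * h p.1 with hF
  have hFm : Measurable F :=
    (Complex.measurable_ofReal.comp (((measurable_uniformQuantizer M γ).comp
      ((ha.comp measurable_fst).add measurable_snd)).sub (ha.comp measurable_fst))).mul
      (hh.comp measurable_fst)
  change ∫ ω, F (X ω, U ω) ∂μ = 0
  -- Without integrability the integral is 0 by convention; with it, Fubini integrates over the
  -- dither first.
  by_cases hint : Integrable (fun ω => F (X ω, U ω)) μ
  swap
  · exact integral_undef hint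
  have hmap := (indepFun_iff_map_prod_eq_prod_map_map hX.aemeasurable hU.aemeasurable).1 hind
  have : IsProbabilityMeasure (μ.map X) := Measure.isProbabilityMeasure_map hX.aemeasurable
  have : IsProbabilityMeasure (μ.map U) := Measure.isProbabilityMeasure_map hU.aemeasurable
  have hXU : AEMeasurable (fun ω => (X ω, U ω)) μ := (hX.prodMk hU).aemeasurable
  have hint2 : Integrable F ((μ.map X).prod (μ.map U)) := by
    rw [← hmap]
    exact (integrable_map_measure hFm.aestronglyMeasurable hXU).2 hint
  rw [← integral_map (f := F) hXU hFm.aestronglyMeasurable, hmap, integral_prod _ hint2]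
  refine integral_eq_zero_of_ae ?_
  have hb2 : ∀ᵐ x ∂μ.map X, |a x| + 2 * γ / M / 2 ≤ γ :=
    (ae_map_iff hX.aemeasurable (measurableSet_le
      ((continuous_abs.measurable.comp ha).add_const _) measurable_const)).2 hb
  filter_upwards [hb2] with x hx
  have hunif' : μ.map U = cond volume (Set.Icc (-(2 * γ / M / 2)) (2 * γ / M / 2)) := hunif
  simp only [hF]
  rw [integral_mul_const, integral_complex_ofReal, hunif', ProbabilityTheory.cond,
    integral_smul_measure, setIntegral_uniformQuantizer_sub hM hγ hx]
  simp

/-- The joint law factors as `X`, then `V`, then `U`, and associativity of product measures regroups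
it. -/
theorem IndepFun.prodMk_left {α β δ : Type*} [MeasurableSpace α] [MeasurableSpace β]
    [MeasurableSpace δ] {X : Ω → α} {V : Ω → β} {U : Ω → δ} (hX : Measurable X)
    (hV : Measurable V) (hU : Measurable U) (h : IndepFun X (fun ω => (V ω, U ω)) μ)
    (hVU : IndepFun V U μ) : IndepFun (fun ω => (X ω, V ω)) U μ := by
  have := Measure.isProbabilityMeasure_map (μ := μ) hX.aemeasurable
  have := Measure.isProbabilityMeasure_map (μ := μ) hV.aemeasurable
  have := Measure.isProbabilityMeasure_map (μ := μ) hU.aemeasurable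
  have h1 : IndepFun X V μ := h.comp measurable_id measurable_fst
  have e1 := (indepFun_iff_map_prod_eq_prod_map_map hX.aemeasurable hV.aemeasurable).1 h1
  have e2 := (indepFun_iff_map_prod_eq_prod_map_map hX.aemeasurable
    (hV.prodMk hU).aemeasurable).1 h
  have e3 := (indepFun_iff_map_prod_eq_prod_map_map hV.aemeasurable hU.aemeasurable).1 hVU
  refine (indepFun_iff_map_prod_eq_prod_map_map (hX.prodMk hV).aemeasurable
    hU.aemeasurable).2 ?_
  rw [e1]
  refine (MeasurableEquiv.prodAssoc (α := α) (β := β) (γ := δ)).map_measurableEquiv_injective ?_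
  rw [Measure.prodAssoc_prod, ← e3, ← e2,
    Measure.map_map MeasurableEquiv.prodAssoc.measurable ((hX.prodMk hV).prodMk hU)]
  rfl

theorem measurable_stack {m : ℕ} {x : ℕ → Ω → Fin m → ℂ} (hx : ∀ i, Measurable (x i)) (N : ℕ) :
    Measurable (stack x N) :=
  measurable_pi_lambda _ fun p => (measurable_pi_apply p.1).comp (hx _)

theorem measurable_mulVec {m n : Type*} [Fintype n] (A : Matrix m n ℂ) (l : m) :
    Measurable fun v : n → ℂ => A.mulVec v l :=
  Finset.measurable_sum Finset.univ fun j _ =>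
    (measurable_const (a := A l j)).mul (measurable_pi_apply j)

/-- Entry `l` of the error has mean zero given anything independent of the dither entry `l`.
Conditioning on the signals gives zero mean and no correlation with them; adding the dither entry
`m` determines the error entry `m` and gives whiteness off the diagonal. The diagonal is the
hypothesis on the mean squared error. -/
theorem isADCOutput_ditheredQuantizer {K L : ℕ} {g : ℕ → Ω → Fin K → ℂ} {y : ℕ → Ω → Fin L → ℂ}
    (hgm : ∀ i, Measurable (g i)) (hym : ∀ i, Measurable (y i))
    (hg2 : ∀ i k, MemLp (fun ω => g i ω k) 2 μ) (hy2 : ∀ i l, MemLp (fun ω => y i ω l) 2 μ)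
    {N P M : ℕ} {γ : ℝ} (A : Matrix (Fin P) (Fin L × Fin N) ℂ) {z : Ω → Fin P → ℂ}
    (hM : 0 < M) (hγ : 0 < γ)
    (hz : IsDither μ (fun ω => (stack g N ω, stack y N ω)) (2 * γ / M) z)
    (hload : ∀ l, ∀ᵐ ω ∂μ, |(combined A y ω l).re| + (2 * γ / M) / 2 ≤ γ ∧
      |(combined A y ω l).im| + (2 * γ / M) / 2 ≤ γ)
    (hmse : ∀ l, ∫ ω, ‖ditheredQuantizer M γ (combined A y ω) (z ω) l -
      combined A y ω l‖ ^ 2 ∂μ = (2 * γ / M) ^ 2 / 3) :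
    IsADCOutput μ (stack g N) (stack y N) M γ (combined A y)
      (fun ω => ditheredQuantizer M γ (combined A y ω) (z ω)) := by
  set s : Ω → (Fin K × Fin N → ℂ) × (Fin L × Fin N → ℂ) :=
    fun ω => (stack g N ω, stack y N ω) with hs
  have hsm : Measurable s := (measurable_stack hgm N).prodMk (measurable_stack hym N)
  set e : Fin P → Ω → ℂ := fun l ω =>
    ditheredQuantizer M γ (combined A y ω) (z ω) l - combined A y ω l with he
  have hzl : ∀ l, Measurable fun ω => z ω l := fun l => (measurable_pi_apply l).comp hz.measurable
  have hzre : ∀ l, Measurable fun ω => (z ω l).re := fun l => Complex.measurable_re.comp (hzl l)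
  have hzim : ∀ l, Measurable fun ω => (z ω l).im := fun l => Complex.measurable_im.comp (hzl l)
  set xr : Fin P → (Fin K × Fin N → ℂ) × (Fin L × Fin N → ℂ) → ℝ :=
    fun l p => (A.mulVec p.2 l).re with hxr
  set xi : Fin P → (Fin K × Fin N → ℂ) × (Fin L × Fin N → ℂ) → ℝ :=
    fun l p => (A.mulVec p.2 l).im with hxi
  have hxrm : ∀ l, Measurable (xr l) := fun l =>
    Complex.measurable_re.comp ((measurable_mulVec A l).comp measurable_snd)
  have hxim : ∀ l, Measurable (xi l) := fun l =>
    Complex.measurable_im.comp ((measurable_mulVec A l).comp measurable_snd)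
  -- the error as a function of the signals and one entry of the dither
  set E : Fin P → ((Fin K × Fin N → ℂ) × (Fin L × Fin N → ℂ)) × (ℝ × ℝ) → ℂ := fun l p =>
    ((uniformQuantizer M γ (xr l p.1 + p.2.1) - xr l p.1 : ℝ) : ℂ) +
      ((uniformQuantizer M γ (xi l p.1 + p.2.2) - xi l p.1 : ℝ) : ℂ) * Complex.I with hE
  have hEm : ∀ l, Measurable (E l) := fun l => by
    have hq := measurable_uniformQuantizer M γ
    have h1 : Measurable fun p : ((Fin K × Fin N → ℂ) × (Fin L × Fin N → ℂ)) × (ℝ × ℝ) =>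
        xr l p.1 := (hxrm l).comp measurable_fst
    have h2 : Measurable fun p : ((Fin K × Fin N → ℂ) × (Fin L × Fin N → ℂ)) × (ℝ × ℝ) =>
        xi l p.1 := (hxim l).comp measurable_fst
    exact (Complex.measurable_ofReal.comp ((hq.comp
        (h1.add (measurable_fst.comp measurable_snd))).sub h1)).add
      ((Complex.measurable_ofReal.comp ((hq.comp
        (h2.add (measurable_snd.comp measurable_snd))).sub h2)).mul_const _)
  have heE : ∀ l ω, e l ω = E l (s ω, ((z ω l).re, (z ω l).im)) := fun l ω => by
    apply Complex.ext <;> simp [he, hE, ditheredQuantizer, xr, xi, s, combined]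
  have hem : ∀ l, Measurable (e l) := fun l => by
    rw [show e l = fun ω => E l (s ω, ((z ω l).re, (z ω l).im)) from funext (heE l)]
    exact (hEm l).comp (hsm.prodMk ((hzre l).prodMk (hzim l)))
  have heL : ∀ l, MemLp (e l) 2 μ := fun l => by
    -- Quantizer output and input are each at most `γ` in absolute value, so each of the two real
    -- components of the error is at most `2 * γ`.
    refine MemLp.of_bound (hem l).aestronglyMeasurable (4 * γ) ?_
    filter_upwards [hload l] with ω hω
    have hΔ : 0 ≤ 2 * γ / M / 2 := by positivity
    have hb : ∀ a u : ℝ, |a| + 2 * γ / M / 2 ≤ γ → |uniformQuantizer M γ (a + u) - a| ≤ 2 * γ :=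
      fun a u ha => (abs_sub _ _).trans
        (by linarith [abs_uniformQuantizer_le hM hγ (a + u)])
    have h1 := hb _ (z ω l).re hω.1
    have h2 := hb _ (z ω l).im hω.2
    refine (Complex.norm_le_abs_re_add_abs_im _).trans ?_
    simp only [he, ditheredQuantizer, Complex.sub_re, Complex.sub_im, Complex.add_re,
      Complex.add_im]
    linarith
  -- uncorrelatedness with functions of variables independent of one entry of the dither
  have key : ∀ {α : Type _} [MeasurableSpace α] (X : Ω → α), Measurable X →
      ∀ (p : α → (Fin K × Fin N → ℂ) × (Fin L × Fin N → ℂ)), Measurable p →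
      (∀ ω, p (X ω) = s ω) → ∀ l, IndepFun X (fun ω => (z ω l).re) μ →
      IndepFun X (fun ω => (z ω l).im) μ → ∀ h : α → ℂ, Measurable h →
      MemLp (fun ω => h (X ω)) 2 μ → ∫ ω, e l ω * h (X ω) ∂μ = 0 := by
    intro α _ X hX p hp hpX l hir hii h hh hh2
    have hr := integral_uniformQuantizer_sub_mul hM hγ hX (hzre l) hir (hz.uniform_re l)
      ((hxrm l).comp hp) hh (by
        filter_upwards [hload l] with ω hω
        simp only [Function.comp_apply, hpX]
        exact hω.1)
    have hi := integral_uniformQuantizer_sub_mul hM hγ hX (hzim l) hii (hz.uniform_im l)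
      ((hxim l).comp hp) hh (by
        filter_upwards [hload l] with ω hω
        simp only [Function.comp_apply, hpX]
        exact hω.2)
    simp only [Function.comp_apply, hpX] at hr hi
    have h1 : MemLp (fun ω => (((e l ω).re : ℝ) : ℂ)) 2 μ := (heL l).re.ofReal
    have h2 : MemLp (fun ω => (((e l ω).im : ℝ) : ℂ)) 2 μ := (heL l).im.ofReal
    have hre : ∀ ω, (e l ω).re = uniformQuantizer M γ (xr l (s ω) + (z ω l).re) - xr l (s ω) :=
      fun ω => by simp [he, ditheredQuantizer, xr, s, combined]
    have him : ∀ ω, (e l ω).im = uniformQuantizer M γ (xi l (s ω) + (z ω l).im) - xi l (s ω) :=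
      fun ω => by simp [he, ditheredQuantizer, xi, s, combined]
    have hi1 : Integrable (fun ω => ((e l ω).re : ℂ) * h (X ω)) μ := h1.integrable_mul hh2
    have hi2 : Integrable (fun ω => ((e l ω).im : ℂ) * h (X ω)) μ := h2.integrable_mul hh2
    have hsplit : ∀ ω, e l ω * h (X ω) =
        ((e l ω).re : ℂ) * h (X ω) + Complex.I * (((e l ω).im : ℂ) * h (X ω)) := fun ω => by
      nth_rewrite 1 [← Complex.re_add_im (e l ω)]
      ring
    simp only [hsplit]
    rw [integral_add hi1 (hi2.const_mul _),
      integral_const_mul]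
    simp only [hre, him]
    rw [hr, hi]
    simp
  have hsre : ∀ l, IndepFun s (fun ω => (z ω l).re) μ := fun l =>
    (hz.indep_signal.comp (Complex.measurable_re.comp (measurable_pi_apply l))
      measurable_id).symm
  have hsim : ∀ l, IndepFun s (fun ω => (z ω l).im) μ := fun l =>
    (hz.indep_signal.comp (Complex.measurable_im.comp (measurable_pi_apply l))
      measurable_id).symm
  have hcm : Measurable fun w : ℂ => conj w := Complex.continuous_conj.measurable
  refine ⟨heL, fun l => ?_, fun l m => ?_, fun l p => ?_, fun l p => ?_⟩
  · have := key s hsm id measurable_id (fun _ => rfl) l (hsre l) (hsim l) (fun _ => 1)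
      measurable_const (memLp_const 1)
    simpa only [mul_one] using this
  · change ∫ ω, e l ω * conj (e m ω) ∂μ = _
    split_ifs with hlm
    · subst hlm
      have : ∀ ω, e l ω * conj (e l ω) = ((‖e l ω‖ ^ 2 : ℝ) : ℂ) := fun ω => by
        rw [Complex.mul_conj, Complex.normSq_eq_norm_sq]
      simp only [this]
      rw [integral_complex_ofReal]
      exact congrArg _ (hmse l)
    · have hj : ∀ j, Measurable fun ω =>
          Sum.elim (fun l => (z ω l).re) (fun l => (z ω l).im) j := by
        rintro (j | j)
        · exact hzre j
        · exact hzim j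
      have hVm : Measurable fun ω => ((z ω m).re, (z ω m).im) := (hzre m).prodMk (hzim m)
      have hVr : IndepFun (fun ω => ((z ω m).re, (z ω m).im)) (fun ω => (z ω l).re) μ :=
        hz.indep.indepFun_prodMk hj (Sum.inl m) (Sum.inr m) (Sum.inl l)
          (by simpa using Ne.symm hlm) (by simp)
      have hVi : IndepFun (fun ω => ((z ω m).re, (z ω m).im)) (fun ω => (z ω l).im) μ :=
        hz.indep.indepFun_prodMk hj (Sum.inl m) (Sum.inr m) (Sum.inr l)
          (by simp) (by simpa using Ne.symm hlm)
      have hVz : Measurable fun w : Fin P → ℂ => ((w m).re, (w m).im) :=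
        (Complex.measurable_re.comp (measurable_pi_apply m)).prodMk
          (Complex.measurable_im.comp (measurable_pi_apply m))
      have hir : IndepFun (fun ω => (s ω, ((z ω m).re, (z ω m).im))) (fun ω => (z ω l).re) μ :=
        IndepFun.prodMk_left hsm hVm (hzre l)
          (hz.indep_signal.comp (hVz.prodMk (Complex.measurable_re.comp (measurable_pi_apply l)))
            measurable_id).symm hVr
      have hii : IndepFun (fun ω => (s ω, ((z ω m).re, (z ω m).im))) (fun ω => (z ω l).im) μ :=
        IndepFun.prodMk_left hsm hVm (hzim l)
          (hz.indep_signal.comp (hVz.prodMk (Complex.measurable_im.comp (measurable_pi_apply l)))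
            measurable_id).symm hVi
      have hmem : MemLp (fun ω => conj (E m (s ω, ((z ω m).re, (z ω m).im)))) 2 μ := by
        simp only [← heE]
        exact (heL m).star
      have := key _ (hsm.prodMk hVm) Prod.fst measurable_fst (fun _ => rfl) l hir hii
        (fun p => conj (E m p)) (hcm.comp (hEm m)) hmem
      simpa only [← heE] using this
  · exact key s hsm id measurable_id (fun _ => rfl) l (hsre l) (hsim l) (fun v => conj (v.2 p))
      (hcm.comp ((measurable_pi_apply p).comp measurable_snd)) (hy2 _ _).star
  · exact key s hsm id measurable_id (fun _ => rfl) l (hsre l) (hsim l) (fun v => conj (v.1 p))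
      (hcm.comp ((measurable_pi_apply p).comp measurable_fst)) (hg2 _ _).star

end Dither

end TaskQuant
-- The main theorem
theorem theorem3 {Ω : Type*} [MeasurableSpace Ω] (μ : Measure Ω) [IsProbabilityMeasure μ]
    {K L : ℕ} (g : ℕ → Ω → Fin K → ℂ) (y : ℕ → Ω → Fin L → ℂ)
    (Cg : Matrix (Fin K) (Fin K) ℂ) (Cy : Matrix (Fin L) (Fin L) ℂ)
    (Γ : Matrix (Fin K) (Fin L) ℂ) (c : ℤ → ℂ)
    (hmodel : SignalModel μ g y Cg Cy Γ c) (hCy : Cy.PosDef) (hΓ : Γ ≠ 0)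
    (R η : ℝ) (hη : 0 < η) :
    -- Dithered uniform quantizers that are not overloaded and whose mean squared error is
    -- `Δ²/3` per complex entry have outputs of the required form.
    (∀ (N P M : ℕ) (γ : ℝ) (A : Matrix (Fin P) (Fin L × Fin N) ℂ) (z : Ω → Fin P → ℂ),
      2 ≤ M → 0 < γ →
      IsDither μ (fun ω => (stack g N ω, stack y N ω))
        (2 * γ / M) z →
      (∀ l, ∀ᵐ ω ∂μ, |(combined A y ω l).re| + (2 * γ / M) / 2 ≤ γ ∧
        |(combined A y ω l).im| + (2 * γ / M) / 2 ≤ γ) →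
      (∀ l, ∫ ω, ‖ditheredQuantizer M γ (combined A y ω) (z ω) l -
        combined A y ω l‖ ^ 2 ∂μ = (2 * γ / M) ^ 2 / 3) →
      IsADCOutput μ (stack g N) (stack y N) M γ
        (combined A y)
        (fun ω => ditheredQuantizer M γ (combined A y ω) (z ω))) ∧
    -- The optimal system for `N` observations and `P` scalar quantizers.
    (∀ N P M : ℕ, 1 ≤ N → 1 ≤ P → P ≤ L * N → M = resolution R (ratio L N P) →
      η < √(3 / 2) * M →
      (∃! ζ : ℝ, IsWaterLevel Cy Γ c (kappa η M) M N P ζ) ∧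
      Nonempty (Design Cy Γ c η M N P) ∧
      ∀ D : Design Cy Γ c η M N P,
        adcSupport μ η M (combined D.analog y) ^ 2 = kappa η M / ratio L N P ∧
        ∀ qo : Ω → Fin P → ℂ, IsSystemOutput μ g y η M D.analog qo →
          ∀ (A : Matrix (Fin P) (Fin L × Fin N) ℂ) (B : Matrix (Fin K × Fin N) (Fin P) ℂ)
            (q : Ω → Fin P → ℂ), IsSystemOutput μ g y η M A q →
            avgMSE μ (stack g N) D.dig qo ≤ avgMSE μ (stack g N) B q) ∧
    -- The asymptotic performance.
    (∀ (N P : ℕ → ℕ) (Pq M : ℕ) (r : ℝ),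
      Tendsto N atTop atTop → (∀ n, 1 ≤ N n) → (∀ n, 1 ≤ P n) → (∀ n, P n ≤ L * N n) →
      (∀ n, P n / N n = Pq) → 0 < r →
      Tendsto (fun n => ratio L (N n) (P n)) atTop (𝓝 r) →
      (∀ n, resolution R (ratio L (N n) (P n)) = M) →
      η < √(3 / 2) * M →
      ∀ (D : ∀ n, Design Cy Γ c η M (N n) (P n)) (q : ∀ n, Ω → Fin (P n) → ℂ),
        (∀ n, IsSystemOutput μ g y η M (D n).analog (q n)) →
        ((Γ * Cy * Γ.conjTranspose).rank ≤ Pq →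
          ∃ ζ : ℝ, 0 < ζ ∧ Tendsto (fun n => (D n).ζ) atTop (𝓝 ζ) ∧
            4 * kappa η M / (3 * (M : ℝ) ^ 2 * (r * L)) *
              ((1 / (2 * Real.pi)) * ∫ w in (0 : ℝ)..(2 * Real.pi), ∑ i ∈ Finset.range K,
                wf (ζ * (sv (gammaTilde Cy Γ) i *
                  √(psd c w)))) = 1 ∧
            Tendsto
              (fun n => avgMSE μ (stack g (N n)) (D n).dig (q n)) atTop
              (𝓝 (mmseValue Cg Cy Γ +
                (1 / (2 * Real.pi)) * ∫ w in (0 : ℝ)..(2 * Real.pi),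
                  (1 / (K : ℝ)) * ∑ i ∈ Finset.range K,
                    sv (gammaTilde Cy Γ) i ^ 2 * psd c w /
                      (wf (ζ * (sv (gammaTilde Cy Γ) i *
                        √(psd c w))) + 1)))) ∧
        ((∀ τ : ℤ, c τ = if τ = 0 then 1 else 0) →
          ∃ ζ : ℝ, 0 < ζ ∧ Tendsto (fun n => (D n).ζ) atTop (𝓝 ζ) ∧
            4 * kappa η M / (3 * (M : ℝ) ^ 2 * (r * L)) *
              (∑ i ∈ Finset.range Pq,
                  wf (ζ * sv (gammaTilde Cy Γ) i) +
                (r * L - Pq) * wf (ζ * sv (gammaTilde Cy Γ) Pq)) =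
              1 ∧
            Tendsto
              (fun n => avgMSE μ (stack g (N n)) (D n).dig (q n)) atTop
              (𝓝 (mmseValue Cg Cy Γ +
                (1 / (K : ℝ)) * ∑ i ∈ Finset.range (min K Pq),
                  sv (gammaTilde Cy Γ) i ^ 2 /
                    (wf (ζ * sv (gammaTilde Cy Γ) i) + 1) +
                if Pq < K then
                  (1 / (K : ℝ)) * (∑ i ∈ Finset.Ico Pq K,
                      sv (gammaTilde Cy Γ) i ^ 2 -
                    (r * L - Pq) *
                      (sv (gammaTilde Cy Γ) Pq ^ 2 *
                        wf (ζ * sv (gammaTilde Cy Γ) Pq) /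
                        (wf (ζ * sv (gammaTilde Cy Γ) Pq) + 1)))
                else 0)))) := by
  have hL := pos_of_gamma_ne_zero hΓ
  have hT := hmodel.posDef_toeplitz hCy hL
  refine ⟨fun N P M γ A z hM hγ hz hload hmse =>
    isADCOutput_ditheredQuantizer hmodel.measurable_g hmodel.measurable_y hmodel.memLp_g
      hmodel.memLp_y A (by omega) hγ hz hload hmse, ?_, ?_⟩
  · intro N P M hN hP hPLN _ hM
    have hr := ratio_pos hL hN hP
    refine ⟨existsUnique_isWaterLevel hCy hΓ hN hP (hT N) hη hM,
      nonempty_design hCy hΓ hN hP hPLN (hT N) hη hM, fun D =>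
      ⟨hmodel.sq_adcSupport_design hCy (hT N) hη hM hP hPLN hr D, fun qo hqo A B q hq => ?_⟩⟩
    exact (hmodel.avgMSE_design hCy (hT N) hη hM hP hPLN hr D hqo).trans_le
      (hmodel.avgMSE_ge hCy (hT N) hη hM hP hPLN D B hq)
  · intro N P Pq M r hN hN1 hP1 hPLN hPq hr hratio _ hM D q hq
    exact ⟨fun hrank => hmodel.asymptotics_of_rank_le hCy hΓ hη hM hN hN1 hP1 hPLN hPq hr hratio
        D q hq hrank,
      fun hc => hmodel.asymptotics_of_white hCy hΓ hη hM hN1 hP1 hPLN hPq hr hratio D q hq hc⟩
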